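/- **Theorem (Nonparametric regression, random design).** *Data and true model.* For every $n$ we observe i.i.d. pairs $(X_1,Y_1),\dots,(X_n,Y_n)$ with $Y_i=f_0(X_i)+\varepsilon_i$, $X_i\sim Q$, $\varepsilon_i\sim N(0,\sigma_0^2)$ independent of $X_i$, where $Q$ is a probability measure supported in $[0,1]^p$ with a Lebesgue density bounded by a constant independent of $n$. The quantities $p,d,R\in\mathbb N$ ($d,R\ge 1$), $\lambda>0$, $\bar\alpha\in(0,1]$, $f_0,\sigma_0^2,Q$ and all objects below may depend on $n$ unless they are called constants; $\lesssim,\asymp$ are for all large $n$, with constants independent of $n$. Assume: 1. $f_0:[0,1]^p\to\mathbb R$ is measurable and $f_0(x)=h_0(x_{S_0})$ for some $S_0=\{s_1<\dots<s_d\}\subseteq\{1,\dots,p\}$ and $h_0:[0,1]^d\to\mathbb R$. There are a partition $(\Xi_1,\dots,\Xi_R)$ of $[0,1]^d$ into boxes (products of intervals) and $\alpha_r=(\alpha_{r1},\dots,\alpha_{rd})\in(0,1]^d$ with $\bar\alpha^{-1}=d^{-1}\sum_j\alpha_{rj}^{-1}$ for every $r$, such that $|h_0(x)-h_0(y)|\le\lambda\sum_j|x_j-y_j|^{\alpha_{rj}}$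 for $x,y\in\Xi_r$ and every $r$. Moreover $\lambda\ge n^{-a}$ for all large $n$, for some constant $a<1/2$ (for example, $\lambda$ is bounded away from zero). 2. $\epsilon_n\to0$, where $\epsilon_n=\sqrt{d\log p/n}+\bar\epsilon_n$ and $\bar\epsilon_n=(\lambda d)^{d/(2\bar\alpha+d)}\big(R\log n/n\big)^{\bar\alpha/(2\bar\alpha+d)}$. 3. $\|f_0\|_\infty\le C_0^*$ and $\sigma_0^2\in[C_0^{-1},C_0]$ for constants $C_0^*>0$, $C_0>1$. *Split-net.* Let $\mathcal Z=\{z_1,\dots,z_{b_n}\}\subset[0,1]^p$ be deterministic and let $[\mathcal Z]_j$ be the set of the $j$th coordinates of its points. A $\mathcal Z$-tree partition arises from $[0,1]^p$ by successive splits of a box $\Omega$ into $\{x\in\Omega:x_j\le\tau\}$ and $\{x\in\Omega:x_j>\tau\}$ with $\tau\in[\mathcal Z]_j\cap\mathrm{int}([\Omega]_j)$, where $[\Omega]_j$ is the $j$th side of $\Omega$; the depth of a node is the number of splits that lead to it. Given a box $\Omega$, $\alpha\in(0,1]^d$ and $L\ge1$, the anisotropic $k$-d tree on $\Omega$ starts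 with $l_1=\dots=l_d=0$ and in each of $L$ rounds takes the smallest $j$ that minimizes $l_j\alpha_j$, splits every current box $\Psi$ along coordinate $s_j$ at the $\lceil m/2\rceil$th smallest of the $m$ points of $[\mathcal Z]_{s_j}\cap\mathrm{int}([\Psi]_{s_j})$, and increases $l_j$ by one. $\mathcal Z$ is $(\Omega,\alpha,L,S_0)$-regular if all $L$ rounds can be carried out (every $m\ge 1$) and the final boxes $\Psi$ satisfy $\mathrm{len}([\Psi]_{s_j})\lesssim \mathrm{len}([\Omega]_{s_j})2^{-l_j}$ for all $j$. Assume: 4. $\max_j\log|[\mathcal Z]_j|\lesssim\log n$. 5. There are a $\mathcal Z$-tree partition $\mathcal T^*=(\Omega_1^*,\dots,\Omega_R^*)$ whose splits are along coordinates in $S_0$ and whose boxes have depth $\lesssim\log n$, and an integer $L_0>0$ with $2^{L_0}\asymp(\lambda^2d^2n/(R\log n))^{d/(2\bar\alpha+d)}$, such that $\mathcal Z$ is $(\Omega_r^*,\alpha_r,L_0,S_0)$-regular for $r=1,\dots,R$ (uniformly in $r$) and, for the partition $\widehat{\mathcal T}$ obtained by subdividing every $\Omega_r^*$ by its anisotropic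 $k$-d tree with $L_0$ rounds, some function $\hat f_0$ that is constant on each box of $\widehat{\mathcal T}$ satisfies $\|f_0-\hat f_0\|_{L_2([0,1]^p)}\lesssim\bar\epsilon_n$. *Prior.* Fix constants $T\ge1$, $\nu\in(0,1/2)$, $\zeta>0$, $\xi>1$. Let $\eta\sim\mathrm{Dir}(\zeta/p^\xi,\dots,\zeta/p^\xi)$ on the simplex in $\mathbb R^p$. Given $\eta$, trees $\mathcal T^1,\dots,\mathcal T^T$ are drawn independently: starting from the root $[0,1]^p$ of depth $0$, a node $\Omega$ of depth $\ell$ is split with probability $\nu^{\ell+1}$, along a coordinate $j$ drawn from $\eta$, at a point drawn uniformly from $[\mathcal Z]_j\cap\mathrm{int}([\Omega]_j)$ (if this set is empty, the node stays terminal). For constants $\overline C_1>C_0^*$, $\overline C_2>C_0$ and $c>0$: given the numbers $K^1,\dots,K^T$ of terminal nodes, the step-heights $B=(\beta^t_k)_{t\le T,\,k\le K^t}$ have a prior on $[-\overline C_1,\overline C_1]^{K^1+\dots+K^T}$ with a Lebesgue density that is at least $c^{K^1+\dots+K^T}$ there (for example a centred normal prior, truncated to this cube, with covariance eigenvalues bounded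 below and above); independently, $\sigma^2$ has a prior on $[\overline C_2^{-1},\overline C_2]$ with a Lebesgue density that is at least $c$ there (for example a truncated inverse gamma prior). Let $\Pi(\cdot\mid\cdot)$ be the resulting posterior distribution of $(f,\sigma^2)$, where $f(x)=\sum_{t=1}^T\sum_{k=1}^{K^t}\beta_k^t\,\mathbb 1(x\in\Omega_k^t)$ and $\mathcal T^t=(\Omega^t_1,\dots,\Omega^t_{K^t})$. *Conclusion.* There is a constant $M>0$ such that $$\mathbb E_0\,\Pi\Big\{(f,\sigma^2):\ \|f-f_0\|_{L_2(Q)}+|\sigma^2-\sigma_0^2|>M\epsilon_n\ \Big|\ (X_1,Y_1),\dots,(X_n,Y_n)\Big\}\longrightarrow0\qquad(n\to\infty).$$ -/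

import Mathlib

open MeasureTheory ProbabilityTheory Filter Topology
open scoped ENNReal NNReal

noncomputable section

namespace Forest

/-! ### Boxes, box partitions, and piecewise heterogeneous anisotropic Hölder functions -/

/-- The unit cube `[0,1]^p`. -/
def cube (p : ℕ) : Set (Fin p → ℝ) := Set.Icc 0 1

/-- A box in `[0,1]^d`: a product of nonempty subintervals of `[0,1]`; each side may be open,
closed or half-closed. -/
def IsBox {d : ℕ} (Ψ : Set (Fin d → ℝ)) : Prop :=
  ∃ I : Fin d → Set ℝ,
    (∀ j, (I j).OrdConnected ∧ (I j).Nonempty ∧ I j ⊆ Set.Icc 0 1) ∧ Ψ = Set.univ.pi I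

/-- A box partition of `[0,1]^d` into `R` boxes. -/
def IsBoxPartition {d R : ℕ} (Ξ : Fin R → Set (Fin d → ℝ)) : Prop :=
  (∀ r, IsBox (Ξ r)) ∧ Pairwise (fun r r' => Disjoint (Ξ r) (Ξ r')) ∧ ⋃ r, Ξ r = cube d

/-- The set of `R`-tuples of smoothness vectors in `(0,1]^d` with common harmonic mean `abar`. -/
def SmoothnessTuples (R d : ℕ) (abar : ℝ) : Set (Fin R → Fin d → ℝ) :=
  {α | (∀ r j, 0 < α r j ∧ α r j ≤ 1) ∧ ∀ r, abar⁻¹ = (d : ℝ)⁻¹ * ∑ j, (α r j)⁻¹}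

/-- The anisotropic `α`-Hölder condition on `Ψ` with coefficient `lam`. -/
def AnisoHolderOn {d : ℕ} (lam : ℝ) (α : Fin d → ℝ) (Ψ : Set (Fin d → ℝ))
    (h : (Fin d → ℝ) → ℝ) : Prop :=
  ∀ x ∈ Ψ, ∀ y ∈ Ψ, |h x - h y| ≤ lam * ∑ j, |x j - y j| ^ α j

/-- `f` belongs to the `d`-sparse piecewise heterogeneous anisotropic Hölder space, with the
active coordinates `S` (a subset of `{1,…,p}` of size `d`, listed increasingly):
`f(x) = h(x_S)` on the cube, with `h` Hölder on every box `Ξ r`. -/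
def SparseHolder {p d R : ℕ} (lam : ℝ) (α : Fin R → Fin d → ℝ) (Ξ : Fin R → Set (Fin d → ℝ))
    (S : Fin d ↪o Fin p) (f : (Fin p → ℝ) → ℝ) : Prop :=
  ∃ h : (Fin d → ℝ) → ℝ,
    (∀ r, AnisoHolderOn lam (α r) (Ξ r) h) ∧ ∀ x ∈ cube p, f x = h (fun j => x (S j))

/-- The second part of the rate,
`(λ d)^{d/(2ᾱ+d)} (R log n / n)^{ᾱ/(2ᾱ+d)}`. -/
def approxRate (n d R : ℕ) (lam abar : ℝ) : ℝ :=
  (lam * d) ^ ((d : ℝ) / (2 * abar + d)) * (R * Real.log n / n) ^ (abar / (2 * abar + d))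

/-- The contraction rate `√(d log p / n) + (λ d)^{d/(2ᾱ+d)} (R log n / n)^{ᾱ/(2ᾱ+d)}`. -/
def rate (n p d R : ℕ) (lam abar : ℝ) : ℝ :=
  √(d * Real.log p / n) + approxRate n d R lam abar

/-! ### Split-nets and binary trees that split at points of a split-net -/

variable {p b : ℕ}

/-- `[Z]_j`, the finite set of the `j`th coordinates of the split-net `Z = {z_1,…,z_b}`. -/
def coordSet (Z : Fin b → Fin p → ℝ) (j : Fin p) : Finset ℝ :=
  Finset.univ.image fun i => Z i j

/-- A node of a tree: the box with `j`th projection of interior `(lo j, hi j)`. -/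
structure Cell (p : ℕ) where
  lo : Fin p → ℝ
  hi : Fin p → ℝ

namespace Cell

/-- The root node `[0,1]^p`. -/
def unit (p : ℕ) : Cell p := ⟨fun _ => 0, fun _ => 1⟩

/-- The part `x_j ≤ τ` of a box. -/
def left (Ω : Cell p) (j : Fin p) (τ : ℝ) : Cell p := ⟨Ω.lo, Function.update Ω.hi j τ⟩

/-- The part `x_j > τ` of a box. -/
def right (Ω : Cell p) (j : Fin p) (τ : ℝ) : Cell p := ⟨Function.update Ω.lo j τ, Ω.hi⟩

/-- The length of the `j`th side. -/
def len (Ω : Cell p) (j : Fin p) : ℝ := Ω.hi j - Ω.lo j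

/-- `[Z]_j ∩ int([Ω]_j)`: the split-candidates in `Ω` for the coordinate `j`. -/
def cand (Z : Fin b → Fin p → ℝ) (Ω : Cell p) (j : Fin p) : Finset ℝ :=
  (coordSet Z j).filter fun τ => Ω.lo j < τ ∧ τ < Ω.hi j

/-- `τ` is the midpoint-split of `Ω` along `j`: the `⌈m/2⌉`th smallest of the `m` candidates. -/
def IsMidpoint (Z : Fin b → Fin p → ℝ) (Ω : Cell p) (j : Fin p) (τ : ℝ) : Prop :=
  τ ∈ Ω.cand Z j ∧
    ((Ω.cand Z j).filter fun c => c ≤ τ).card = ((Ω.cand Z j).card + 1) / 2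

end Cell

/-- Binary trees whose inner nodes carry a splitting coordinate `j` and a split-point
`τ ∈ [Z]_j`. -/
inductive ZTree (Z : Fin b → Fin p → ℝ) : Type
  | leaf : ZTree Z
  | node (j : Fin p) (τ : {τ : ℝ // τ ∈ coordSet Z j}) (l r : ZTree Z) : ZTree Z

namespace ZTree

variable {Z : Fin b → Fin p → ℝ}

/-- The number `K` of terminal nodes. -/
def numLeaves : ZTree Z → ℕ
  | leaf => 1
  | node _ _ l r => l.numLeaves + r.numLeaves

/-- The largest depth of a terminal node (the root has depth `0`). -/
def height : ZTree Z → ℕ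
  | leaf => 0
  | node _ _ l r => max l.height r.height + 1

/-- All splitting coordinates belong to `S`. -/
def ChoppedIn (S : Set (Fin p)) : ZTree Z → Prop
  | leaf => True
  | node j _ l r => j ∈ S ∧ l.ChoppedIn S ∧ r.ChoppedIn S

/-- Started at the box `Ω`, every split-point lies in the interior of the projection of the box
that it splits. -/
def Valid : ZTree Z → Cell p → Prop
  | leaf, _ => True
  | node j τ l r, Ω =>
      (τ : ℝ) ∈ Ω.cand Z j ∧ l.Valid (Ω.left j τ) ∧ r.Valid (Ω.right j τ)

/-- The label of the terminal node that contains `x` (terminal nodes are numbered from left to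
right). -/
def leafIdx : (t : ZTree Z) → (Fin p → ℝ) → Fin t.numLeaves
  | leaf, _ => (0 : Fin 1)
  | node j τ l r, x =>
      if x j ≤ (τ : ℝ) then Fin.castAdd r.numLeaves (l.leafIdx x)
      else Fin.natAdd l.numLeaves (r.leafIdx x)

/-- The box of the `k`th terminal node of the tree started at `Ω`. -/
def leafCell : (t : ZTree Z) → Cell p → Fin t.numLeaves → Cell p
  | leaf, Ω, _ => Ω
  | node j τ l r, Ω, k =>
      Fin.addCases (motive := fun _ => Cell p)
        (fun i => l.leafCell (Ω.left j τ) i) (fun i => r.leafCell (Ω.right j τ) i) k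

/-- Replace the `k`th terminal node of `t` by the tree `g k`, for every `k`. -/
def graft : (t : ZTree Z) → (Fin t.numLeaves → ZTree Z) → ZTree Z
  | leaf, g => g (0 : Fin 1)
  | node j τ l r, g =>
      node j τ (l.graft fun i => g (Fin.castAdd r.numLeaves i))
        (r.graft fun i => g (Fin.natAdd l.numLeaves i))

/-- The step function `∑ₖ βₖ 1(x ∈ Ωₖ)` of a tree. -/
def stepFun (t : ZTree Z) (β : Fin t.numLeaves → ℝ) (x : Fin p → ℝ) : ℝ := β (t.leafIdx x)

end ZTree

/-! ### Anisotropic k-d trees and the approximation assumption -/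

/-- The next coordinate of the anisotropic k-d tree: the smallest `j` minimising `l_j α_j`. -/
def akdNext {d : ℕ} (α : Fin d → ℝ) (l : Fin d → ℕ) : Option (Fin d) :=
  (List.finRange d).argmin fun j => (l j : ℝ) * α j

/-- The counters `(l_1,…,l_d)` after `m` rounds of the anisotropic k-d tree. -/
def akdCount {d : ℕ} (α : Fin d → ℝ) : ℕ → Fin d → ℕ
  | 0 => fun _ => 0
  | m + 1 =>
      match akdNext α (akdCount α m) with
      | none => akdCount α m
      | some j => Function.update (akdCount α m) j (akdCount α m j + 1)

/-- `t` results from the box `Ω` by the rounds `i+1,…,i+m` of the anisotropic k-d tree, all the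
midpoint-splits being available. -/
def IsAKDFrom {d : ℕ} (Z : Fin b → Fin p → ℝ) (α : Fin d → ℝ) (S : Fin d ↪o Fin p) :
    (m i : ℕ) → Cell p → ZTree Z → Prop
  | 0, _, _, t => t = ZTree.leaf
  | m + 1, i, Ω, t =>
      ∃ (j : Fin d) (τ : {τ : ℝ // τ ∈ coordSet Z (S j)}) (l r : ZTree Z),
        akdNext α (akdCount α i) = some j ∧ Ω.IsMidpoint Z (S j) τ ∧
        t = ZTree.node (S j) τ l r ∧
        IsAKDFrom Z α S m (i + 1) (Ω.left (S j) τ) l ∧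
        IsAKDFrom Z α S m (i + 1) (Ω.right (S j) τ) r

/-- The split-net is `(Ψ, α, L, S)`-regular with constant `C`, and `t` is the tree returned by the
anisotropic k-d tree on `Ψ`: all `L` rounds are available, and the `s_j`th sides of the final boxes
have length at most `C · len([Ψ]_{s_j}) · 2^{-l_j}`. -/
def IsRegularAKD {d : ℕ} (C : ℝ) (Z : Fin b → Fin p → ℝ) (α : Fin d → ℝ) (S : Fin d ↪o Fin p)
    (L : ℕ) (Ψ : Cell p) (t : ZTree Z) : Prop :=
  IsAKDFrom Z α S L 0 Ψ t ∧
    ∀ (k : Fin t.numLeaves) (j : Fin d),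
      (t.leafCell Ψ k).len (S j) ≤ C * Ψ.len (S j) * (2 : ℝ)⁻¹ ^ akdCount α L j

/-- The assumption on the split-net (with constant `C`): for some tree partition
`Tstar = (Ω*_1,…,Ω*_R)` with as many boxes as the partition underlying `f`, splits along active
coordinates and depth at most `C log n`, and an integer `L > 0` with
`2^L ≍ (λ² d² n / (R log n))^{d/(2ᾱ+d)}`, the split-net is `(Ω*_r, α_r, L, S)`-regular for every
`r`, and the tree partition obtained by subdividing every `Ω*_r` by its anisotropic k-d tree
carries a step function with `L₂`-distance at most `C · approxRate` from `f`. -/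
def SplitNetApprox {d R : ℕ} (C : ℝ) (n : ℕ) (Z : Fin b → Fin p → ℝ) (S : Fin d ↪o Fin p)
    (α : Fin R → Fin d → ℝ) (lam abar : ℝ) (f : (Fin p → ℝ) → ℝ) : Prop :=
  ∃ (Tstar : ZTree Z) (lab : Fin Tstar.numLeaves ≃ Fin R) (L : ℕ)
    (sub : Fin Tstar.numLeaves → ZTree Z) (β : Fin (Tstar.graft sub).numLeaves → ℝ),
    Tstar.Valid (Cell.unit p) ∧ Tstar.ChoppedIn (Set.range S) ∧
    (Tstar.height : ℝ) ≤ C * Real.log n ∧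
    0 < L ∧
    (lam ^ 2 * d ^ 2 * n / (R * Real.log n)) ^ ((d : ℝ) / (2 * abar + d)) ≤ C * 2 ^ L ∧
    (2 : ℝ) ^ L ≤ C * (lam ^ 2 * d ^ 2 * n / (R * Real.log n)) ^ ((d : ℝ) / (2 * abar + d)) ∧
    (∀ k, IsRegularAKD C Z (α (lab k)) S L (Tstar.leafCell (Cell.unit p) k) (sub k)) ∧
    eLpNorm (fun x => f x - (Tstar.graft sub).stepFun β x) 2 (volume.restrict (cube p))
      ≤ ENNReal.ofReal (C * approxRate n d R lam abar)

/-! ### The prior -/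

/-- The symmetric Dirichlet distribution `Dir(a,…,a)` on the simplex in `ℝ^p`, as the law of
normalised independent `Gamma(a, 1)` variables. -/
def dirichlet (p : ℕ) (a : ℝ) : Measure (Fin p → ℝ) :=
  (Measure.pi fun _ : Fin p => gammaMeasure a 1).map fun g j => g j / ∑ i, g i

/-- The probability, given the proportions `η`, that the tree process continued at the box `Ω` of
depth `ℓ` grows exactly the given tree. A node of depth `ℓ` attempts to split with probability
`ν^{ℓ+1}`; it then draws a coordinate `j` from `η` and a split-point uniformly from the
split-candidates `[Z]_j ∩ int([Ω]_j)`; if there is no such candidate, the node stays terminal. -/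
def treeProb (Z : Fin b → Fin p → ℝ) (ν : ℝ) (η : Fin p → ℝ) : ZTree Z → ℕ → Cell p → ℝ
  | .leaf, ℓ, Ω =>
      (1 - ν ^ (ℓ + 1)) + ν ^ (ℓ + 1) * ∑ j, if Ω.cand Z j = ∅ then η j else 0
  | .node j τ l r, ℓ, Ω =>
      if (τ : ℝ) ∈ Ω.cand Z j then
        ν ^ (ℓ + 1) * (η j * ((Ω.cand Z j).card : ℝ)⁻¹) *
          (treeProb Z ν η l (ℓ + 1) (Ω.left j τ) * treeProb Z ν η r (ℓ + 1) (Ω.right j τ))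
      else 0

/-- The prior probability of an ensemble of `T` trees: conditionally on
`η ∼ Dir(ζ/p^ξ,…,ζ/p^ξ)` the trees are independent draws of the tree process started at the root
node `[0,1]^p` of depth `0`. -/
def ensembleProb (Z : Fin b → Fin p → ℝ) (ν ζ ξ : ℝ) {T : ℕ} (E : Fin T → ZTree Z) : ℝ≥0∞ :=
  ∫⁻ η, ENNReal.ofReal (∏ t, treeProb Z ν η (E t) 0 (Cell.unit p))
    ∂(dirichlet p (ζ / (p : ℝ) ^ ξ))

/-- Step-heights for `T` trees with `K 1,…,K T` terminal nodes. -/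
abbrev Heights {T : ℕ} (K : Fin T → ℕ) : Type := (t : Fin T) → Fin (K t) → ℝ

/-- The cube `[-C, C]^{K 1 + … + K T}` of step-heights. -/
def heightCube {T : ℕ} (K : Fin T → ℕ) (C : ℝ) : Set (Heights K) :=
  {B | ∀ t k, B t k ∈ Set.Icc (-C) C}

/-- A prior on the step-heights with support `[-C, C]^{K 1 + … + K T}`, given the tree sizes
`K 1,…,K T`: a probability measure on this cube with a Lebesgue density that is bounded below by
`c^{K 1 + … + K T}` there. -/
def IsTruncatedHeightPrior {T : ℕ} (C c : ℝ) (μ : (K : Fin T → ℕ) → Measure (Heights K)) : Prop :=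
  ∀ K : Fin T → ℕ, IsProbabilityMeasure (μ K) ∧
    ∃ g : Heights K → ℝ≥0∞, Measurable g ∧
      (∀ B ∈ heightCube K C, ENNReal.ofReal (c ^ ∑ t, K t) ≤ g B) ∧
      μ K = (volume.restrict (heightCube K C)).withDensity g

/-- A prior on the variance with support `[C⁻¹, C]`: a probability measure on this interval with a
Lebesgue density that is bounded below by `c` there. -/
def IsTruncatedVariancePrior (C c : ℝ) (μ : Measure ℝ) : Prop :=
  IsProbabilityMeasure μ ∧
    ∃ g : ℝ → ℝ≥0∞, Measurable g ∧ (∀ s ∈ Set.Icc C⁻¹ C, ENNReal.ofReal c ≤ g s) ∧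
      μ = (volume.restrict (Set.Icc C⁻¹ C)).withDensity g

/-- The forest `f_{E,B}(x) = ∑_t ∑_k β^t_k 1(x ∈ Ω^t_k)`. -/
def forest {Z : Fin b → Fin p → ℝ} {T : ℕ} (E : Fin T → ZTree Z)
    (B : Heights fun t => (E t).numLeaves) (x : Fin p → ℝ) : ℝ :=
  ∑ t, (E t).stepFun (B t) x

/-! ### Random design regression and the posterior -/

/-- `Q` is supported in `[0,1]^p` with a Lebesgue density bounded by `C`. -/
def HasBoundedDensity (C : ℝ) (Q : Measure (Fin p → ℝ)) : Prop :=
  ∃ q : (Fin p → ℝ) → ℝ≥0∞, Measurable q ∧ (∀ x, q x ≤ ENNReal.ofReal C) ∧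
    Q = (volume.restrict (cube p)).withDensity q

/-- The law of one observation `(X, Y)` with `Y = f(X) + ε`, `X ∼ Q`, `ε ∼ N(0, s)`, and `X`, `ε`
independent. -/
def obsLaw (Q : Measure (Fin p → ℝ)) (f : (Fin p → ℝ) → ℝ) (s : ℝ) :
    Measure ((Fin p → ℝ) × ℝ) :=
  (Q.prod (gaussianReal 0 s.toNNReal)).map fun z => (z.1, f z.1 + z.2)

/-- The likelihood of `(f, s)` for the data `D`, relative to `(Q ⊗ Lebesgue)^n`. -/
def likelihood {n : ℕ} (D : Fin n → (Fin p → ℝ) × ℝ) (f : (Fin p → ℝ) → ℝ) (s : ℝ) : ℝ≥0∞ :=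
  ∏ i, gaussianPDF (f (D i).1) s.toNNReal (D i).2

/-- `∫_A likelihood dΠ` for the prior `Π` on `(f, σ²)` under which the ensemble of trees has the
law `ensembleProb`, the step-heights have the law `μB` given the tree sizes, and, independently,
the variance has the law `μσ`. -/
def evidence (Z : Fin b → Fin p → ℝ) (ν ζ ξ : ℝ) {T : ℕ}
    (μB : (K : Fin T → ℕ) → Measure (Heights K)) (μσ : Measure ℝ) {n : ℕ}
    (D : Fin n → (Fin p → ℝ) × ℝ) (A : Set (((Fin p → ℝ) → ℝ) × ℝ)) : ℝ≥0∞ :=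
  ∑' E : Fin T → ZTree Z, ensembleProb Z ν ζ ξ E *
    ∫⁻ s, ∫⁻ B, A.indicator (fun θ => likelihood D θ.1 θ.2) (forest E B, s)
      ∂(μB fun t => (E t).numLeaves) ∂μσ

/-- The posterior probability of `A` given the data `D`, by Bayes' formula. -/
def posterior (Z : Fin b → Fin p → ℝ) (ν ζ ξ : ℝ) {T : ℕ}
    (μB : (K : Fin T → ℕ) → Measure (Heights K)) (μσ : Measure ℝ) {n : ℕ}
    (D : Fin n → (Fin p → ℝ) × ℝ) (A : Set (((Fin p → ℝ) → ℝ) × ℝ)) : ℝ≥0∞ :=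
  evidence Z ν ζ ξ μB μσ D A / evidence Z ν ζ ξ μB μσ D Set.univ

end Forest

end

namespace Forest

/-! ### Gaussian densities -/

lemma gaussianPDFReal_toNNReal (m : ℝ) {s : ℝ} (hs : 0 < s) (y : ℝ) :
    gaussianPDFReal m s.toNNReal y = (√(2 * Real.pi * s))⁻¹ * Real.exp (-(y - m) ^ 2 / (2 * s)) := by
  rw [gaussianPDFReal_def]; simp [Real.coe_toNNReal _ hs.le]

lemma toNNReal_ne_zero_of_pos {s : ℝ} (hs : 0 < s) : s.toNNReal ≠ 0 := by
  simpa using hs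

/-- Pointwise form of the Hellinger affinity of two normal densities. -/
lemma gaussianPDFReal_mul_le {m m0 s s0 : ℝ} (hs : 0 < s) (hs0 : 0 < s0) (y : ℝ) :
    gaussianPDFReal m s.toNNReal y * gaussianPDFReal m0 s0.toNNReal y ≤
      (Real.exp (-((m - m0) ^ 2 / (4 * (s + s0)) + (s - s0) ^ 2 / (4 * (s + s0) ^ 2))) *
        gaussianPDFReal ((m * s0 + m0 * s) / (s + s0)) (2 * s * s0 / (s + s0)).toNNReal y) ^ 2 := by
  have hp : 0 < Real.pi := Real.pi_pos
  have hss : 0 < s + s0 := by positivity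
  rw [gaussianPDFReal_toNNReal _ hs, gaussianPDFReal_toNNReal _ hs0,
    gaussianPDFReal_toNNReal _ (by positivity)]
  have e1 : (√(2 * Real.pi * s))⁻¹ * Real.exp (-(y - m) ^ 2 / (2 * s)) *
      ((√(2 * Real.pi * s0))⁻¹ * Real.exp (-(y - m0) ^ 2 / (2 * s0))) =
      (2 * Real.pi * √(s * s0))⁻¹ *
        Real.exp (-(y - m) ^ 2 / (2 * s) + -(y - m0) ^ 2 / (2 * s0)) := by
    rw [Real.exp_add]
    have : √(2 * Real.pi * s) * √(2 * Real.pi * s0) = 2 * Real.pi * √(s * s0) := by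
      rw [← Real.sqrt_mul (by positivity),
        show 2 * Real.pi * s * (2 * Real.pi * s0) = (2 * Real.pi) ^ 2 * (s * s0) by ring,
        Real.sqrt_mul (by positivity), Real.sqrt_sq (by positivity)]
    rw [← this, mul_inv]; ring
  have e2 : (Real.exp (-((m - m0) ^ 2 / (4 * (s + s0)) + (s - s0) ^ 2 / (4 * (s + s0) ^ 2))) *
      ((√(2 * Real.pi * (2 * s * s0 / (s + s0))))⁻¹ *
        Real.exp (-(y - (m * s0 + m0 * s) / (s + s0)) ^ 2 / (2 * (2 * s * s0 / (s + s0)))))) ^ 2 =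
      ((2 * Real.pi * (2 * s * s0 / (s + s0)))⁻¹ * Real.exp (-(s - s0) ^ 2 / (2 * (s + s0) ^ 2))) *
        Real.exp (-(y - m) ^ 2 / (2 * s) + -(y - m0) ^ 2 / (2 * s0)) := by
    rw [mul_pow, mul_pow, ← Real.exp_nat_mul, ← Real.exp_nat_mul, inv_pow,
      Real.sq_sqrt (by positivity)]
    rw [mul_left_comm, ← Real.exp_add, mul_assoc _ (Real.exp _) (Real.exp _), ← Real.exp_add]
    congr 2
    push_cast
    field_simp
    ring
  rw [e1, e2]
  gcongr
  have e3 : 2 * √(s * s0) / (s + s0) ≤ Real.exp (-(s - s0) ^ 2 / (2 * (s + s0) ^ 2)) := by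
    apply le_of_sq_le_sq _ (Real.exp_pos _).le
    rw [div_pow, mul_pow, Real.sq_sqrt (by positivity), ← Real.exp_nat_mul]
    have := Real.add_one_le_exp ((2 : ℕ) * (-(s - s0) ^ 2 / (2 * (s + s0) ^ 2)))
    refine le_trans (le_of_eq ?_) this
    push_cast
    field_simp
    ring
  have hq : 0 < √(s * s0) := by positivity
  have hq2 : √(s * s0) ^ 2 = s * s0 := Real.sq_sqrt (by positivity)
  calc (2 * Real.pi * √(s * s0))⁻¹
      = (2 * Real.pi * (2 * s * s0 / (s + s0)))⁻¹ * (2 * √(s * s0) / (s + s0)) := by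
        field_simp
        rw [hq2]
    _ ≤ _ := by gcongr

/-- Pointwise form of the `χ²`-affinity of two normal densities. -/
lemma gaussianPDFReal_sq_le {m m0 s s0 : ℝ} (hs0 : 0 < s0) (hs : s0 ≤ s) (y : ℝ) :
    gaussianPDFReal m0 s0.toNNReal y ^ 2 ≤
      Real.exp ((m - m0) ^ 2 / s0 + (s - s0) ^ 2 / (2 * s0 ^ 2)) *
        gaussianPDFReal ((2 * m0 * s - m * s0) / (2 * s - s0)) (s * s0 / (2 * s - s0)).toNNReal y *
        gaussianPDFReal m s.toNNReal y := by
  have hp : 0 < Real.pi := Real.pi_pos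
  have hs' : 0 < s := hs0.trans_le hs
  have h2 : 0 < 2 * s - s0 := by linarith
  rw [gaussianPDFReal_toNNReal _ hs', gaussianPDFReal_toNNReal _ hs0,
    gaussianPDFReal_toNNReal _ (by positivity)]
  set A := Real.exp (-(y - m0) ^ 2 / s0) with hA
  have e1 : ((√(2 * Real.pi * s0))⁻¹ * Real.exp (-(y - m0) ^ 2 / (2 * s0))) ^ 2 =
      (2 * Real.pi * s0)⁻¹ * A := by
    rw [mul_pow, inv_pow, Real.sq_sqrt (by positivity), ← Real.exp_nat_mul, hA]
    congr 2; push_cast; field_simp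
  have e2 : Real.exp ((m - m0) ^ 2 / (2 * s - s0)) *
      Real.exp (-(y - (2 * m0 * s - m * s0) / (2 * s - s0)) ^ 2 / (2 * (s * s0 / (2 * s - s0)))) *
      Real.exp (-(y - m) ^ 2 / (2 * s)) = A := by
    rw [← Real.exp_add, ← Real.exp_add, hA]
    congr 1
    field_simp
    ring
  have e3 : √(2 * Real.pi * (s * s0 / (2 * s - s0))) * √(2 * Real.pi * s) ≤
      2 * Real.pi * s0 * Real.exp ((s - s0) ^ 2 / (2 * s0 ^ 2)) := by
    rw [← Real.sqrt_mul (by positivity)]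
    apply Real.sqrt_le_iff.2 ⟨by positivity, ?_⟩
    rw [mul_pow, ← Real.exp_nat_mul]
    have h1 := Real.add_one_le_exp ((2 : ℕ) * ((s - s0) ^ 2 / (2 * s0 ^ 2)))
    have h3 : s ^ 2 / (s0 * (2 * s - s0)) ≤ (2 : ℕ) * ((s - s0) ^ 2 / (2 * s0 ^ 2)) + 1 := by
      have : s ^ 2 / (s0 * (2 * s - s0)) = (s - s0) ^ 2 / (s0 * (2 * s - s0)) + 1 := by
        rw [div_add_one (by positivity)]; congr 1; ring
      rw [this]
      have : (s - s0) ^ 2 / (s0 * (2 * s - s0)) ≤ (s - s0) ^ 2 / (s0 * s0) := by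
        gcongr; linarith
      have h4 : (2 : ℕ) * ((s - s0) ^ 2 / (2 * s0 ^ 2)) = (s - s0) ^ 2 / (s0 * s0) := by
        push_cast; field_simp
      linarith
    calc 2 * Real.pi * (s * s0 / (2 * s - s0)) * (2 * Real.pi * s)
        = (2 * Real.pi * s0) ^ 2 * (s ^ 2 / (s0 * (2 * s - s0))) := by field_simp
      _ ≤ _ := by gcongr; exact h3.trans h1
  rw [e1, ← e2, Real.exp_add]
  have e4 : Real.exp ((m - m0) ^ 2 / (2 * s - s0)) ≤ Real.exp ((m - m0) ^ 2 / s0) := by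
    apply Real.exp_le_exp.2
    gcongr
    linarith
  set X := Real.exp (-(y - (2 * m0 * s - m * s0) / (2 * s - s0)) ^ 2 / (2 * (s * s0 / (2 * s - s0))))
  set W := Real.exp (-(y - m) ^ 2 / (2 * s))
  set E := Real.exp ((s - s0) ^ 2 / (2 * s0 ^ 2))
  have e5 : (2 * Real.pi * s0)⁻¹ ≤
      E * (√(2 * Real.pi * (s * s0 / (2 * s - s0))))⁻¹ * (√(2 * Real.pi * s))⁻¹ := by
    rw [mul_assoc E, ← mul_inv, ← div_eq_mul_inv, le_div_iff₀ (by positivity), inv_mul_le_iff₀ (by positivity)]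
    exact e3
  calc (2 * Real.pi * s0)⁻¹ * (Real.exp ((m - m0) ^ 2 / (2 * s - s0)) * X * W)
      ≤ (E * (√(2 * Real.pi * (s * s0 / (2 * s - s0))))⁻¹ * (√(2 * Real.pi * s))⁻¹) *
        (Real.exp ((m - m0) ^ 2 / s0) * X * W) := by gcongr
    _ = _ := by ring

/-- A normal density is dominated by a multiple of a normal density with a nearby mean and a
slightly larger variance. -/
lemma gaussianPDFReal_le_of_near {m g s s' δ : ℝ} (hs : 0 < s) (hδ : 0 < δ) (hm : |m - g| ≤ δ)
    (hs' : s * (1 + δ) ≤ s') (y : ℝ) :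
    gaussianPDFReal m s.toNNReal y ≤
      √(s' / s) * Real.exp (δ / (2 * s)) * gaussianPDFReal g s'.toNNReal y := by
  have hp : 0 < Real.pi := Real.pi_pos
  have hs0 : 0 < s' := lt_of_lt_of_le (by positivity) hs'
  rw [gaussianPDFReal_toNNReal _ hs, gaussianPDFReal_toNNReal _ hs0]
  have e1 : √(s' / s) * (√(2 * Real.pi * s'))⁻¹ = (√(2 * Real.pi * s))⁻¹ := by
    rw [Real.sqrt_div hs0.le, Real.sqrt_mul (x := 2 * Real.pi) (by positivity),
      Real.sqrt_mul (x := 2 * Real.pi) (by positivity)]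
    have h1 : 0 < √s' := by positivity
    have h2 : 0 < √s := by positivity
    have h3 : 0 < √(2 * Real.pi) := by positivity
    field_simp
  have e2 : -(y - m) ^ 2 / (2 * s) ≤ δ / (2 * s) + -(y - g) ^ 2 / (2 * s') := by
    have a1 : (y - g) ^ 2 ≤ (1 + δ) * (y - m) ^ 2 + (δ + δ ^ 2) := by
      have h1 : (m - g) ^ 2 ≤ δ ^ 2 := by rw [← sq_abs]; gcongr
      have h2 : 0 ≤ (δ * (y - m) - (m - g)) ^ 2 / δ := by positivity
      have h3 : (δ * (y - m) - (m - g)) ^ 2 / δ =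
          δ * (y - m) ^ 2 - 2 * (y - m) * (m - g) + (m - g) ^ 2 / δ := by field_simp; ring
      have h4 : (m - g) ^ 2 / δ ≤ δ := by rw [div_le_iff₀ hδ]; linarith [h1, sq δ]
      nlinarith
    have a2 : (y - g) ^ 2 / (2 * s') ≤ (y - g) ^ 2 / (2 * (s * (1 + δ))) := by gcongr
    have a3 : (y - g) ^ 2 / (2 * (s * (1 + δ))) ≤
        ((1 + δ) * (y - m) ^ 2 + (δ + δ ^ 2)) / (2 * (s * (1 + δ))) := by gcongr
    have a4 : ((1 + δ) * (y - m) ^ 2 + (δ + δ ^ 2)) / (2 * (s * (1 + δ))) =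
        (y - m) ^ 2 / (2 * s) + δ / (2 * s) := by field_simp
    rw [neg_div, neg_div]; linarith
  calc (√(2 * Real.pi * s))⁻¹ * Real.exp (-(y - m) ^ 2 / (2 * s))
      ≤ (√(2 * Real.pi * s))⁻¹ * Real.exp (δ / (2 * s) + -(y - g) ^ 2 / (2 * s')) := by gcongr
    _ = _ := by rw [← e1, Real.exp_add]; ring

/-- Hellinger affinity of two normal laws, as a likelihood ratio integral. -/
lemma lintegral_sqrt_gaussianPDF_div_le {m m0 s s0 : ℝ} (hs : 0 < s) (hs0 : 0 < s0) :
    ∫⁻ y, (gaussianPDF m s.toNNReal y / gaussianPDF m0 s0.toNNReal y) ^ (1 / 2 : ℝ) *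
        gaussianPDF m0 s0.toNNReal y ≤
      ENNReal.ofReal
        (Real.exp (-((m - m0) ^ 2 / (4 * (s + s0)) + (s - s0) ^ 2 / (4 * (s + s0) ^ 2)))) := by
  have hss : 0 < s + s0 := by positivity
  have hv : (2 * s * s0 / (s + s0)).toNNReal ≠ 0 := toNNReal_ne_zero_of_pos (by positivity)
  set A := Real.exp (-((m - m0) ^ 2 / (4 * (s + s0)) + (s - s0) ^ 2 / (4 * (s + s0) ^ 2)))
  calc _ ≤ ∫⁻ y, ENNReal.ofReal A *
        gaussianPDF ((m * s0 + m0 * s) / (s + s0)) (2 * s * s0 / (s + s0)).toNNReal y := by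
        refine lintegral_mono fun y => ?_
        have h0 := gaussianPDF_pos m0 (toNNReal_ne_zero_of_pos hs0) y
        have hr0 := gaussianPDFReal_pos m0 _ y (toNNReal_ne_zero_of_pos hs0)
        have hr := gaussianPDFReal_pos m _ y (toNNReal_ne_zero_of_pos hs)
        have key := gaussianPDFReal_mul_le (m := m) (m0 := m0) hs hs0 y
        simp only [gaussianPDF]
        rw [← ENNReal.ofReal_div_of_pos hr0, ENNReal.ofReal_rpow_of_nonneg (by positivity) (by norm_num),
          ← ENNReal.ofReal_mul (by positivity), ← ENNReal.ofReal_mul (by positivity),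
          ← Real.sqrt_eq_rpow]
        apply ENNReal.ofReal_le_ofReal
        apply le_of_sq_le_sq _ (mul_nonneg (Real.exp_pos _).le (gaussianPDFReal_nonneg _ _ _))
        refine le_trans (le_of_eq ?_) key
        rw [mul_pow, Real.sq_sqrt (by positivity)]
        field_simp
    _ = _ := by
        rw [lintegral_const_mul _ (measurable_gaussianPDF _ _), lintegral_gaussianPDF_eq_one _ hv,
          mul_one]

/-- The `χ²`-affinity of two normal laws, as a likelihood ratio integral. -/
lemma lintegral_gaussianPDF_div_le {m m0 s s0 : ℝ} (hs0 : 0 < s0) (hs : s0 ≤ s) :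
    ∫⁻ y, (gaussianPDF m0 s0.toNNReal y / gaussianPDF m s.toNNReal y) *
        gaussianPDF m0 s0.toNNReal y ≤
      ENNReal.ofReal (Real.exp ((m - m0) ^ 2 / s0 + (s - s0) ^ 2 / (2 * s0 ^ 2))) := by
  have hs' : 0 < s := hs0.trans_le hs
  have h2 : 0 < 2 * s - s0 := by linarith
  have hv : (s * s0 / (2 * s - s0)).toNNReal ≠ 0 := toNNReal_ne_zero_of_pos (by positivity)
  set A := Real.exp ((m - m0) ^ 2 / s0 + (s - s0) ^ 2 / (2 * s0 ^ 2))
  calc _ ≤ ∫⁻ y, ENNReal.ofReal A *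
        gaussianPDF ((2 * m0 * s - m * s0) / (2 * s - s0)) (s * s0 / (2 * s - s0)).toNNReal y := by
        refine lintegral_mono fun y => ?_
        have hr0 := gaussianPDFReal_pos m0 _ y (toNNReal_ne_zero_of_pos hs0)
        have hr := gaussianPDFReal_pos m _ y (toNNReal_ne_zero_of_pos hs')
        have key := gaussianPDFReal_sq_le (m := m) (m0 := m0) hs0 hs y
        simp only [gaussianPDF]
        rw [← ENNReal.ofReal_div_of_pos hr, ← ENNReal.ofReal_mul (by positivity),
          ← ENNReal.ofReal_mul (by positivity)]
        apply ENNReal.ofReal_le_ofReal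
        rw [div_mul_eq_mul_div, div_le_iff₀ hr, ← sq]
        exact key
    _ = _ := by
        rw [lintegral_const_mul _ (measurable_gaussianPDF _ _), lintegral_gaussianPDF_eq_one _ hv,
          mul_one]

lemma gaussianPDF_le_of_near {m g s s' δ : ℝ} (hs : 0 < s) (hδ : 0 < δ) (hm : |m - g| ≤ δ)
    (hs' : s * (1 + δ) ≤ s') (y : ℝ) :
    gaussianPDF m s.toNNReal y ≤
      ENNReal.ofReal (√(s' / s) * Real.exp (δ / (2 * s))) * gaussianPDF g s'.toNNReal y := by
  simp only [gaussianPDF]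
  rw [← ENNReal.ofReal_mul (by positivity)]
  exact ENNReal.ofReal_le_ofReal (gaussianPDFReal_le_of_near hs hδ hm hs' y)

end Forest

noncomputable section

namespace Forest

/-! ### Likelihood ratios -/

lemma lintegral_pi_prod_eq {ι : Type*} [Fintype ι] {X : ι → Type*} [∀ i, MeasurableSpace (X i)]
    (μ : ∀ i, Measure (X i)) [∀ i, IsProbabilityMeasure (μ i)] (f : ∀ i, X i → ℝ≥0∞)
    (hf : ∀ i, Measurable (f i)) :
    ∫⁻ x, ∏ i, f i (x i) ∂(Measure.pi μ) = ∏ i, ∫⁻ x, f i x ∂(μ i) := by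
  rw [lintegral_prod_eq_prod_lintegral_of_indepFun Finset.univ (fun i (x : ∀ i, X i) => f i (x i))
    (iIndepFun_pi fun i => (hf i).aemeasurable) fun i => (hf i).comp (measurable_pi_apply i)]
  refine Finset.prod_congr rfl fun i _ => ?_
  exact (measurePreserving_eval μ i).lintegral_comp (hf i)

variable {p : ℕ}

instance isProbabilityMeasure_obsLaw {Q : Measure (Fin p → ℝ)} [IsProbabilityMeasure Q]
    {f : (Fin p → ℝ) → ℝ} [hf : Fact (Measurable f)] {s : ℝ} :
    IsProbabilityMeasure (obsLaw Q f s) := by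
  have := hf.out
  exact Measure.isProbabilityMeasure_map (by fun_prop)

lemma lintegral_obsLaw {Q : Measure (Fin p → ℝ)} [IsProbabilityMeasure Q] {f : (Fin p → ℝ) → ℝ}
    (hf : Measurable f) {s : ℝ} (hs : 0 < s) {φ : (Fin p → ℝ) × ℝ → ℝ≥0∞} (hφ : Measurable φ) :
    ∫⁻ z, φ z ∂(obsLaw Q f s) =
      ∫⁻ x, (∫⁻ y, φ (x, y) * gaussianPDF (f x) s.toNNReal y) ∂Q := by
  have hm : Measurable fun z : (Fin p → ℝ) × ℝ => (z.1, f z.1 + z.2) := by fun_prop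
  rw [obsLaw, lintegral_map hφ hm, lintegral_prod (fun z : (Fin p → ℝ) × ℝ => φ (z.1, f z.1 + z.2)) (hφ.comp hm).aemeasurable]
  refine lintegral_congr fun x => ?_
  have h1 : Measurable fun y => φ (x, y) := by fun_prop
  have h2 : Measurable fun e : ℝ => f x + e := by fun_prop
  rw [show (∫⁻ e, φ (x, f x + e) ∂(gaussianReal 0 s.toNNReal)) =
    ∫⁻ y, φ (x, y) ∂((gaussianReal 0 s.toNNReal).map fun e => f x + e) from
    (lintegral_map h1 h2).symm, gaussianReal_map_const_add, zero_add,
    gaussianReal_of_var_ne_zero _ (toNNReal_ne_zero_of_pos hs),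
    lintegral_withDensity_eq_lintegral_mul _ (measurable_gaussianPDF _ _) h1]
  refine lintegral_congr fun y => ?_
  rw [Pi.mul_apply, mul_comm]

/-- The density ratio of one observation. -/
def obsRatio (f f0 : (Fin p → ℝ) → ℝ) (s s0 : ℝ) (z : (Fin p → ℝ) × ℝ) : ℝ≥0∞ :=
  gaussianPDF (f z.1) s.toNNReal z.2 / gaussianPDF (f0 z.1) s0.toNNReal z.2

/-- The likelihood ratio of the data. -/
def likRatio {n : ℕ} (D : Fin n → (Fin p → ℝ) × ℝ) (f f0 : (Fin p → ℝ) → ℝ) (s s0 : ℝ) : ℝ≥0∞ :=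
  ∏ i, obsRatio f f0 s s0 (D i)

variable {n : ℕ} {f f0 : (Fin p → ℝ) → ℝ} {s s0 : ℝ}

lemma measurable_gaussianPDF_comp {α : Type*} [MeasurableSpace α] {m v y : α → ℝ}
    (hm : Measurable m) (hv : Measurable v) (hy : Measurable y) :
    Measurable fun a => gaussianPDF (m a) (v a).toNNReal (y a) :=
  measurable_uncurry_gaussianPDF.comp (hm.prodMk (hv.real_toNNReal.prodMk hy))

lemma measurable_obsRatio (hf : Measurable f) (hf0 : Measurable f0) :
    Measurable (obsRatio f f0 s s0) :=
  (measurable_gaussianPDF_comp (hf.comp measurable_fst) measurable_const measurable_snd).div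
    (measurable_gaussianPDF_comp (hf0.comp measurable_fst) measurable_const measurable_snd)

lemma measurable_likRatio (hf : Measurable f) (hf0 : Measurable f0) :
    Measurable fun D : Fin n → (Fin p → ℝ) × ℝ => likRatio D f f0 s s0 :=
  Finset.measurable_prod _ fun i _ => (measurable_obsRatio hf hf0).comp (measurable_pi_apply i)

lemma obsRatio_pos (hs : 0 < s) (z : (Fin p → ℝ) × ℝ) : 0 < obsRatio f f0 s s0 z :=
  ENNReal.div_pos (gaussianPDF_pos _ (toNNReal_ne_zero_of_pos hs) _).ne' gaussianPDF_ne_top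

lemma obsRatio_lt_top (hs0 : 0 < s0) (z : (Fin p → ℝ) × ℝ) : obsRatio f f0 s s0 z < ⊤ :=
  ENNReal.div_lt_top gaussianPDF_ne_top (gaussianPDF_pos _ (toNNReal_ne_zero_of_pos hs0) _).ne'

lemma likRatio_ne_zero (hs : 0 < s) (D : Fin n → (Fin p → ℝ) × ℝ) : likRatio D f f0 s s0 ≠ 0 :=
  Finset.prod_ne_zero_iff.2 fun _ _ => (obsRatio_pos hs _).ne'

lemma likRatio_ne_top (hs0 : 0 < s0) (D : Fin n → (Fin p → ℝ) × ℝ) : likRatio D f f0 s s0 ≠ ⊤ :=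
  ENNReal.prod_ne_top fun _ _ => (obsRatio_lt_top hs0 _).ne

lemma likelihood_ne_zero (hs : 0 < s) (D : Fin n → (Fin p → ℝ) × ℝ) : likelihood D f s ≠ 0 :=
  Finset.prod_ne_zero_iff.2 fun _ _ => (gaussianPDF_pos _ (toNNReal_ne_zero_of_pos hs) _).ne'

lemma likelihood_ne_top (D : Fin n → (Fin p → ℝ) × ℝ) : likelihood D f s ≠ ⊤ :=
  ENNReal.prod_ne_top fun _ _ => gaussianPDF_ne_top

lemma likelihood_eq_likRatio_mul (hs0 : 0 < s0) (D : Fin n → (Fin p → ℝ) × ℝ) :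
    likelihood D f s = likRatio D f f0 s s0 * likelihood D f0 s0 := by
  rw [likelihood, likelihood, likRatio, ← Finset.prod_mul_distrib]
  refine Finset.prod_congr rfl fun i _ => ?_
  rw [obsRatio, ENNReal.div_mul_cancel (gaussianPDF_pos _ (toNNReal_ne_zero_of_pos hs0) _).ne'
    gaussianPDF_ne_top]

lemma inv_likRatio (hs : 0 < s) (hs0 : 0 < s0) (D : Fin n → (Fin p → ℝ) × ℝ) :
    (likRatio D f f0 s s0)⁻¹ = likRatio D f0 f s0 s := by
  rw [likRatio, likRatio, ENNReal.prod_inv_distrib]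
  · refine Finset.prod_congr rfl fun i _ => ?_
    rw [obsRatio, obsRatio, ENNReal.inv_div (Or.inl gaussianPDF_ne_top)
      (Or.inl (gaussianPDF_pos _ (toNNReal_ne_zero_of_pos hs0) _).ne')]
  · intro i _ j _ _
    exact Or.inl (obsRatio_pos hs _).ne'

variable {Q : Measure (Fin p → ℝ)} [IsProbabilityMeasure Q]

lemma lintegral_likRatio (hf : Measurable f) (hf0 : Measurable f0) (hs : 0 < s) (hs0 : 0 < s0) :
    ∫⁻ D : Fin n → (Fin p → ℝ) × ℝ, likRatio D f f0 s s0 ∂(Measure.pi fun _ => obsLaw Q f0 s0) =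
      1 := by
  have := Fact.mk hf0
  simp only [likRatio]
  rw [lintegral_pi_prod_eq (fun _ : Fin n => obsLaw Q f0 s0) (fun _ => obsRatio f f0 s s0)
    fun _ => measurable_obsRatio hf hf0, lintegral_obsLaw hf0 hs0 (measurable_obsRatio hf hf0)]
  have : ∀ x, ∫⁻ y, obsRatio f f0 s s0 (x, y) * gaussianPDF (f0 x) s0.toNNReal y = 1 := by
    intro x
    rw [← lintegral_gaussianPDF_eq_one (f x) (toNNReal_ne_zero_of_pos hs)]
    refine lintegral_congr fun y => ?_
    rw [obsRatio, ENNReal.div_mul_cancel (gaussianPDF_pos _ (toNNReal_ne_zero_of_pos hs0) _).ne'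
      gaussianPDF_ne_top]
  simp [this]

lemma lintegral_ofReal_exp_neg_le {α : Type*} [MeasurableSpace α] {μ : Measure α}
    [IsProbabilityMeasure μ] {v : α → ℝ} (hv : Integrable v μ) {V : ℝ}
    (h0 : ∀ᵐ x ∂μ, 0 ≤ v x) (h1 : ∀ᵐ x ∂μ, v x ≤ V) :
    ∫⁻ x, ENNReal.ofReal (Real.exp (-v x)) ∂μ ≤
      ENNReal.ofReal (Real.exp (-(Real.exp (-V) * ∫ x, v x ∂μ))) := by
  have key : ∀ᵐ x ∂μ, Real.exp (-v x) ≤ 1 - Real.exp (-V) * v x := by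
    filter_upwards [h0, h1] with x hx0 hx1
    have a1 : Real.exp (-V) ≤ Real.exp (-v x) := Real.exp_le_exp.2 (by linarith)
    have a2 := Real.add_one_le_exp (v x)
    have a3 : Real.exp (-v x) * Real.exp (v x) = 1 := by rw [← Real.exp_add]; simp
    have a4 := Real.exp_pos (-v x)
    nlinarith
  have hi : Integrable (fun x => 1 - Real.exp (-V) * v x) μ :=
    (integrable_const 1).sub (hv.const_mul _)
  calc ∫⁻ x, ENNReal.ofReal (Real.exp (-v x)) ∂μ
      ≤ ∫⁻ x, ENNReal.ofReal (1 - Real.exp (-V) * v x) ∂μ :=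
        lintegral_mono_ae (key.mono fun x hx => ENNReal.ofReal_le_ofReal hx)
    _ = ENNReal.ofReal (∫ x, (1 - Real.exp (-V) * v x) ∂μ) :=
        (ofReal_integral_eq_lintegral_ofReal hi
          (key.mono fun x hx => (Real.exp_pos _).le.trans hx)).symm
    _ ≤ _ := by
        apply ENNReal.ofReal_le_ofReal
        rw [integral_sub (integrable_const 1) (hv.const_mul _), integral_const_mul]
        simp only [integral_const, probReal_univ, smul_eq_mul, mul_one]
        have := Real.add_one_le_exp (-(Real.exp (-V) * ∫ x, v x ∂μ))
        linarith

lemma lintegral_ofReal_exp_le {α : Type*} [MeasurableSpace α] {μ : Measure α}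
    [IsProbabilityMeasure μ] {v : α → ℝ} (hv : Integrable v μ) {V : ℝ}
    (h0 : ∀ᵐ x ∂μ, 0 ≤ v x) (h1 : ∀ᵐ x ∂μ, v x ≤ V) :
    ∫⁻ x, ENNReal.ofReal (Real.exp (v x)) ∂μ ≤
      ENNReal.ofReal (Real.exp (Real.exp V * ∫ x, v x ∂μ)) := by
  have key : ∀ᵐ x ∂μ, Real.exp (v x) ≤ 1 + Real.exp V * v x := by
    filter_upwards [h0, h1] with x hx0 hx1
    have a1 : Real.exp (v x) ≤ Real.exp V := Real.exp_le_exp.2 hx1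
    have a2 := Real.add_one_le_exp (-v x)
    have a3 : Real.exp (-v x) * Real.exp (v x) = 1 := by rw [← Real.exp_add]; simp
    have a4 := Real.exp_pos (v x)
    nlinarith
  have hi : Integrable (fun x => 1 + Real.exp V * v x) μ :=
    (integrable_const 1).add (hv.const_mul _)
  calc ∫⁻ x, ENNReal.ofReal (Real.exp (v x)) ∂μ
      ≤ ∫⁻ x, ENNReal.ofReal (1 + Real.exp V * v x) ∂μ :=
        lintegral_mono_ae (key.mono fun x hx => ENNReal.ofReal_le_ofReal hx)
    _ = ENNReal.ofReal (∫ x, (1 + Real.exp V * v x) ∂μ) :=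
        (ofReal_integral_eq_lintegral_ofReal hi
          (key.mono fun x hx => (Real.exp_pos _).le.trans hx)).symm
    _ ≤ _ := by
        apply ENNReal.ofReal_le_ofReal
        rw [integral_add (integrable_const 1) (hv.const_mul _), integral_const_mul]
        simp only [integral_const, probReal_univ, smul_eq_mul, mul_one]
        have := Real.add_one_le_exp (Real.exp V * ∫ x, v x ∂μ)
        linarith

lemma integrable_sq_sub_of_bounded (hf : Measurable f) (hf0 : Measurable f0) {U : ℝ}
    (hU : ∀ᵐ x ∂Q, |f x - f0 x| ≤ U) : Integrable (fun x => (f x - f0 x) ^ 2) Q := by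
  refine Integrable.of_bound (by fun_prop) (U ^ 2) (hU.mono fun x hx => ?_)
  rw [Real.norm_eq_abs, abs_pow]
  exact pow_le_pow_left₀ (abs_nonneg _) hx 2

/-- Expected square root of the likelihood ratio. -/
lemma lintegral_sqrt_likRatio_le (hf : Measurable f) (hf0 : Measurable f0) {S U : ℝ}
    (hs : 0 < s) (hs0 : 0 < s0) (hsS : s ≤ S) (hs0S : s0 ≤ S)
    (hU : ∀ᵐ x ∂Q, |f x - f0 x| ≤ U) :
    ∫⁻ D : Fin n → (Fin p → ℝ) × ℝ, likRatio D f f0 s s0 ^ (1 / 2 : ℝ)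
        ∂(Measure.pi fun _ => obsLaw Q f0 s0) ≤
      ENNReal.ofReal (Real.exp (-(n * (Real.exp (-(U ^ 2 / (8 * S))) / (8 * S) *
        ∫ x, (f x - f0 x) ^ 2 ∂Q + (s - s0) ^ 2 / (16 * S ^ 2))))) := by
  have := Fact.mk hf0
  have hS : 0 < S := hs.trans_le hsS
  have hm : Measurable fun z => obsRatio f f0 s s0 z ^ (1 / 2 : ℝ) :=
    (measurable_obsRatio hf hf0).pow_const _
  have e1 : ∀ D : Fin n → (Fin p → ℝ) × ℝ, likRatio D f f0 s s0 ^ (1 / 2 : ℝ) =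
      ∏ i, (fun z => obsRatio f f0 s s0 z ^ (1 / 2 : ℝ)) (D i) := fun D => by
    rw [likRatio, ENNReal.prod_rpow_of_nonneg (by norm_num)]
  simp only [e1]
  rw [lintegral_pi_prod_eq (fun _ : Fin n => obsLaw Q f0 s0) (fun _ z => obsRatio f f0 s s0 z ^ (1 / 2 : ℝ))
    fun _ => hm, lintegral_obsLaw hf0 hs0 hm, Finset.prod_const, Finset.card_univ, Fintype.card_fin,
    ← mul_neg, Real.exp_nat_mul, ENNReal.ofReal_pow (Real.exp_pos _).le]
  gcongr
  set W := (s - s0) ^ 2 / (16 * S ^ 2)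
  have hint := integrable_sq_sub_of_bounded hf hf0 hU
  calc _ ≤ ∫⁻ x, ENNReal.ofReal (Real.exp (-W)) *
        ENNReal.ofReal (Real.exp (-((f x - f0 x) ^ 2 / (8 * S)))) ∂Q := by
        refine lintegral_mono fun x => ?_
        have h0 := lintegral_sqrt_gaussianPDF_div_le (m := f x) (m0 := f0 x) hs hs0
        simp only [obsRatio]
        refine h0.trans ?_
        rw [← ENNReal.ofReal_mul (Real.exp_pos _).le, ← Real.exp_add]
        apply ENNReal.ofReal_le_ofReal (Real.exp_le_exp.2 _)
        have h1 : (f x - f0 x) ^ 2 / (8 * S) ≤ (f x - f0 x) ^ 2 / (4 * (s + s0)) := by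
          apply div_le_div_of_nonneg_left (by positivity) (by positivity)
          linarith
        have h2 : W ≤ (s - s0) ^ 2 / (4 * (s + s0) ^ 2) := by
          apply div_le_div_of_nonneg_left (by positivity) (by positivity)
          nlinarith
        linarith
    _ = ENNReal.ofReal (Real.exp (-W)) *
        ∫⁻ x, ENNReal.ofReal (Real.exp (-((f x - f0 x) ^ 2 / (8 * S)))) ∂Q :=
        lintegral_const_mul _ (by fun_prop)
    _ ≤ ENNReal.ofReal (Real.exp (-W)) * ENNReal.ofReal (Real.exp
          (-(Real.exp (-(U ^ 2 / (8 * S))) * ∫ x, (f x - f0 x) ^ 2 / (8 * S) ∂Q))) := by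
        gcongr
        refine lintegral_ofReal_exp_neg_le (hint.div_const _) (Eventually.of_forall fun x => by positivity)
          (hU.mono fun x hx => ?_)
        rw [← sq_abs (f x - f0 x)]
        gcongr
    _ = _ := by
        rw [← ENNReal.ofReal_mul (Real.exp_pos _).le, ← Real.exp_add, integral_div]
        congr 2; ring

/-- Expected inverse of the likelihood ratio. -/
lemma lintegral_inv_likRatio_le (hf : Measurable f) (hf0 : Measurable f0) {S U : ℝ} (hS : 0 < S)
    (hs0 : S⁻¹ ≤ s0) (hs : s0 ≤ s) (hU : ∀ᵐ x ∂Q, |f x - f0 x| ≤ U) :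
    ∫⁻ D : Fin n → (Fin p → ℝ) × ℝ, (likRatio D f f0 s s0)⁻¹
        ∂(Measure.pi fun _ => obsLaw Q f0 s0) ≤
      ENNReal.ofReal (Real.exp (n * (Real.exp (S * U ^ 2) * S *
        ∫ x, (f x - f0 x) ^ 2 ∂Q + S ^ 2 * (s - s0) ^ 2))) := by
  have := Fact.mk hf0
  have hs0' : 0 < s0 := (inv_pos.2 hS).trans_le hs0
  have hm : Measurable (obsRatio f0 f s0 s) := measurable_obsRatio hf0 hf
  simp only [inv_likRatio (hs0'.trans_le hs) hs0']
  simp only [likRatio]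
  rw [lintegral_pi_prod_eq (fun _ : Fin n => obsLaw Q f0 s0) (fun _ => obsRatio f0 f s0 s)
    fun _ => hm, lintegral_obsLaw hf0 hs0' hm, Finset.prod_const, Finset.card_univ, Fintype.card_fin,
    Real.exp_nat_mul, ENNReal.ofReal_pow (Real.exp_pos _).le]
  gcongr
  set W := S ^ 2 * (s - s0) ^ 2
  have hint := integrable_sq_sub_of_bounded hf hf0 hU
  have hinv : s0⁻¹ ≤ S := inv_le_of_inv_le₀ hS hs0
  calc _ ≤ ∫⁻ x, ENNReal.ofReal (Real.exp W) *
        ENNReal.ofReal (Real.exp (S * (f x - f0 x) ^ 2)) ∂Q := by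
        refine lintegral_mono fun x => ?_
        have h0 := lintegral_gaussianPDF_div_le (m := f x) (m0 := f0 x) hs0' hs
        simp only [obsRatio]
        refine h0.trans ?_
        rw [← ENNReal.ofReal_mul (Real.exp_pos _).le, ← Real.exp_add]
        apply ENNReal.ofReal_le_ofReal (Real.exp_le_exp.2 _)
        have h1 : (f x - f0 x) ^ 2 / s0 ≤ S * (f x - f0 x) ^ 2 := by
          rw [div_eq_mul_inv, mul_comm]; gcongr
        have h2 : (s - s0) ^ 2 / (2 * s0 ^ 2) ≤ W := by
          have : (s - s0) ^ 2 / (2 * s0 ^ 2) = (s0⁻¹) ^ 2 * (s - s0) ^ 2 / 2 := by field_simp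
          rw [this]
          have : (s0⁻¹) ^ 2 * (s - s0) ^ 2 ≤ S ^ 2 * (s - s0) ^ 2 := by gcongr
          have : 0 ≤ (s0⁻¹) ^ 2 * (s - s0) ^ 2 := by positivity
          linarith
        linarith
    _ = ENNReal.ofReal (Real.exp W) *
        ∫⁻ x, ENNReal.ofReal (Real.exp (S * (f x - f0 x) ^ 2)) ∂Q :=
        lintegral_const_mul _ (by fun_prop)
    _ ≤ ENNReal.ofReal (Real.exp W) * ENNReal.ofReal (Real.exp
          (Real.exp (S * U ^ 2) * ∫ x, S * (f x - f0 x) ^ 2 ∂Q)) := by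
        gcongr
        refine lintegral_ofReal_exp_le (hint.const_mul _) (Eventually.of_forall fun x => by positivity)
          (hU.mono fun x hx => ?_)
        rw [← sq_abs (f x - f0 x)]
        gcongr
    _ = _ := by
        rw [← ENNReal.ofReal_mul (Real.exp_pos _).le, ← Real.exp_add, integral_const_mul]
        congr 2; ring

/-- Likelihoods near `(g, s')` are dominated by the likelihood at `(g, s')`. -/
lemma likelihood_le_of_near {g : (Fin p → ℝ) → ℝ} {s' δ : ℝ} (hs : 0 < s) (hδ : 0 < δ)
    (hm : ∀ x, |f x - g x| ≤ δ) (hs' : s * (1 + δ) ≤ s') (D : Fin n → (Fin p → ℝ) × ℝ) :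
    likelihood D f s ≤
      ENNReal.ofReal (√(s' / s) * Real.exp (δ / (2 * s))) ^ n * likelihood D g s' := by
  have := Finset.prod_le_prod' (s := Finset.univ) fun (i : Fin n) _ =>
    gaussianPDF_le_of_near hs hδ (hm (D i).1) hs' (D i).2
  rwa [Finset.prod_mul_distrib, Finset.prod_const, Finset.card_univ, Fintype.card_fin] at this

end Forest

end

noncomputable section

namespace Forest

/-! ### Moments of the Dirichlet distribution -/

lemma ae_gammaMeasure_pos (a : ℝ) : ∀ᵐ x ∂(gammaMeasure a 1), 0 < x := by
  rw [ae_iff, gammaMeasure, withDensity_apply _ (by simp only [not_lt]; exact measurableSet_Iic)]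
  have : {x : ℝ | ¬ 0 < x} = Set.Iic 0 := by ext; simp
  rw [this, ← setLIntegral_congr Iio_ae_eq_Iic]
  exact lintegral_gammaPDF_of_nonpos le_rfl

lemma lintegral_pow_mul_exp_gammaMeasure {a u : ℝ} (ha : 0 < a) (hu : 0 ≤ u) (m : ℕ) :
    ∫⁻ x, ENNReal.ofReal x ^ m * ENNReal.ofReal (Real.exp (-(u * x))) ∂(gammaMeasure a 1) =
      ENNReal.ofReal (Real.Gamma (a + m) / Real.Gamma a * (1 + u) ^ (-(a + m))) := by
  have hG : 0 < Real.Gamma a := Real.Gamma_pos_of_pos ha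
  have hGm : 0 < Real.Gamma (a + m) := Real.Gamma_pos_of_pos (by positivity)
  have hu1 : 0 < 1 + u := by linarith
  rw [gammaMeasure, lintegral_withDensity_eq_lintegral_mul _
    (show Measurable (gammaPDF a 1) from (measurable_gammaPDFReal a 1).ennreal_ofReal)
    (by fun_prop)]
  rw [← mul_one (ENNReal.ofReal _), ← lintegral_gammaPDF_eq_one (a := a + m) (r := 1 + u)
    (by positivity) hu1, ← lintegral_const_mul _
    (show Measurable (gammaPDF (a + m) (1 + u)) from (measurable_gammaPDFReal _ _).ennreal_ofReal)]
  apply lintegral_congr_ae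
  have hne : ∀ᵐ x : ℝ, x ≠ 0 := by simp [ae_iff]
  filter_upwards [hne] with x hx
  rcases lt_or_gt_of_ne hx with hx | hx
  · simp [gammaPDF_of_neg hx]
  · rw [Pi.mul_apply, gammaPDF_of_nonneg hx.le, gammaPDF_of_nonneg hx.le, ← ENNReal.ofReal_pow hx.le,
      ← ENNReal.ofReal_mul (by positivity), ← ENNReal.ofReal_mul (by positivity),
      ← ENNReal.ofReal_mul (by positivity)]
    congr 1
    have e1 : x ^ (a + m - 1) = x ^ (a - 1) * x ^ m := by
      rw [← Real.rpow_natCast, ← Real.rpow_add hx]; congr 1; ring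
    have e2 : (1 + u) ^ (-(a + m)) * (1 + u) ^ (a + m) = 1 := by
      rw [← Real.rpow_add hu1]; simp
    have e3 : Real.exp (-((1 + u) * x)) = Real.exp (-(1 * x)) * Real.exp (-(u * x)) := by
      rw [← Real.exp_add]; congr 1; ring
    rw [e1, e3, Real.one_rpow]
    calc _ = (1 / Real.Gamma a * x ^ (a - 1) * x ^ m * Real.exp (-(1 * x)) * Real.exp (-(u * x))) *
        ((1 + u) ^ (-(a + m)) * (1 + u) ^ (a + m)) := by rw [e2]; ring
      _ = _ := by
        generalize (1 + u) ^ (-(a + m)) = A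
        generalize (1 + u) ^ (a + m) = B
        field_simp

lemma lintegral_pow_mul_exp_Ioi {N : ℕ} (hN : 0 < N) {G : ℝ} (hG : 0 < G) :
    ∫⁻ u in Set.Ioi (0 : ℝ), ENNReal.ofReal (u ^ (N - 1 : ℝ) / Real.Gamma N) *
      ENNReal.ofReal (Real.exp (-(u * G))) = ENNReal.ofReal (1 / G) ^ N := by
  have hN' : (0 : ℝ) < N := by exact_mod_cast hN
  have hΓ : 0 < Real.Gamma N := Real.Gamma_pos_of_pos hN'
  have h1 : ∫⁻ u in Set.Ioi (0 : ℝ), gammaPDF N G u = 1 := by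
    rw [← lintegral_gammaPDF_eq_one hN' hG, ← lintegral_indicator measurableSet_Ioi]
    apply lintegral_congr_ae
    have hne : ∀ᵐ x : ℝ, x ≠ 0 := by simp [ae_iff]
    filter_upwards [hne] with x hx
    rcases lt_or_gt_of_ne hx with hx | hx
    · simp [gammaPDF_of_neg hx, hx.le]
    · simp [hx]
  rw [← mul_one (_ ^ N), ← h1, ← lintegral_const_mul _
    (show Measurable (gammaPDF N G) from (measurable_gammaPDFReal _ _).ennreal_ofReal)]
  refine setLIntegral_congr_fun measurableSet_Ioi fun u (hu : 0 < u) => ?_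
  rw [gammaPDF_of_nonneg hu.le, ← ENNReal.ofReal_pow (by positivity),
    ← ENNReal.ofReal_mul (by positivity), ← ENNReal.ofReal_mul (by positivity)]
  congr 1
  rw [Real.rpow_natCast, mul_comm u G, one_div, inv_pow]
  field_simp

variable {p : ℕ}

lemma lintegral_dirichlet {a : ℝ} {φ : (Fin p → ℝ) → ℝ≥0∞} (hφ : Measurable φ) :
    ∫⁻ η, φ η ∂(dirichlet p a) =
      ∫⁻ g, φ (fun j => g j / ∑ i, g i) ∂(Measure.pi fun _ : Fin p => gammaMeasure a 1) := by
  rw [dirichlet, lintegral_map hφ (by fun_prop)]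

lemma lintegral_prod_pow_dirichlet [NeZero p] {a : ℝ} (ha : 0 < a) (m : Fin p → ℕ) {N : ℕ}
    (hm : ∑ j, m j = N) (hN : 0 < N) :
    ∫⁻ η, ∏ j, ENNReal.ofReal (η j) ^ m j ∂(dirichlet p a) =
      ENNReal.ofReal ((∏ j, Real.Gamma (a + m j) / Real.Gamma a) / Real.Gamma N) *
        ∫⁻ u in Set.Ioi (0 : ℝ),
          ENNReal.ofReal (u ^ (N - 1 : ℝ) * (1 + u) ^ (-(p * a + N))) := by
  have hN' : (0 : ℝ) < N := by exact_mod_cast hN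
  have hΓ : 0 < Real.Gamma N := Real.Gamma_pos_of_pos hN'
  have hprob : IsProbabilityMeasure (gammaMeasure a 1) := isProbabilityMeasure_gammaMeasure ha one_pos
  rw [lintegral_dirichlet (by fun_prop)]
  have hpos : ∀ᵐ g ∂(Measure.pi fun _ : Fin p => gammaMeasure a 1), ∀ j, 0 < g j :=
    ae_all_iff.2 fun j => (measurePreserving_eval (fun _ : Fin p => gammaMeasure a 1) j).quasiMeasurePreserving.ae
      (ae_gammaMeasure_pos a)
  calc _ = ∫⁻ g, (∫⁻ u in Set.Ioi (0 : ℝ), ENNReal.ofReal (u ^ (N - 1 : ℝ) / Real.Gamma N) *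
        ∏ j, (ENNReal.ofReal (g j) ^ m j * ENNReal.ofReal (Real.exp (-(u * g j)))))
        ∂(Measure.pi fun _ : Fin p => gammaMeasure a 1) := by
        apply lintegral_congr_ae
        filter_upwards [hpos] with g hg
        have hG : 0 < ∑ i, g i := Finset.sum_pos (fun i _ => hg i) Finset.univ_nonempty
        have e1 : ∀ u : ℝ, ∏ j, (ENNReal.ofReal (g j) ^ m j * ENNReal.ofReal (Real.exp (-(u * g j)))) =
            (∏ j, ENNReal.ofReal (g j) ^ m j) * ENNReal.ofReal (Real.exp (-(u * ∑ i, g i))) := by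
          intro u
          rw [Finset.prod_mul_distrib, ← ENNReal.ofReal_prod_of_nonneg fun _ _ => (Real.exp_pos _).le,
            ← Real.exp_sum, Finset.mul_sum, Finset.sum_neg_distrib]
        simp only [e1]
        simp_rw [mul_left_comm _ (∏ j, ENNReal.ofReal (g j) ^ m j)]
        rw [lintegral_const_mul _ (by fun_prop), lintegral_pow_mul_exp_Ioi hN hG, ← hm,
          ← Finset.prod_pow_eq_pow_sum, ← Finset.prod_mul_distrib]
        refine Finset.prod_congr rfl fun j _ => ?_
        rw [← mul_pow, ← ENNReal.ofReal_mul (hg j).le, mul_one_div]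
    _ = ∫⁻ u in Set.Ioi (0 : ℝ), (∫⁻ g, ENNReal.ofReal (u ^ (N - 1 : ℝ) / Real.Gamma N) *
        ∏ j, (ENNReal.ofReal (g j) ^ m j * ENNReal.ofReal (Real.exp (-(u * g j))))
        ∂(Measure.pi fun _ : Fin p => gammaMeasure a 1)) := by
        rw [lintegral_lintegral_swap]
        apply Measurable.aemeasurable
        fun_prop
    _ = _ := by
        rw [← lintegral_const_mul _ (by fun_prop)]
        refine setLIntegral_congr_fun measurableSet_Ioi fun u (hu : 0 < u) => ?_
        have h1u : 0 < 1 + u := by linarith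
        rw [lintegral_const_mul _ (by fun_prop), lintegral_pi_prod_eq (fun _ : Fin p => gammaMeasure a 1)
          (fun j x => ENNReal.ofReal x ^ m j * ENNReal.ofReal (Real.exp (-(u * x)))) (by fun_prop)]
        simp only [lintegral_pow_mul_exp_gammaMeasure ha hu.le]
        have hΓa : ∀ j, 0 < Real.Gamma (a + m j) := fun j => Real.Gamma_pos_of_pos (by positivity)
        have hΓ0 : 0 < Real.Gamma a := Real.Gamma_pos_of_pos ha
        rw [← ENNReal.ofReal_prod_of_nonneg (fun j _ => by have := hΓa j; positivity),
          ← ENNReal.ofReal_mul (by positivity), ← ENNReal.ofReal_mul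
          (div_nonneg (Finset.prod_nonneg fun j _ => (div_pos (hΓa j) hΓ0).le) hΓ.le),
          Finset.prod_mul_distrib]
        have e2 : ∏ j, (1 + u) ^ (-(a + m j)) = (1 + u) ^ (-(p * a + N)) := by
          rw [← Real.rpow_sum_of_pos h1u]
          congr 1
          rw [Finset.sum_neg_distrib, Finset.sum_add_distrib, ← hm]
          simp
        rw [e2]
        congr 1
        ring

lemma Gamma_add_nat_div_le {a : ℝ} (ha : 0 < a) (m : ℕ) :
    Real.Gamma (a + m) / Real.Gamma a ≤
      (if m = 0 then 1 else a) * ((1 + a) ^ m * ((m - 1).factorial : ℝ)) := by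
  have hG : 0 < Real.Gamma a := Real.Gamma_pos_of_pos ha
  rw [div_le_iff₀ hG]
  induction m with
  | zero => simp
  | succ m ih =>
    have hpos : 0 < a + m := by positivity
    have e : Real.Gamma (a + (m + 1 : ℕ)) = (a + m) * Real.Gamma (a + m) := by
      rw [← Real.Gamma_add_one hpos.ne']; congr 1; push_cast; ring
    rw [e]
    rcases Nat.eq_zero_or_pos m with rfl | hm
    · simp
      have : a * 1 ≤ a * (1 + a) := by gcongr; linarith
      nlinarith
    · have hm' : (1 : ℝ) ≤ m := by exact_mod_cast hm
      simp only [hm.ne', if_false, Nat.succ_ne_zero] at ih ⊢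
      have e2 : ((m + 1 - 1).factorial : ℝ) = m * ((m - 1).factorial : ℝ) := by
        rw [Nat.add_sub_cancel, ← Nat.mul_factorial_pred hm.ne']; push_cast; ring
      rw [e2]
      calc (a + m) * Real.Gamma (a + m) ≤ (m * (1 + a)) *
            (a * ((1 + a) ^ m * ((m - 1).factorial : ℝ)) * Real.Gamma a) := by
            gcongr
            nlinarith
        _ = _ := by ring

lemma le_Gamma_add_nat_div {a : ℝ} (ha : 0 < a) (m : ℕ) :
    (if m = 0 then 1 else a) ≤ Real.Gamma (a + m) / Real.Gamma a := by
  have hG : 0 < Real.Gamma a := Real.Gamma_pos_of_pos ha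
  rw [le_div_iff₀ hG]
  induction m with
  | zero => simp
  | succ m ih =>
    have hpos : 0 < a + m := by positivity
    have e : Real.Gamma (a + (m + 1 : ℕ)) = (a + m) * Real.Gamma (a + m) := by
      rw [← Real.Gamma_add_one hpos.ne']; congr 1; push_cast; ring
    rw [e]
    rcases Nat.eq_zero_or_pos m with rfl | hm
    · simp
    · have hm' : (1 : ℝ) ≤ m := by exact_mod_cast hm
      simp only [hm.ne', if_false, Nat.succ_ne_zero] at ih ⊢
      have := Real.Gamma_pos_of_pos hpos
      nlinarith

lemma lintegral_Ioi_one_rpow {q : ℝ} (hq : 0 < q) :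
    ∫⁻ u in Set.Ioi (1 : ℝ), ENNReal.ofReal (u ^ (-q - 1)) = ENNReal.ofReal (1 / q) := by
  rw [← ofReal_integral_eq_lintegral_ofReal (integrableOn_Ioi_rpow_of_lt (by linarith) one_pos)
    ((ae_restrict_mem measurableSet_Ioi).mono fun u (hu : 1 < u) => by positivity),
    integral_Ioi_rpow_of_lt (by linarith) one_pos]
  congr 1
  rw [Real.one_rpow]
  have : -q - 1 + 1 = -q := by ring
  rw [this]; field_simp

lemma lintegral_beta_le {N : ℕ} (hN : 0 < N) {q : ℝ} (hq : 0 < q) :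
    ∫⁻ u in Set.Ioi (0 : ℝ), ENNReal.ofReal (u ^ (N - 1 : ℝ) * (1 + u) ^ (-(q + N))) ≤
      ENNReal.ofReal (1 + 1 / q) := by
  have hN' : (1 : ℝ) ≤ N := by exact_mod_cast hN
  rw [← Set.Ioc_union_Ioi_eq_Ioi zero_le_one, ENNReal.ofReal_add (by norm_num) (by positivity)]
  refine (lintegral_union_le _ _ _).trans (add_le_add ?_ ?_)
  · calc _ ≤ ∫⁻ u in Set.Ioc (0 : ℝ) 1, 1 := by
          refine setLIntegral_mono measurable_const fun u hu => ?_
          rw [← ENNReal.ofReal_one]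
          apply ENNReal.ofReal_le_ofReal
          apply mul_le_one₀ (Real.rpow_le_one hu.1.le hu.2 (by linarith))
            (Real.rpow_nonneg (by linarith [hu.1]) _)
          exact Real.rpow_le_one_of_one_le_of_nonpos (by linarith [hu.1]) (by linarith)
      _ = _ := by simp
  · rw [← lintegral_Ioi_one_rpow hq]
    refine setLIntegral_mono' measurableSet_Ioi fun u (hu : 1 < u) => ?_
    apply ENNReal.ofReal_le_ofReal
    have hu0 : 0 < u := by linarith
    have e : u ^ (-q - 1) = u ^ (N - 1 : ℝ) * u ^ (-(q + N)) := by
      rw [← Real.rpow_add hu0]; congr 1; ring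
    rw [e]
    refine mul_le_mul_of_nonneg_left ?_ (by positivity)
    exact Real.rpow_le_rpow_of_nonpos hu0 (by linarith) (by linarith)

lemma le_lintegral_beta {N : ℕ} {q : ℝ} (hq : 0 < q) :
    ENNReal.ofReal ((2 : ℝ) ^ (-(q + N)) * (1 / q)) ≤
    ∫⁻ u in Set.Ioi (0 : ℝ), ENNReal.ofReal (u ^ (N - 1 : ℝ) * (1 + u) ^ (-(q + N))) := by
  rw [ENNReal.ofReal_mul (by positivity), ← lintegral_Ioi_one_rpow hq,
    ← lintegral_const_mul _ (by fun_prop)]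
  refine (setLIntegral_mono' measurableSet_Ioi fun u (hu : 1 < u) => ?_).trans
    (lintegral_mono_set (Set.Ioi_subset_Ioi zero_le_one))
  rw [← ENNReal.ofReal_mul (by positivity)]
  apply ENNReal.ofReal_le_ofReal
  have hu0 : 0 < u := by linarith
  have e : u ^ (-q - 1) = u ^ (N - 1 : ℝ) * u ^ (-(q + N)) := by
    rw [← Real.rpow_add hu0]; congr 1; ring
  have e2 : (2 : ℝ) ^ (-(q + N)) * u ^ (-(q + N)) = (2 * u) ^ (-(q + N)) :=
    (Real.mul_rpow (by norm_num) hu0.le).symm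
  rw [e, mul_left_comm, e2]
  gcongr u ^ (N - 1 : ℝ) * ?_
  exact Real.rpow_le_rpow_of_nonpos (by linarith) (by linarith) (by
    have : (0 : ℝ) ≤ N := by positivity
    linarith)

/-- Upper bound for the moments of a symmetric Dirichlet distribution. -/
lemma lintegral_prod_pow_dirichlet_le [NeZero p] {a : ℝ} (ha : 0 < a) (m : Fin p → ℕ) {N : ℕ}
    (hm : ∑ j, m j = N) (hN : 0 < N) :
    ∫⁻ η, ∏ j, ENNReal.ofReal (η j) ^ m j ∂(dirichlet p a) ≤
      ENNReal.ofReal (a ^ (Finset.univ.filter fun j => m j ≠ 0).card * (1 + a) ^ N *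
        (1 + 1 / (p * a))) := by
  have hp : (0 : ℝ) < p := by exact_mod_cast Nat.pos_of_ne_zero (NeZero.ne p)
  rw [lintegral_prod_pow_dirichlet ha m hm hN]
  have hG : 0 < Real.Gamma a := Real.Gamma_pos_of_pos ha
  have hN' : (0 : ℝ) < N := by exact_mod_cast hN
  have hΓ : Real.Gamma N = ((N - 1).factorial : ℝ) := by
    rw [← Real.Gamma_nat_eq_factorial]; congr 1; rw [Nat.cast_sub hN]; simp
  have hfac : (0 : ℝ) < ((N - 1).factorial : ℝ) := by exact_mod_cast Nat.factorial_pos _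
  have hkey : (∏ j, Real.Gamma (a + m j) / Real.Gamma a) / Real.Gamma N ≤
      a ^ (Finset.univ.filter fun j => m j ≠ 0).card * (1 + a) ^ N := by
    rw [hΓ, div_le_iff₀ hfac]
    calc ∏ j, Real.Gamma (a + m j) / Real.Gamma a
        ≤ ∏ j, (if m j = 0 then 1 else a) * ((1 + a) ^ m j * ((m j - 1).factorial : ℝ)) :=
          Finset.prod_le_prod (fun j _ => (div_pos (Real.Gamma_pos_of_pos (by positivity)) hG).le)
            fun j _ => Gamma_add_nat_div_le ha (m j)
      _ = a ^ (Finset.univ.filter fun j => m j ≠ 0).card * (1 + a) ^ N *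
          ((∏ j, (m j - 1).factorial : ℕ) : ℝ) := by
          rw [Finset.prod_mul_distrib, Finset.prod_mul_distrib, Finset.prod_pow_eq_pow_sum, hm,
            Finset.prod_ite, Finset.prod_const_one, Finset.prod_const]
          push_cast; ring
      _ ≤ _ := by
          gcongr
          refine (Nat.le_of_dvd (Nat.factorial_pos _)
            (Nat.prod_factorial_dvd_factorial_sum Finset.univ fun j => m j - 1)).trans
            (Nat.factorial_le ?_)
          obtain ⟨i, -, hi⟩ : ∃ i ∈ Finset.univ, m i ≠ 0 := by
            by_contra! h
            rw [Finset.sum_eq_zero h] at hm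
            omega
          have : ∑ j, (m j - 1) < ∑ j, m j :=
            Finset.sum_lt_sum (fun j _ => Nat.sub_le _ _) ⟨i, Finset.mem_univ i, by omega⟩
          omega
  calc _ ≤ ENNReal.ofReal (a ^ (Finset.univ.filter fun j => m j ≠ 0).card * (1 + a) ^ N) *
        ENNReal.ofReal (1 + 1 / (p * a)) := by
        gcongr
        exact lintegral_beta_le hN (by positivity)
    _ = _ := by rw [← ENNReal.ofReal_mul (by positivity)]

/-- Lower bound for the moments of a symmetric Dirichlet distribution. -/
lemma le_lintegral_prod_pow_dirichlet [NeZero p] {a : ℝ} (ha : 0 < a) (m : Fin p → ℕ) {N : ℕ}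
    (hm : ∑ j, m j = N) (hN : 0 < N) :
    ENNReal.ofReal (a ^ (Finset.univ.filter fun j => m j ≠ 0).card / (N : ℝ) ^ N *
        ((2 : ℝ) ^ (-(p * a + N)) * (1 / (p * a)))) ≤
    ∫⁻ η, ∏ j, ENNReal.ofReal (η j) ^ m j ∂(dirichlet p a) := by
  have hp : (0 : ℝ) < p := by exact_mod_cast Nat.pos_of_ne_zero (NeZero.ne p)
  rw [lintegral_prod_pow_dirichlet ha m hm hN]
  have hG : 0 < Real.Gamma a := Real.Gamma_pos_of_pos ha
  have hN' : (0 : ℝ) < N := by exact_mod_cast hN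
  have hΓ : Real.Gamma N = ((N - 1).factorial : ℝ) := by
    rw [← Real.Gamma_nat_eq_factorial]; congr 1; rw [Nat.cast_sub hN]; simp
  have hfac : (0 : ℝ) < ((N - 1).factorial : ℝ) := by exact_mod_cast Nat.factorial_pos _
  rw [ENNReal.ofReal_mul (by positivity)]
  refine mul_le_mul' (ENNReal.ofReal_le_ofReal ?_) (le_lintegral_beta (by positivity))
  rw [hΓ]
  have h1 : a ^ (Finset.univ.filter fun j => m j ≠ 0).card ≤
      ∏ j, Real.Gamma (a + m j) / Real.Gamma a := by
    calc _ = ∏ j, (if m j = 0 then 1 else a) := by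
          rw [Finset.prod_ite, Finset.prod_const_one, Finset.prod_const, one_mul]
      _ ≤ _ := Finset.prod_le_prod (fun j _ => by split_ifs <;> positivity)
          fun j _ => le_Gamma_add_nat_div ha (m j)
  have h2 : ((N - 1).factorial : ℝ) ≤ (N : ℝ) ^ N := by
    exact_mod_cast (Nat.factorial_le (Nat.sub_le N 1)).trans (Nat.factorial_le_pow N)
  have : 0 ≤ ∏ j, Real.Gamma (a + m j) / Real.Gamma a :=
    le_trans (by positivity) h1
  gcongr

/-- The Dirichlet distribution is a probability measure on `{η | η ≥ 0, ∑ η ≤ 1}`. -/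
lemma isProbabilityMeasure_dirichlet {a : ℝ} (ha : 0 < a) :
    IsProbabilityMeasure (dirichlet p a) := by
  have hprob : IsProbabilityMeasure (gammaMeasure a 1) := isProbabilityMeasure_gammaMeasure ha one_pos
  have hm : Measurable fun (g : Fin p → ℝ) (j : Fin p) => g j / ∑ i, g i := by fun_prop
  exact Measure.isProbabilityMeasure_map hm.aemeasurable

lemma ae_dirichlet {a : ℝ} (ha : 0 < a) :
    ∀ᵐ η ∂(dirichlet p a), (∀ j, 0 ≤ η j) ∧ ∑ j, η j ≤ 1 := by
  have hprob : IsProbabilityMeasure (gammaMeasure a 1) := isProbabilityMeasure_gammaMeasure ha one_pos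
  have hpos : ∀ᵐ g ∂(Measure.pi fun _ : Fin p => gammaMeasure a 1), ∀ j, 0 < g j :=
    ae_all_iff.2 fun j => (measurePreserving_eval (fun _ : Fin p => gammaMeasure a 1) j).quasiMeasurePreserving.ae
      (ae_gammaMeasure_pos a)
  have hs : MeasurableSet {η : Fin p → ℝ | (∀ j, 0 ≤ η j) ∧ ∑ j, η j ≤ 1} := by
    have h1 : MeasurableSet {η : Fin p → ℝ | ∀ j, 0 ≤ η j} := by
      rw [Set.ofPred_forall]
      exact MeasurableSet.iInter fun j => measurableSet_le measurable_const (measurable_pi_apply j)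
    have h2 : MeasurableSet {η : Fin p → ℝ | ∑ j, η j ≤ 1} :=
      measurableSet_le (by fun_prop) measurable_const
    exact h1.inter h2
  rw [dirichlet, ae_map_iff (by fun_prop) hs]
  filter_upwards [hpos] with g hg
  refine ⟨fun j => div_nonneg (hg j).le (Finset.sum_nonneg fun i _ => (hg i).le), ?_⟩
  rw [← Finset.sum_div]
  exact div_self_le_one _

end Forest

end

noncomputable section

namespace Forest

/-! ### Combinatorics of trees -/

variable {p b : ℕ} {Z : Fin b → Fin p → ℝ}

/-- A splitting coordinate together with a split-point. -/
abbrev SplitLabel (Z : Fin b → Fin p → ℝ) : Type := (j : Fin p) × {τ : ℝ // τ ∈ coordSet Z j}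

namespace ZTree

/-- A tree is a leaf, or a label together with two subtrees. -/
def equivSum (Z : Fin b → Fin p → ℝ) :
    Unit ⊕ (SplitLabel Z × ZTree Z × ZTree Z) ≃ ZTree Z where
  toFun
    | Sum.inl _ => leaf
    | Sum.inr x => node x.1.1 x.1.2 x.2.1 x.2.2
  invFun
    | leaf => Sum.inl ()
    | node j τ l r => Sum.inr (⟨j, τ⟩, l, r)
  left_inv x := by rcases x with _ | ⟨⟨_, _⟩, _, _⟩ <;> rfl
  right_inv t := by cases t <;> rfl

lemma tsum_eq (f : ZTree Z → ℝ≥0∞) :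
    ∑' t, f t = f leaf + ∑ j, ∑ τ : {τ : ℝ // τ ∈ coordSet Z j}, ∑' l, ∑' r, f (node j τ l r) := by
  rw [← (equivSum Z).tsum_eq, Summable.tsum_sum ENNReal.summable ENNReal.summable]
  congr 1
  · simp [equivSum]
  · rw [ENNReal.tsum_prod', ENNReal.tsum_sigma', tsum_fintype]
    refine Finset.sum_congr rfl fun j _ => ?_
    rw [tsum_fintype]
    refine Finset.sum_congr rfl fun τ _ => ?_
    rw [ENNReal.tsum_prod']
    rfl

lemma finite_height_le (h : ℕ) : {t : ZTree Z | t.height ≤ h}.Finite := by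
  induction h with
  | zero =>
    refine (Set.finite_singleton leaf).subset fun t ht => ?_
    cases t with
    | leaf => rfl
    | node => simp [height] at ht
  | succ h ih =>
    refine ((Set.finite_singleton leaf).union ((Set.finite_univ (α := SplitLabel Z)).prod
      (ih.prod ih) |>.image fun x => node x.1.1 x.1.2 x.2.1 x.2.2)).subset fun t ht => ?_
    cases t with
    | leaf => exact Or.inl rfl
    | node j τ l r =>
      refine Or.inr ⟨(⟨j, τ⟩, l, r), ?_, rfl⟩
      simp only [Set.mem_ofPred_eq, height] at ht
      simp only [Set.mem_prod, Set.mem_ofPred_eq, Set.mem_univ, true_and]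
      omega

instance : Countable (ZTree Z) := by
  rw [← Set.countable_univ_iff]
  have : (Set.univ : Set (ZTree Z)) = ⋃ h : ℕ, {t | t.height ≤ h} := by
    ext t; simp only [Set.mem_univ, Set.mem_iUnion, Set.mem_ofPred_eq, true_iff]; exact ⟨_, le_rfl⟩
  rw [this]
  exact Set.countable_iUnion fun h => (finite_height_le h).countable

/-- A Kraft inequality: weights of trees that are bounded by a branching recursion have a bounded
sum. -/
lemma tsum_le_of_branching (φ : ZTree Z → ℕ → Cell p → ℝ≥0∞) (a c G : ℕ → ℝ≥0∞)
    (q : Cell p → SplitLabel Z → ℝ≥0∞)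
    (hleaf : ∀ ℓ Ω, φ leaf ℓ Ω ≤ a ℓ)
    (hnode : ∀ j τ l r ℓ Ω, φ (node j τ l r) ℓ Ω ≤
      c ℓ * q Ω ⟨j, τ⟩ * (φ l (ℓ + 1) (Ω.left j τ) * φ r (ℓ + 1) (Ω.right j τ)))
    (hq : ∀ Ω, ∑ x, q Ω x ≤ 1) (hG : ∀ ℓ, a ℓ + c ℓ * G (ℓ + 1) ^ 2 ≤ G ℓ) (ℓ : ℕ) (Ω : Cell p) :
    ∑' t, φ t ℓ Ω ≤ G ℓ := by
  have key : ∀ (h ℓ : ℕ) (Ω : Cell p), ∑' t : ZTree Z, (if t.height ≤ h then φ t ℓ Ω else 0) ≤ G ℓ := by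
    intro h
    induction h with
    | zero =>
      intro ℓ Ω
      rw [tsum_eq]
      simp only [height, Nat.le_zero_eq, Nat.add_eq_zero_iff, one_ne_zero, and_false, if_false,
        tsum_zero, Finset.sum_const_zero, add_zero, if_true]
      exact (hleaf ℓ Ω).trans (le_self_add.trans (hG ℓ))
    | succ h ih =>
      intro ℓ Ω
      rw [tsum_eq]
      refine le_trans (add_le_add ?_ ?_) (hG ℓ)
      · simpa [height] using hleaf ℓ Ω
      · calc _ ≤ ∑ j, ∑ τ : {τ : ℝ // τ ∈ coordSet Z j}, ∑' l : ZTree Z, ∑' r : ZTree Z,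
              c ℓ * q Ω ⟨j, τ⟩ * ((if l.height ≤ h then φ l (ℓ + 1) (Ω.left j τ) else 0) *
                (if r.height ≤ h then φ r (ℓ + 1) (Ω.right j τ) else 0)) := by
              refine Finset.sum_le_sum fun j _ => Finset.sum_le_sum fun τ _ =>
                ENNReal.tsum_le_tsum fun l => ENNReal.tsum_le_tsum fun r => ?_
              by_cases h1 : (node j τ l r).height ≤ h + 1
              · have h2 : l.height ≤ h ∧ r.height ≤ h := by
                  simp only [height] at h1; omega
                rw [if_pos h1, if_pos h2.1, if_pos h2.2]
                exact hnode j τ l r ℓ Ω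
              · rw [if_neg h1]; exact zero_le
          _ ≤ ∑ j, ∑ τ : {τ : ℝ // τ ∈ coordSet Z j}, c ℓ * q Ω ⟨j, τ⟩ * G (ℓ + 1) ^ 2 := by
              refine Finset.sum_le_sum fun j _ => Finset.sum_le_sum fun τ _ => ?_
              simp_rw [ENNReal.tsum_mul_left, ENNReal.tsum_mul_right]
              rw [sq]
              gcongr
              · exact ih _ _
              · exact ih _ _
          _ = c ℓ * G (ℓ + 1) ^ 2 * ∑ x, q Ω x := by
              rw [Fintype.sum_sigma, Finset.mul_sum]
              refine Finset.sum_congr rfl fun j _ => ?_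
              rw [Finset.mul_sum]
              exact Finset.sum_congr rfl fun τ _ => by ring
          _ ≤ c ℓ * G (ℓ + 1) ^ 2 * 1 := by gcongr; exact hq Ω
          _ = _ := mul_one _
  rw [ENNReal.tsum_eq_iSup_sum]
  refine iSup_le fun F => ?_
  refine le_trans ?_ (key (F.sup height) ℓ Ω)
  refine le_trans (Finset.sum_le_sum fun t ht => ?_) (ENNReal.sum_le_tsum F)
  rw [if_pos (Finset.le_sup ht)]

/-- The number of nodes that are split along the coordinate `i`. -/
def splitCount : ZTree Z → Fin p → ℕ
  | leaf, _ => 0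
  | node j _ l r, i => (if i = j then 1 else 0) + (l.splitCount i + r.splitCount i)

lemma sum_splitCount_add_one (t : ZTree Z) : ∑ i, t.splitCount i + 1 = t.numLeaves := by
  induction t with
  | leaf => simp [splitCount, numLeaves]
  | node j τ l r hl hr =>
    simp only [splitCount, numLeaves, Finset.sum_add_distrib, Finset.sum_ite_eq', Finset.mem_univ,
      if_true]
    omega

lemma numLeaves_pos (t : ZTree Z) : 0 < t.numLeaves := by
  rw [← sum_splitCount_add_one]; omega

lemma choppedIn_iff (S : Set (Fin p)) (t : ZTree Z) :
    t.ChoppedIn S ↔ ∀ i, t.splitCount i ≠ 0 → i ∈ S := by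
  induction t with
  | leaf => simp [ChoppedIn, splitCount]
  | node j τ l r hl hr =>
    simp only [ChoppedIn, splitCount, hl, hr]
    constructor
    · rintro ⟨h1, h2, h3⟩ i hi
      by_cases hij : i = j
      · exact hij ▸ h1
      · by_cases h4 : l.splitCount i = 0
        · exact h3 i (by simpa [hij, h4] using hi)
        · exact h2 i h4
    · intro h
      exact ⟨h j (by simp), fun i hi => h i (by omega), fun i hi => h i (by omega)⟩

open Classical in
/-- The generating function of the trees with splitting coordinates in `U`. -/
lemma tsum_choppedIn_le (U : Finset (Fin p)) {A : ℕ} (hA : 0 < A)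
    (hU : ∑ j ∈ U, (coordSet Z j).card ≤ A) :
    ∑' t : ZTree Z, (if t.ChoppedIn (U : Set (Fin p)) then
      (ENNReal.ofReal (1 / (4 * A))) ^ t.numLeaves else 0) ≤ 1 := by
  classical
  have hA' : (1 : ℝ) ≤ A := by exact_mod_cast hA
  set x : ℝ≥0∞ := ENNReal.ofReal (1 / (4 * A)) with hx
  have h1 : ∑' t : ZTree Z, (if t.ChoppedIn (U : Set (Fin p)) then x ^ t.numLeaves else 0) ≤
      ENNReal.ofReal (1 / (2 * A)) := by
    refine tsum_le_of_branching (fun t _ _ => if t.ChoppedIn (U : Set (Fin p)) then x ^ t.numLeaves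
      else 0) (fun _ => x) (fun _ => (A : ℝ≥0∞)) (fun _ => ENNReal.ofReal (1 / (2 * A)))
      (fun _ y => if y.1 ∈ U then (A : ℝ≥0∞)⁻¹ else 0) ?_ ?_ ?_ ?_ 0 (Cell.unit p)
    · intro ℓ Ω; simp [ChoppedIn, numLeaves]
    · intro j τ l r ℓ Ω
      by_cases hj : j ∈ U <;> by_cases hl : l.ChoppedIn (U : Set (Fin p)) <;>
        by_cases hr : r.ChoppedIn (U : Set (Fin p)) <;>
        simp [ChoppedIn, hj, hl, hr, numLeaves, pow_add]
      rw [ENNReal.mul_inv_cancel (by simpa using hA.ne') (by simp), one_mul]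
    · intro Ω
      rw [Fintype.sum_sigma]
      have e : ∀ j, (∑ _τ : {τ : ℝ // τ ∈ coordSet Z j}, if j ∈ U then (A : ℝ≥0∞)⁻¹ else 0) =
          if j ∈ U then ((coordSet Z j).card : ℝ≥0∞) * (A : ℝ≥0∞)⁻¹ else 0 := by
        intro j
        rw [Finset.sum_const, Finset.card_univ, Fintype.card_coe, nsmul_eq_mul, mul_ite, mul_zero]
      simp only [e]
      rw [Finset.sum_ite_mem, Finset.univ_inter, ← Finset.sum_mul, ← Nat.cast_sum]
      rw [← div_eq_mul_inv]
      exact ENNReal.div_le_of_le_mul (by rw [one_mul]; exact_mod_cast hU)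
    · intro ℓ
      rw [hx, ← ENNReal.ofReal_pow (by positivity), ← ENNReal.ofReal_natCast,
        ← ENNReal.ofReal_mul (by positivity), ← ENNReal.ofReal_add (by positivity) (by positivity)]
      apply ENNReal.ofReal_le_ofReal
      apply le_of_eq
      field_simp
      norm_num
  refine h1.trans ?_
  rw [← ENNReal.ofReal_one]
  apply ENNReal.ofReal_le_ofReal
  rw [div_le_one (by positivity)]
  linarith

/-! ### Grafted trees -/

lemma numLeaves_graft (t : ZTree Z) (g : Fin t.numLeaves → ZTree Z) :
    (t.graft g).numLeaves = ∑ k, (g k).numLeaves := by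
  induction t with
  | leaf => exact (Fin.sum_univ_one fun k : Fin 1 => (g k).numLeaves).symm
  | node j τ l r hl hr =>
    simp only [graft, numLeaves, hl, hr]
    exact (Fin.sum_univ_add fun k : Fin (l.numLeaves + r.numLeaves) => (g k).numLeaves).symm

lemma choppedIn_graft {S : Set (Fin p)} (t : ZTree Z) (g : Fin t.numLeaves → ZTree Z)
    (ht : t.ChoppedIn S) (hg : ∀ k, (g k).ChoppedIn S) : (t.graft g).ChoppedIn S := by
  induction t with
  | leaf => exact hg _
  | node j τ l r hl hr => exact ⟨ht.1, hl _ ht.2.1 fun k => hg _, hr _ ht.2.2 fun k => hg _⟩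

lemma valid_graft (t : ZTree Z) (g : Fin t.numLeaves → ZTree Z) (Ω : Cell p)
    (ht : t.Valid Ω) (hg : ∀ k, (g k).Valid (t.leafCell Ω k)) : (t.graft g).Valid Ω := by
  induction t generalizing Ω with
  | leaf => exact hg _
  | node j τ l r hl hr =>
    refine ⟨ht.1, hl _ _ ht.2.1 fun k => ?_, hr _ _ ht.2.2 fun k => ?_⟩
    · simpa [leafCell] using hg (Fin.castAdd r.numLeaves k)
    · simpa [leafCell] using hg (Fin.natAdd l.numLeaves k)

lemma height_graft_le (t : ZTree Z) (g : Fin t.numLeaves → ZTree Z) {L : ℕ}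
    (hg : ∀ k, (g k).height ≤ L) : (t.graft g).height ≤ t.height + L := by
  induction t with
  | leaf => simpa [graft, height] using hg _
  | node j τ l r hl hr =>
    have h1 := hl (fun i => g (Fin.castAdd r.numLeaves i)) fun k => hg _
    have h2 := hr (fun i => g (Fin.natAdd l.numLeaves i)) fun k => hg _
    simp only [graft, height]
    omega

end ZTree

open ZTree

lemma IsAKDFrom.properties {d : ℕ} {α : Fin d → ℝ} {S : Fin d ↪o Fin p} {m i : ℕ} {Ω : Cell p}
    {t : ZTree Z} (h : IsAKDFrom Z α S m i Ω t) :
    t.Valid Ω ∧ t.ChoppedIn (Set.range S) ∧ t.height ≤ m ∧ t.numLeaves = 2 ^ m := by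
  induction m generalizing i Ω t with
  | zero =>
    simp only [IsAKDFrom] at h
    subst h
    simp [Valid, ChoppedIn, height, numLeaves]
  | succ m ih =>
    obtain ⟨j, τ, l, r, -, hmid, rfl, hl, hr⟩ := h
    obtain ⟨l1, l2, l3, l4⟩ := ih hl
    obtain ⟨r1, r2, r3, r4⟩ := ih hr
    refine ⟨⟨hmid.1, l1, r1⟩, ⟨⟨j, rfl⟩, l2, r2⟩, ?_, ?_⟩
    · simp only [height]; omega
    · simp only [numLeaves, l4, r4]; ring

/-! ### The tree process -/

variable {ν : ℝ} {η : Fin p → ℝ}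

lemma sum_cand_empty_nonneg (hη : ∀ j, 0 ≤ η j) (Ω : Cell p) :
    0 ≤ ∑ j, if Ω.cand Z j = ∅ then η j else 0 :=
  Finset.sum_nonneg fun j _ => by split_ifs; exacts [hη j, le_rfl]

lemma treeProb_nonneg (hν0 : 0 ≤ ν) (hν1 : ν ≤ 1) (hη : ∀ j, 0 ≤ η j) (t : ZTree Z) (ℓ : ℕ)
    (Ω : Cell p) : 0 ≤ treeProb Z ν η t ℓ Ω := by
  induction t generalizing ℓ Ω with
  | leaf =>
    have h1 : ν ^ (ℓ + 1) ≤ 1 := pow_le_one₀ hν0 hν1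
    have h2 := sum_cand_empty_nonneg (Z := Z) hη Ω
    simp only [treeProb]
    have := mul_nonneg (pow_nonneg hν0 (ℓ + 1)) h2
    linarith
  | node j τ l r hl hr =>
    simp only [treeProb]
    split_ifs
    · have := hl (ℓ + 1) (Ω.left j τ)
      have := hr (ℓ + 1) (Ω.right j τ)
      have := hη j
      positivity
    · exact le_rfl

lemma treeProb_leaf_le_one (hν0 : 0 ≤ ν) (hη : ∀ j, 0 ≤ η j) (hη1 : ∑ j, η j ≤ 1) (ℓ : ℕ)
    (Ω : Cell p) : treeProb Z ν η .leaf ℓ Ω ≤ 1 := by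
  simp only [treeProb]
  have h2 : (∑ j, if Ω.cand Z j = ∅ then η j else 0) ≤ 1 :=
    (Finset.sum_le_sum fun j _ => by split_ifs; exacts [le_rfl, hη j]).trans hη1
  have := mul_le_mul_of_nonneg_left h2 (pow_nonneg hν0 (ℓ + 1))
  linarith

lemma treeProb_le_prod (hν0 : 0 ≤ ν) (hν1 : ν ≤ 1) (hη : ∀ j, 0 ≤ η j) (hη1 : ∑ j, η j ≤ 1)
    (t : ZTree Z) (ℓ : ℕ) (Ω : Cell p) :
    treeProb Z ν η t ℓ Ω ≤ ∏ i, η i ^ t.splitCount i := by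
  induction t generalizing ℓ Ω with
  | leaf => simpa [splitCount] using treeProb_leaf_le_one hν0 hη hη1 ℓ Ω
  | node j τ l r hl hr =>
    have e : ∏ i, η i ^ (ZTree.node j τ l r).splitCount i =
        η j * ((∏ i, η i ^ l.splitCount i) * ∏ i, η i ^ r.splitCount i) := by
      simp only [splitCount, pow_add, Finset.prod_mul_distrib]
      simp
    have hP : ∀ t : ZTree Z, 0 ≤ ∏ i, η i ^ t.splitCount i := fun t =>
      Finset.prod_nonneg fun i _ => pow_nonneg (hη i) _
    rw [e]
    simp only [treeProb]
    split_ifs with hc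
    · have hcard : ((Ω.cand Z j).card : ℝ)⁻¹ ≤ 1 :=
        inv_le_one_of_one_le₀ (by exact_mod_cast Finset.card_pos.2 ⟨_, hc⟩)
      have h1 : ν ^ (ℓ + 1) ≤ 1 := pow_le_one₀ hν0 hν1
      have h0 : 0 ≤ ν ^ (ℓ + 1) := pow_nonneg hν0 _
      have a1 : ν ^ (ℓ + 1) * (η j * ((Ω.cand Z j).card : ℝ)⁻¹) ≤ 1 * (η j * 1) := by
        have := hη j
        gcongr
      rw [one_mul, mul_one] at a1
      have hl0 := treeProb_nonneg hν0 hν1 hη l (ℓ + 1) (Ω.left j τ)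
      have hr0 := treeProb_nonneg hν0 hν1 hη r (ℓ + 1) (Ω.right j τ)
      exact mul_le_mul a1 (mul_le_mul (hl _ _) (hr _ _) hr0 (hP _)) (mul_nonneg hl0 hr0) (hη j)
    · exact mul_nonneg (hη j) (mul_nonneg (hP _) (hP _))

lemma le_treeProb (hν0 : 0 < ν) (hν1 : ν ≤ 1 / 2) (hη : ∀ j, 0 ≤ η j) {A : ℕ}
    (hA : ∀ j, (coordSet Z j).card ≤ A) (hA0 : 0 < A) {H : ℕ} (t : ZTree Z) (ℓ : ℕ)
    (Ω : Cell p) (hv : t.Valid Ω) (hh : ℓ + t.height ≤ H) :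
    (ν ^ H / (2 * A)) ^ t.numLeaves * ∏ i, η i ^ t.splitCount i ≤ treeProb Z ν η t ℓ Ω := by
  have hA' : (1 : ℝ) ≤ A := by exact_mod_cast hA0
  set x : ℝ := ν ^ H / A with hx
  have hx0 : 0 < x := by positivity
  have hx1 : x ≤ 1 := by
    rw [hx, div_le_one (by positivity)]
    exact (pow_le_one₀ hν0.le (by linarith)).trans hA'
  have key : ∀ (t : ZTree Z) (ℓ : ℕ) (Ω : Cell p), t.Valid Ω → ℓ + t.height ≤ H →
      (1 / 2) ^ t.numLeaves * x ^ (∑ i, t.splitCount i) * ∏ i, η i ^ t.splitCount i ≤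
        treeProb Z ν η t ℓ Ω := by
    intro t
    induction t with
    | leaf =>
      intro ℓ Ω _ _
      have h2 := sum_cand_empty_nonneg (Z := Z) hη Ω
      have h1 : ν ^ (ℓ + 1) ≤ 1 / 2 := by
        rw [pow_succ]
        have : ν ^ ℓ ≤ 1 := pow_le_one₀ hν0.le (by linarith)
        nlinarith
      simp only [treeProb, numLeaves, splitCount, pow_one, pow_zero, Finset.prod_const_one,
        Finset.sum_const_zero, mul_one]
      have := mul_nonneg (pow_nonneg hν0.le (ℓ + 1)) h2
      linarith
    | node j τ l r hl hr =>
      intro ℓ Ω hv hh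
      simp only [height] at hh
      obtain ⟨hc, hvl, hvr⟩ := hv
      have e1 : ∏ i, η i ^ (ZTree.node j τ l r).splitCount i =
          η j * ((∏ i, η i ^ l.splitCount i) * ∏ i, η i ^ r.splitCount i) := by
        simp only [splitCount, pow_add, Finset.prod_mul_distrib]
        simp
      have e2 : ∑ i, (ZTree.node j τ l r).splitCount i =
          1 + (∑ i, l.splitCount i + ∑ i, r.splitCount i) := by
        simp [splitCount, Finset.sum_add_distrib]
      have hP : ∀ t : ZTree Z, 0 ≤ ∏ i, η i ^ t.splitCount i := fun t =>
        Finset.prod_nonneg fun i _ => pow_nonneg (hη i) _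
      rw [e1, e2]
      simp only [treeProb, if_pos hc, numLeaves]
      have h1 := hl (ℓ + 1) (Ω.left j τ) hvl (by omega)
      have h2 := hr (ℓ + 1) (Ω.right j τ) hvr (by omega)
      have hcard : (A : ℝ)⁻¹ ≤ ((Ω.cand Z j).card : ℝ)⁻¹ := by
        apply inv_anti₀ (by exact_mod_cast Finset.card_pos.2 ⟨_, hc⟩)
        exact_mod_cast (Finset.card_filter_le _ _).trans (hA j)
      have h3 : x ≤ ν ^ (ℓ + 1) * ((Ω.cand Z j).card : ℝ)⁻¹ := by
        rw [hx, div_eq_mul_inv]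
        have : ν ^ H ≤ ν ^ (ℓ + 1) := pow_le_pow_of_le_one hν0.le (by linarith) (by omega)
        gcongr
      have hηj := hη j
      have hPl := hP l
      have hPr := hP r
      calc _ = (x * η j) * (((1 / 2) ^ l.numLeaves * x ^ (∑ i, l.splitCount i) *
              ∏ i, η i ^ l.splitCount i) * ((1 / 2) ^ r.numLeaves * x ^ (∑ i, r.splitCount i) *
              ∏ i, η i ^ r.splitCount i)) := by
            rw [pow_add, pow_add, pow_add]; ring
        _ ≤ (ν ^ (ℓ + 1) * ((Ω.cand Z j).card : ℝ)⁻¹ * η j) *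
            (treeProb Z ν η l (ℓ + 1) (Ω.left j τ) * treeProb Z ν η r (ℓ + 1) (Ω.right j τ)) := by
            have hl0 := treeProb_nonneg hν0.le (by linarith) hη l (ℓ + 1) (Ω.left j τ)
            gcongr
        _ = _ := by ring
  refine le_trans ?_ (key t ℓ Ω hv hh)
  refine mul_le_mul_of_nonneg_right ?_ (Finset.prod_nonneg fun i _ => pow_nonneg (hη i) _)
  have e : ν ^ H / (2 * A) = 1 / 2 * x := by rw [hx]; field_simp
  rw [e, mul_pow]
  refine mul_le_mul_of_nonneg_left ?_ (by positivity)
  have hN := sum_splitCount_add_one t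
  exact pow_le_pow_of_le_one hx0.le hx1 (by omega)

/-- The generating function of the number of terminal nodes under the tree process. -/
lemma tsum_treeProb_mul_pow_le (hν0 : 0 < ν) (hν1 : ν ≤ 1 / 2) (hη : ∀ j, 0 ≤ η j)
    (hη1 : ∑ j, η j ≤ 1) {m : ℕ} (hm : 0 < m) :
    ∑' t : ZTree Z, ENNReal.ofReal (treeProb Z ν η t 0 (Cell.unit p)) *
      ((2 : ℝ≥0∞) ^ (m - 1)) ^ t.numLeaves ≤ (2 : ℝ≥0∞) ^ (m * 2 ^ m) := by
  classical
  set x : ℝ≥0∞ := 2 ^ (m - 1) with hx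
  have hx2 : x * 2 = 2 ^ m := by rw [hx, ← pow_succ]; congr 1; omega
  refine (tsum_le_of_branching (fun t ℓ Ω => ENNReal.ofReal (treeProb Z ν η t ℓ Ω) * x ^ t.numLeaves)
    (fun _ => x) (fun ℓ => ENNReal.ofReal (ν ^ (ℓ + 1))) (fun ℓ => (2 : ℝ≥0∞) ^ (m * 2 ^ (m - ℓ)))
    (fun Ω y => if (y.2 : ℝ) ∈ Ω.cand Z y.1 then
      ENNReal.ofReal (η y.1 * ((Ω.cand Z y.1).card : ℝ)⁻¹) else 0) ?_ ?_ ?_ ?_ 0 (Cell.unit p)).trans ?_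
  · intro ℓ Ω
    have : ENNReal.ofReal (treeProb Z ν η .leaf ℓ Ω) ≤ 1 := by
      rw [← ENNReal.ofReal_one]
      exact ENNReal.ofReal_le_ofReal (treeProb_leaf_le_one hν0.le hη hη1 ℓ Ω)
    simpa [numLeaves] using mul_le_mul_left this x
  · intro j τ l r ℓ Ω
    simp only [treeProb]
    split_ifs with hc
    · have := hη j
      have hl0 := treeProb_nonneg hν0.le (by linarith) hη l (ℓ + 1) (Ω.left j τ)
      rw [ENNReal.ofReal_mul (by positivity), ENNReal.ofReal_mul (by positivity),
        ENNReal.ofReal_mul hl0, numLeaves, pow_add]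
      apply le_of_eq
      ring
    · simp
  · intro Ω
    rw [Fintype.sum_sigma]
    calc _ ≤ ∑ j, ENNReal.ofReal (η j) := by
          refine Finset.sum_le_sum fun j _ => ?_
          simp only
          rw [← Finset.sum_filter, Finset.sum_const, nsmul_eq_mul,
            ← ENNReal.ofReal_natCast, ← ENNReal.ofReal_mul (by positivity)]
          apply ENNReal.ofReal_le_ofReal
          have hcard : (Finset.univ.filter
              fun τ : {τ : ℝ // τ ∈ coordSet Z j} => (τ : ℝ) ∈ Ω.cand Z j).card ≤ (Ω.cand Z j).card := by
            apply Finset.card_le_card_of_injOn (fun τ : {τ : ℝ // τ ∈ coordSet Z j} => (τ : ℝ))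
            · intro τ hτ; simpa using hτ
            · exact fun τ _ τ' _ h => Subtype.ext (by exact h)
          have h1 : (((Finset.univ.filter
              fun τ : {τ : ℝ // τ ∈ coordSet Z j} => (τ : ℝ) ∈ Ω.cand Z j).card : ℕ) : ℝ) * ((Ω.cand Z j).card : ℝ)⁻¹ ≤ 1 := by
            rw [← div_eq_mul_inv]
            exact div_le_one_of_le₀ (by exact_mod_cast hcard) (by positivity)
          have := mul_le_mul_of_nonneg_left h1 (hη j)
          linarith
      _ = ENNReal.ofReal (∑ j, η j) := (ENNReal.ofReal_sum_of_nonneg fun j _ => hη j).symm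
      _ ≤ 1 := by rw [← ENNReal.ofReal_one]; exact ENNReal.ofReal_le_ofReal hη1
  · intro ℓ
    have hνp : ENNReal.ofReal (ν ^ (ℓ + 1)) * 2 ^ (ℓ + 1) ≤ 1 := by
      rw [ENNReal.ofReal_pow hν0.le, ← mul_pow]
      apply pow_le_one₀ (by positivity)
      have : (2 : ℝ≥0∞) = ENNReal.ofReal 2 := by simp
      rw [this, ← ENNReal.ofReal_mul hν0.le, ← ENNReal.ofReal_one]
      exact ENNReal.ofReal_le_ofReal (by linarith)
    set G : ℝ≥0∞ := 2 ^ (m * 2 ^ (m - ℓ)) with hG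
    have hfin : G ≠ ⊤ := by simp [hG]
    have h1 : x * 2 ≤ G := by
      rw [hx2, hG]
      exact pow_le_pow_right₀ one_le_two (Nat.le_mul_of_pos_right _ (by positivity))
    have h2 : ENNReal.ofReal (ν ^ (ℓ + 1)) * (2 ^ (m * 2 ^ (m - (ℓ + 1)))) ^ 2 * 2 ≤ G := by
      rcases lt_or_ge ℓ m with hlt | hge
      · have e : (((2 : ℝ≥0∞) ^ (m * 2 ^ (m - (ℓ + 1)))) ^ 2) = G := by
          rw [hG, ← pow_mul]; congr 1
          rw [mul_assoc, ← pow_succ]; congr 2; omega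
        rw [e, mul_right_comm]
        have h3 : ENNReal.ofReal (ν ^ (ℓ + 1)) * 2 ≤ 1 := by
          refine le_trans ?_ hνp
          gcongr
          exact le_self_pow₀ one_le_two (by omega)
        simpa using mul_le_mul_left h3 G
      · have e1 : m - (ℓ + 1) = 0 := by omega
        have e2 : m - ℓ = 0 := by omega
        rw [hG, e1, e2, pow_zero, mul_one, ← pow_mul]
        calc ENNReal.ofReal (ν ^ (ℓ + 1)) * 2 ^ (m * 2) * 2
            = (ENNReal.ofReal (ν ^ (ℓ + 1)) * 2 ^ (m + 1)) * 2 ^ m := by ring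
          _ ≤ (ENNReal.ofReal (ν ^ (ℓ + 1)) * 2 ^ (ℓ + 1)) * 2 ^ m := by
              gcongr
              · exact one_le_two
          _ ≤ 1 * 2 ^ m := by gcongr
          _ = _ := one_mul _
    have h3 : (x + ENNReal.ofReal (ν ^ (ℓ + 1)) * (2 ^ (m * 2 ^ (m - (ℓ + 1)))) ^ 2) * 2 ≤ G * 2 := by
      rw [add_mul, mul_two G]
      exact add_le_add h1 h2
    exact (ENNReal.mul_le_mul_iff_left two_ne_zero ENNReal.ofNat_ne_top).1 h3
  · simp

end Forest

end

noncomputable section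

namespace Forest

/-! ### The prior on ensembles of trees -/

lemma tsum_fin_prod {β : Type*} (f : β → ℝ≥0∞) (T : ℕ) :
    ∑' E : Fin T → β, ∏ t, f (E t) = (∑' x, f x) ^ T := by
  induction T with
  | zero => simp
  | succ T ih =>
    rw [← (Fin.consEquiv fun _ : Fin (T + 1) => β).tsum_eq, ENNReal.tsum_prod', pow_succ', ← ih,
      ← ENNReal.tsum_mul_right]
    refine tsum_congr fun x => ?_
    rw [← ENNReal.tsum_mul_left]
    refine tsum_congr fun E => ?_
    simp [Fin.consEquiv, Fin.prod_univ_succ]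

variable {p b : ℕ} {Z : Fin b → Fin p → ℝ} {T : ℕ}

/-- The total number of terminal nodes of an ensemble. -/
def totalLeaves (E : Fin T → ZTree Z) : ℕ := ∑ t, (E t).numLeaves

/-- The number of splits along the coordinate `i` in an ensemble. -/
def totalSplits (E : Fin T → ZTree Z) (i : Fin p) : ℕ := ∑ t, (E t).splitCount i

/-- The coordinates along which an ensemble splits. -/
def usedCoords (E : Fin T → ZTree Z) : Finset (Fin p) := Finset.univ.filter fun i => totalSplits E i ≠ 0

lemma sum_totalSplits_add (E : Fin T → ZTree Z) : ∑ i, totalSplits E i + T = totalLeaves E := by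
  simp only [totalSplits, totalLeaves, ← ZTree.sum_splitCount_add_one]
  rw [Finset.sum_comm, Finset.sum_add_distrib]
  simp

lemma sum_totalSplits_le (E : Fin T → ZTree Z) : ∑ i, totalSplits E i ≤ totalLeaves E := by
  rw [← sum_totalSplits_add]; omega

lemma card_usedCoords_le (E : Fin T → ZTree Z) : (usedCoords E).card ≤ totalLeaves E := by
  refine le_trans ?_ (sum_totalSplits_le E)
  rw [Finset.card_eq_sum_ones]
  refine (Finset.sum_le_sum fun i hi => ?_).trans
    (Finset.sum_le_sum_of_subset (Finset.subset_univ (usedCoords E)))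
  have := (Finset.mem_filter.1 hi).2
  omega

lemma choppedIn_usedCoords (E : Fin T → ZTree Z) (t : Fin T) :
    (E t).ChoppedIn (usedCoords E : Set (Fin p)) := by
  rw [ZTree.choppedIn_iff]
  intro i hi
  simp only [usedCoords, Finset.coe_filter, Finset.mem_univ, true_and, Set.mem_ofPred_eq]
  have : (E t).splitCount i ≤ totalSplits E i :=
    Finset.single_le_sum (f := fun t => (E t).splitCount i) (fun _ _ => Nat.zero_le _)
      (Finset.mem_univ t)
  omega

variable {ν ζ ξ : ℝ}

lemma measurable_treeProb (t : ZTree Z) (ℓ : ℕ) (Ω : Cell p) :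
    Measurable fun η => treeProb Z ν η t ℓ Ω := by
  induction t generalizing ℓ Ω with
  | leaf =>
    simp only [treeProb]
    refine measurable_const.add (measurable_const.mul (Finset.measurable_sum _ fun j _ => ?_))
    split_ifs
    · exact measurable_pi_apply j
    · exact measurable_const
  | node j τ l r hl hr =>
    simp only [treeProb]
    split_ifs
    · exact (measurable_const.mul ((measurable_pi_apply j).mul_const _)).mul ((hl _ _).mul (hr _ _))
    · exact measurable_const

lemma tsum_ensembleProb_mul_pow_le (hν0 : 0 < ν) (hν1 : ν ≤ 1 / 2) (ha : 0 < ζ / (p : ℝ) ^ ξ)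
    {m : ℕ} (hm : 0 < m) :
    ∑' E : Fin T → ZTree Z, ensembleProb Z ν ζ ξ E * ((2 : ℝ≥0∞) ^ (m - 1)) ^ totalLeaves E ≤
      ((2 : ℝ≥0∞) ^ (m * 2 ^ m)) ^ T := by
  have hprob := isProbabilityMeasure_dirichlet (p := p) ha
  have hmeas : ∀ E : Fin T → ZTree Z, Measurable fun η : Fin p → ℝ =>
      ENNReal.ofReal (∏ t, treeProb Z ν η (E t) 0 (Cell.unit p)) := fun E =>
    (Finset.measurable_prod _ fun t _ => measurable_treeProb _ _ _).ennreal_ofReal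
  simp only [ensembleProb]
  simp_rw [← lintegral_mul_const _ (hmeas _)]
  rw [← lintegral_tsum fun E => ((hmeas E).mul_const _).aemeasurable]
  calc _ ≤ ∫⁻ _, ((2 : ℝ≥0∞) ^ (m * 2 ^ m)) ^ T ∂(dirichlet p (ζ / (p : ℝ) ^ ξ)) := by
        apply lintegral_mono_ae
        filter_upwards [ae_dirichlet (p := p) ha] with η hη
        refine le_trans (le_of_eq ?_) (pow_le_pow_left' (tsum_treeProb_mul_pow_le (Z := Z) hν0 hν1
          hη.1 hη.2 hm) T)
        rw [← tsum_fin_prod]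
        refine tsum_congr fun E => ?_
        rw [Finset.prod_mul_distrib, totalLeaves, Finset.prod_pow_eq_pow_sum,
          ENNReal.ofReal_prod_of_nonneg fun t _ => treeProb_nonneg hν0.le (by linarith) hη.1 _ _ _]
    _ = _ := by simp

open Classical in
/-- Large ensembles have a small prior probability. -/
lemma tsum_ensembleProb_tail_le (hν0 : 0 < ν) (hν1 : ν ≤ 1 / 2) (ha : 0 < ζ / (p : ℝ) ^ ξ)
    {m : ℕ} (hm : 0 < m) (K : ℕ) :
    (∑' E : Fin T → ZTree Z, if K < totalLeaves E then ensembleProb Z ν ζ ξ E else 0) *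
      ((2 : ℝ≥0∞) ^ (m - 1)) ^ K ≤ ((2 : ℝ≥0∞) ^ (m * 2 ^ m)) ^ T := by
  refine le_trans ?_ (tsum_ensembleProb_mul_pow_le (Z := Z) hν0 hν1 ha hm)
  rw [← ENNReal.tsum_mul_right]
  refine ENNReal.tsum_le_tsum fun E => ?_
  split_ifs with h
  · gcongr
    exact one_le_pow₀ one_le_two
  · simp

lemma prod_treeProb_le (hν0 : 0 < ν) (hν1 : ν ≤ 1 / 2) (E : Fin T → ZTree Z)
    {η : Fin p → ℝ} (hη : ∀ j, 0 ≤ η j) (hη1 : ∑ j, η j ≤ 1) :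
    ENNReal.ofReal (∏ t, treeProb Z ν η (E t) 0 (Cell.unit p)) ≤
      ∏ j, ENNReal.ofReal (η j) ^ totalSplits E j := by
  simp_rw [← ENNReal.ofReal_pow (hη _)]
  rw [← ENNReal.ofReal_prod_of_nonneg fun j _ => pow_nonneg (hη j) _]
  apply ENNReal.ofReal_le_ofReal
  simp only [totalSplits, ← Finset.prod_pow_eq_pow_sum]
  rw [Finset.prod_comm]
  exact Finset.prod_le_prod (fun t _ => treeProb_nonneg hν0.le (by linarith) hη _ _ _)
    fun t _ => treeProb_le_prod hν0.le (by linarith) hη hη1 _ _ _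

/-- Upper bound for the prior probability of an ensemble. -/
lemma ensembleProb_le [NeZero p] (hν0 : 0 < ν) (hν1 : ν ≤ 1 / 2) {a : ℝ} (ha : 0 < a)
    (hae : a = ζ / (p : ℝ) ^ ξ) (E : Fin T → ZTree Z) :
    ensembleProb Z ν ζ ξ E ≤ ENNReal.ofReal (a ^ (usedCoords E).card * (1 + a) ^ totalLeaves E *
      (1 + 1 / (p * a))) := by
  have hp : (0 : ℝ) < p := by exact_mod_cast Nat.pos_of_ne_zero (NeZero.ne p)
  have hprob := isProbabilityMeasure_dirichlet (p := p) ha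
  rw [ensembleProb, ← hae]
  have h1 : ∫⁻ η, ENNReal.ofReal (∏ t, treeProb Z ν η (E t) 0 (Cell.unit p)) ∂(dirichlet p a) ≤
      ∫⁻ η, ∏ j, ENNReal.ofReal (η j) ^ totalSplits E j ∂(dirichlet p a) := by
    apply lintegral_mono_ae
    filter_upwards [ae_dirichlet (p := p) ha] with η hη
    exact prod_treeProb_le hν0 hν1 E hη.1 hη.2
  refine h1.trans ?_
  rcases Nat.eq_zero_or_pos (∑ i, totalSplits E i) with h0 | h0
  · have h2 : ∀ i, totalSplits E i = 0 := fun i => (Finset.sum_eq_zero_iff.1 h0) i (Finset.mem_univ i)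
    have h3 : usedCoords E = ∅ := by simp [usedCoords, h2]
    simp only [h2, pow_zero, Finset.prod_const_one, lintegral_const, measure_univ, mul_one, h3,
      Finset.card_empty, one_mul]
    rw [← ENNReal.ofReal_one]
    apply ENNReal.ofReal_le_ofReal
    have h4 : 1 ≤ (1 + a) ^ totalLeaves E := one_le_pow₀ (by linarith)
    have h5 : 1 ≤ 1 + 1 / (p * a) := by
      have : 0 < 1 / (p * a) := by positivity
      linarith
    nlinarith
  · refine (lintegral_prod_pow_dirichlet_le ha _ rfl h0).trans ?_
    apply ENNReal.ofReal_le_ofReal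
    rw [usedCoords]
    gcongr
    · linarith
    · exact sum_totalSplits_le E

/-- Lower bound for the prior probability of an ensemble. -/
lemma le_ensembleProb [NeZero p] (hν0 : 0 < ν) (hν1 : ν ≤ 1 / 2) {a : ℝ} (ha : 0 < a)
    (hae : a = ζ / (p : ℝ) ^ ξ) {A : ℕ} (hA : ∀ j, (coordSet Z j).card ≤ A) (hA0 : 0 < A) {H : ℕ}
    (E : Fin T → ZTree Z) (hv : ∀ t, (E t).Valid (Cell.unit p)) (hH : ∀ t, (E t).height ≤ H) {N : ℕ}
    (hN : ∑ i, totalSplits E i = N) (hN0 : 0 < N) :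
    ENNReal.ofReal ((ν ^ H / (2 * A)) ^ totalLeaves E *
      (a ^ (usedCoords E).card / (N : ℝ) ^ N * ((2 : ℝ) ^ (-(p * a + N)) * (1 / (p * a))))) ≤
    ensembleProb Z ν ζ ξ E := by
  rw [ensembleProb, ← hae, ENNReal.ofReal_mul (by positivity)]
  refine (mul_le_mul_right (le_lintegral_prod_pow_dirichlet ha _ hN hN0) _).trans ?_
  rw [← lintegral_const_mul _ (by fun_prop)]
  apply lintegral_mono_ae
  filter_upwards [ae_dirichlet (p := p) ha] with η hη
  simp_rw [← ENNReal.ofReal_pow (hη.1 _)]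
  rw [← ENNReal.ofReal_prod_of_nonneg fun j _ => pow_nonneg (hη.1 j) _,
    ← ENNReal.ofReal_mul (by positivity)]
  apply ENNReal.ofReal_le_ofReal
  have e : ∏ j, η j ^ totalSplits E j = ∏ t, ∏ j, η j ^ (E t).splitCount j := by
    simp only [totalSplits, ← Finset.prod_pow_eq_pow_sum]
    rw [Finset.prod_comm]
  rw [e, totalLeaves, ← Finset.prod_pow_eq_pow_sum, ← Finset.prod_mul_distrib]
  refine Finset.prod_le_prod (fun t _ => ?_) fun t _ =>
    le_treeProb hν0 hν1 hη.1 hA hA0 (E t) 0 _ (hv t) (by simpa using hH t)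
  exact mul_nonneg (by positivity) (Finset.prod_nonneg fun i _ => pow_nonneg (hη.1 i) _)

open Classical in
/-- The number of ensembles with at most `K` terminal nodes and splitting coordinates in `U`. -/
lemma tsum_choppedIn_totalLeaves_le (U : Finset (Fin p)) {A : ℕ} (hA : 0 < A)
    (hU : ∑ j ∈ U, (coordSet Z j).card ≤ A) (K : ℕ) :
    ∑' E : Fin T → ZTree Z, (if (∀ t, (E t).ChoppedIn (U : Set (Fin p))) ∧ totalLeaves E ≤ K
      then (1 : ℝ≥0∞) else 0) ≤ ENNReal.ofReal ((4 * A) ^ K) := by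
  have hA' : (1 : ℝ) ≤ A := by exact_mod_cast hA
  calc _ ≤ ∑' E : Fin T → ZTree Z, ENNReal.ofReal ((4 * A) ^ K) *
        ∏ t, (if (E t).ChoppedIn (U : Set (Fin p)) then
          ENNReal.ofReal (1 / (4 * A)) ^ (E t).numLeaves else 0) := by
        refine ENNReal.tsum_le_tsum fun E => ?_
        split_ifs with h
        · simp only [h.1, if_true]
          rw [Finset.prod_pow_eq_pow_sum, ← ENNReal.ofReal_pow (by positivity),
            ← ENNReal.ofReal_mul (by positivity), ← ENNReal.ofReal_one]
          apply ENNReal.ofReal_le_ofReal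
          rw [one_div, inv_pow, ← div_eq_mul_inv, one_le_div (by positivity)]
          exact pow_le_pow_right₀ (by linarith) h.2
        · exact zero_le
    _ = ENNReal.ofReal ((4 * A) ^ K) * (∑' t : ZTree Z, if t.ChoppedIn (U : Set (Fin p)) then
          ENNReal.ofReal (1 / (4 * A)) ^ t.numLeaves else 0) ^ T := by
        rw [ENNReal.tsum_mul_left, tsum_fin_prod fun t : ZTree Z => if t.ChoppedIn (U : Set (Fin p))
          then ENNReal.ofReal (1 / (4 * A)) ^ t.numLeaves else 0]
    _ ≤ ENNReal.ofReal ((4 * A) ^ K) * 1 := by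
        gcongr
        exact pow_le_one₀ zero_le (ZTree.tsum_choppedIn_le U hA hU)
    _ = _ := mul_one _

open Classical in
/-- The `θ`-powers of the prior probabilities of moderately large ensembles. -/
lemma tsum_ensembleProb_rpow_le [NeZero p] (hν0 : 0 < ν) (hν1 : ν ≤ 1 / 2) {a : ℝ} (ha : 0 < a)
    (hae : a = ζ / (p : ℝ) ^ ξ) {A K : ℕ} (hA : ∀ j, (coordSet Z j).card ≤ A) (hA0 : 0 < A)
    (hK : 0 < K) {θ : ℝ} (hθ : 0 < θ) (hθ1 : θ ≤ 1) :
    ∑' E : Fin T → ZTree Z, (if totalLeaves E ≤ K then ensembleProb Z ν ζ ξ E ^ θ else 0) ≤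
      ENNReal.ofReal ((1 + a) ^ K * (1 + 1 / (p * a)) * (4 * (K * A)) ^ K * (1 + a ^ θ) ^ p) := by
  have hp : (0 : ℝ) < p := by exact_mod_cast Nat.pos_of_ne_zero (NeZero.ne p)
  have hpa : 0 < 1 / (p * a) := by positivity
  set D : ℝ := (1 + a) ^ K * (1 + 1 / (p * a)) with hD
  have hD1 : 1 ≤ D := by
    have h4 : 1 ≤ (1 + a) ^ K := one_le_pow₀ (by linarith)
    nlinarith
  calc _ ≤ ∑' E : Fin T → ZTree Z, ∑ U : Finset (Fin p), ENNReal.ofReal (D * (a ^ θ) ^ U.card) *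
        (if U.card ≤ K then (if (∀ t, (E t).ChoppedIn (U : Set (Fin p))) ∧ totalLeaves E ≤ K
          then (1 : ℝ≥0∞) else 0) else 0) := by
        refine ENNReal.tsum_le_tsum fun E => ?_
        by_cases h : totalLeaves E ≤ K
        swap
        · rw [if_neg h]; exact zero_le
        rw [if_pos h]
        refine le_trans ?_ (Finset.single_le_sum (f := fun U : Finset (Fin p) =>
          ENNReal.ofReal (D * (a ^ θ) ^ U.card) *
          (if U.card ≤ K then (if (∀ t, (E t).ChoppedIn (U : Set (Fin p))) ∧ totalLeaves E ≤ K
          then (1 : ℝ≥0∞) else 0) else 0)) (fun _ _ => zero_le) (Finset.mem_univ (usedCoords E)))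
        rw [if_pos ((card_usedCoords_le E).trans h), if_pos ⟨choppedIn_usedCoords E, h⟩, mul_one]
        refine (ENNReal.rpow_le_rpow (ensembleProb_le hν0 hν1 ha hae E) hθ.le).trans ?_
        rw [ENNReal.ofReal_rpow_of_nonneg (by positivity) hθ.le]
        apply ENNReal.ofReal_le_ofReal
        have e : (a ^ (usedCoords E).card) ^ θ = (a ^ θ) ^ (usedCoords E).card := by
          rw [← Real.rpow_natCast, ← Real.rpow_mul ha.le, mul_comm, Real.rpow_mul ha.le,
            Real.rpow_natCast]
        rw [mul_assoc, Real.mul_rpow (by positivity) (by positivity), e, mul_comm]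
        gcongr
        have h1 : 1 ≤ (1 + a) ^ totalLeaves E * (1 + 1 / (p * a)) := by
          have h4 : 1 ≤ (1 + a) ^ totalLeaves E := one_le_pow₀ (by linarith)
          nlinarith
        refine (Real.rpow_le_self_of_one_le h1 hθ1).trans ?_
        rw [hD]
        gcongr
        linarith
    _ = ∑ U : Finset (Fin p), ENNReal.ofReal (D * (a ^ θ) ^ U.card) *
        ∑' E : Fin T → ZTree Z, (if U.card ≤ K then
          (if (∀ t, (E t).ChoppedIn (U : Set (Fin p))) ∧ totalLeaves E ≤ K
          then (1 : ℝ≥0∞) else 0) else 0) := by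
        rw [Summable.tsum_finsetSum fun _ _ => ENNReal.summable]
        simp_rw [ENNReal.tsum_mul_left]
    _ ≤ ∑ U : Finset (Fin p), ENNReal.ofReal (D * (a ^ θ) ^ U.card) *
          ENNReal.ofReal ((4 * (K * A)) ^ K) := by
        refine Finset.sum_le_sum fun U _ => mul_le_mul_right ?_ _
        by_cases hU : U.card ≤ K
        · simp only [if_pos hU]
          have := tsum_choppedIn_totalLeaves_le (Z := Z) (T := T) U (A := K * A) (by positivity)
            ((Finset.sum_le_card_nsmul U _ A fun j _ => hA j).trans
              (by rw [smul_eq_mul]; gcongr)) K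
          push_cast at this
          exact this
        · simp [if_neg hU]
    _ = _ := by
        simp_rw [← ENNReal.ofReal_mul (show 0 ≤ D * (a ^ θ) ^ _ by positivity)]
        rw [← ENNReal.ofReal_sum_of_nonneg fun _ _ => by positivity]
        congr 1
        rw [← Finset.sum_mul, ← Finset.mul_sum]
        have : ∑ U : Finset (Fin p), (a ^ θ) ^ U.card = (1 + a ^ θ) ^ p := by
          have := Fintype.sum_pow_mul_eq_add_pow (Fin p) (a ^ θ) 1
          simp only [one_pow, mul_one, Fintype.card_fin] at this
          rw [this, add_comm]
        rw [this]; ring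

end Forest

end

noncomputable section

namespace Forest

/-! ### Step functions and forests -/

variable {p b : ℕ} {Z : Fin b → Fin p → ℝ} {T : ℕ}

lemma measurable_leafIdx (t : ZTree Z) : Measurable t.leafIdx := by
  induction t with
  | leaf => exact measurable_const
  | node j τ l r hl hr =>
    simp only [ZTree.leafIdx]
    exact Measurable.ite (measurableSet_le (measurable_pi_apply j) measurable_const)
      ((measurable_of_countable (Fin.castAdd r.numLeaves)).comp hl)
      ((measurable_of_countable (Fin.natAdd l.numLeaves)).comp hr)

lemma measurable_stepFun_comp {α : Type*} [MeasurableSpace α] (t : ZTree Z)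
    {β : α → Fin t.numLeaves → ℝ} {x : α → Fin p → ℝ} (hβ : Measurable β) (hx : Measurable x) :
    Measurable fun a => t.stepFun (β a) (x a) := by
  have : (fun a => t.stepFun (β a) (x a)) =
      fun a => ∑ k, if t.leafIdx (x a) = k then β a k else 0 := by
    ext a; simp [ZTree.stepFun]
  rw [this]
  refine Finset.measurable_sum _ fun k _ => Measurable.ite ?_ ((measurable_pi_apply k).comp hβ)
    measurable_const
  exact ((measurable_leafIdx t).comp hx) (measurableSet_singleton k)

lemma measurable_forest_comp {α : Type*} [MeasurableSpace α] (E : Fin T → ZTree Z)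
    {B : α → Heights fun t => (E t).numLeaves} {x : α → Fin p → ℝ} (hB : Measurable B)
    (hx : Measurable x) : Measurable fun a => forest E (B a) (x a) :=
  Finset.measurable_sum _ fun t _ =>
    measurable_stepFun_comp (E t) ((measurable_pi_apply t).comp hB) hx

lemma measurable_forest (E : Fin T → ZTree Z) (B : Heights fun t => (E t).numLeaves) :
    Measurable (forest E B) :=
  measurable_forest_comp E measurable_const measurable_id

lemma abs_forest_sub_le (E : Fin T → ZTree Z) {B B' : Heights fun t => (E t).numLeaves} {δ : ℝ}
    (h : ∀ t k, |B t k - B' t k| ≤ δ) (x : Fin p → ℝ) :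
    |forest E B x - forest E B' x| ≤ T * δ := by
  simp only [forest, ← Finset.sum_sub_distrib]
  refine (Finset.abs_sum_le_sum_abs _ _).trans ?_
  refine (Finset.sum_le_sum fun t _ => h t ((E t).leafIdx x)).trans ?_
  simp

lemma abs_forest_le (E : Fin T → ZTree Z) {B : Heights fun t => (E t).numLeaves} {C : ℝ}
    (h : ∀ t k, |B t k| ≤ C) (x : Fin p → ℝ) : |forest E B x| ≤ T * C := by
  have := abs_forest_sub_le E (B := B) (B' := fun _ _ => 0) (δ := C) (by simpa using h) x
  simpa [forest, ZTree.stepFun] using this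

variable {n : ℕ} {f0 : (Fin p → ℝ) → ℝ} {s0 : ℝ}

lemma measurable_likRatio_forest (E : Fin T → ZTree Z) (hf0 : Measurable f0) :
    Measurable fun z : (Fin n → (Fin p → ℝ) × ℝ) × ℝ × Heights (fun t => (E t).numLeaves) =>
      likRatio z.1 (forest E z.2.2) f0 z.2.1 s0 := by
  simp only [likRatio, obsRatio]
  refine Finset.measurable_prod _ fun i _ => ?_
  have hx : Measurable fun z : (Fin n → (Fin p → ℝ) × ℝ) × ℝ ×
      Heights (fun t => (E t).numLeaves) => z.1 i := (measurable_pi_apply i).comp measurable_fst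
  refine (measurable_gaussianPDF_comp ?_ (measurable_fst.comp measurable_snd)
    (measurable_snd.comp hx)).div
    (measurable_gaussianPDF_comp (hf0.comp (measurable_fst.comp hx)) measurable_const
      (measurable_snd.comp hx))
  exact measurable_forest_comp E (measurable_snd.comp measurable_snd) (measurable_fst.comp hx)

lemma measurable_likRatio_forest_right (D : Fin n → (Fin p → ℝ) × ℝ) (E : Fin T → ZTree Z)
    (hf0 : Measurable f0) :
    Measurable fun z : ℝ × Heights (fun t => (E t).numLeaves) =>
      likRatio D (forest E z.2) f0 z.1 s0 := by
  have h := (measurable_likRatio_forest (n := n) (s0 := s0) E hf0).comp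
    (measurable_prodMk_left (x := D))
  simp only [Function.comp_def] at h
  exact h

/-! ### Lower bounds for the evidence -/

lemma two_mul_le_add_sq_mul_inv {x t : ℝ≥0∞} (hx0 : x ≠ 0) (hx : x ≠ ⊤) (ht : t ≠ ⊤) :
    2 * t ≤ x + t ^ 2 * x⁻¹ := by
  lift x to ℝ≥0 using hx
  lift t to ℝ≥0 using ht
  have hx' : 0 < x := pos_iff_ne_zero.2 (by simpa using hx0)
  rw [← ENNReal.coe_inv hx'.ne']
  norm_cast
  rw [← NNReal.coe_le_coe]
  push_cast
  have hx'' : (0 : ℝ) < x := hx'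
  have h : (x : ℝ) + t ^ 2 * (x : ℝ)⁻¹ - 2 * t = (x - t) ^ 2 / x := by field_simp; ring
  have : 0 ≤ ((x : ℝ) - t) ^ 2 / x := by positivity
  linarith

/-- A mixture of likelihood ratios with small inverse moments is bounded below with large
probability. -/
lemma exists_event_mixture_ge {Ω Θ : Type*} [MeasurableSpace Ω] [MeasurableSpace Θ]
    (P : Measure Ω) [IsProbabilityMeasure P] (π : Measure Θ) [IsFiniteMeasure π]
    {R : Ω × Θ → ℝ≥0∞} (hR : Measurable R) (hR0 : ∀ᵐ θ ∂π, ∀ D, R (D, θ) ≠ 0 ∧ R (D, θ) ≠ ⊤)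
    {X t m : ℝ≥0∞} (hX : ∀ᵐ θ ∂π, ∫⁻ D, (R (D, θ))⁻¹ ∂P ≤ X) (ht0 : t ≠ 0) (ht : t ≠ ⊤)
    (hm0 : m ≠ 0) (hm : π Set.univ = m) :
    ∃ G : Set Ω, MeasurableSet G ∧ P G ≤ X * t ∧ ∀ D ∉ G, t * m ≤ ∫⁻ θ, R (D, θ) ∂π := by
  have hmt : m ≠ ⊤ := hm ▸ measure_ne_top π _
  set V : Ω → ℝ≥0∞ := fun D => ∫⁻ θ, (R (D, θ))⁻¹ ∂π with hV
  have hVm : Measurable V := (hR.inv).lintegral_prod_right'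
  have hVint : ∫⁻ D, V D ∂P ≤ X * m := by
    rw [hV, lintegral_lintegral_swap (hR.inv).aemeasurable]
    calc _ ≤ ∫⁻ _, X ∂π := lintegral_mono_ae hX
      _ = X * m := by rw [lintegral_const, hm]
  refine ⟨{D | m / t ≤ V D}, measurableSet_le measurable_const hVm, ?_, ?_⟩
  · refine (meas_ge_le_lintegral_div hVm.aemeasurable (ENNReal.div_pos hm0 ht).ne'
      (ENNReal.div_ne_top hmt ht0)).trans ?_
    refine ENNReal.div_le_of_le_mul (hVint.trans (le_of_eq ?_))
    rw [mul_assoc, ENNReal.mul_div_cancel ht0 ht]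
  · intro D hD
    have hD' : V D ≤ m / t := by
      simp only [Set.mem_ofPred_eq, not_le] at hD
      exact hD.le
    have h1 : 2 * t * m ≤ ∫⁻ θ, R (D, θ) ∂π + t ^ 2 * V D := by
      have hm1 : Measurable fun θ => R (D, θ) := hR.comp measurable_prodMk_left
      have hm2 : Measurable fun θ => (R (D, θ))⁻¹ := hm1.inv
      rw [show V D = ∫⁻ θ, (R (D, θ))⁻¹ ∂π from rfl, ← lintegral_const_mul _ hm2, ← lintegral_add_left hm1, ← hm, ← lintegral_const]
      exact lintegral_mono_ae (hR0.mono fun θ hθ => two_mul_le_add_sq_mul_inv (hθ D).1 (hθ D).2 ht)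
    have h2 : t ^ 2 * V D ≤ t * m := by
      calc t ^ 2 * V D ≤ t ^ 2 * (m / t) := by gcongr
        _ = t * (t * (m / t)) := by ring
        _ = t * m := by rw [ENNReal.mul_div_cancel ht0 ht]
    have h3 : t * m + t * m ≤ ∫⁻ θ, R (D, θ) ∂π + t * m := by
      calc t * m + t * m = 2 * t * m := by ring
        _ ≤ _ := h1
        _ ≤ _ := by gcongr
    exact (ENNReal.add_le_add_iff_right (ENNReal.mul_ne_top ht hmt)).1 h3

lemma le_heightPrior {C c : ℝ} (hc : 0 < c) {μB : (K : Fin T → ℕ) → Measure (Heights K)}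
    (hμ : IsTruncatedHeightPrior C c μB) (K : Fin T → ℕ) (β : Heights K) {δ : ℝ} (hδ : 0 < δ)
    (hβ : ∀ t k, |β t k| + δ ≤ C) :
    ENNReal.ofReal ((c * (2 * δ)) ^ ∑ t, K t) ≤ μB K {B | ∀ t k, B t k ∈ Set.Icc (β t k - δ) (β t k + δ)} := by
  obtain ⟨-, g, hg, hgc, hμK⟩ := hμ K
  have hN : {B : Heights K | ∀ t k, B t k ∈ Set.Icc (β t k - δ) (β t k + δ)} =
      Set.univ.pi fun t => Set.univ.pi fun k => Set.Icc (β t k - δ) (β t k + δ) := by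
    ext B; exact ⟨fun h t _ k _ => h t k, fun h t k => h t trivial k trivial⟩
  have hmeas : MeasurableSet {B : Heights K | ∀ t k, B t k ∈ Set.Icc (β t k - δ) (β t k + δ)} := by
    rw [hN]
    exact MeasurableSet.univ_pi fun t => MeasurableSet.univ_pi fun k => measurableSet_Icc
  have hsub : {B : Heights K | ∀ t k, B t k ∈ Set.Icc (β t k - δ) (β t k + δ)} ⊆ heightCube K C := by
    intro B hB t k
    have h1 := hβ t k
    have h2 := hB t k
    have h3 := abs_le.1 (le_refl |β t k|)
    exact ⟨by linarith [h2.1], by linarith [h2.2]⟩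
  have hvol : (volume : Measure (Heights K)) {B | ∀ t k, B t k ∈ Set.Icc (β t k - δ) (β t k + δ)} =
      ENNReal.ofReal ((2 * δ) ^ ∑ t, K t) := by
    rw [hN, volume_pi_pi]
    simp_rw [volume_pi_pi, Real.volume_Icc]
    have e : ∀ t k, β t k + δ - (β t k - δ) = 2 * δ := fun t k => by ring
    simp only [e, Finset.prod_const, Finset.card_univ, Fintype.card_fin]
    rw [Finset.prod_pow_eq_pow_sum, ENNReal.ofReal_pow (by positivity)]
  rw [hμK, withDensity_apply _ hmeas, Measure.restrict_restrict hmeas,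
    Set.inter_eq_self_of_subset_left hsub]
  calc _ = ∫⁻ _ in {B : Heights K | ∀ t k, B t k ∈ Set.Icc (β t k - δ) (β t k + δ)},
        ENNReal.ofReal (c ^ ∑ t, K t) := by
        rw [setLIntegral_const, hvol, ← ENNReal.ofReal_mul (by positivity), mul_pow]
    _ ≤ _ := setLIntegral_mono hg fun B hB => hgc B (hsub hB)

lemma le_variancePrior {C c : ℝ} {μσ : Measure ℝ} (hc : 0 < c)
    (hμ : IsTruncatedVariancePrior C c μσ) {s h : ℝ} (h1 : C⁻¹ ≤ s) (h2 : s + h ≤ C) :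
    ENNReal.ofReal (c * h) ≤ μσ (Set.Icc s (s + h)) := by
  obtain ⟨-, g, hg, hgc, hμK⟩ := hμ
  have hsub : Set.Icc s (s + h) ⊆ Set.Icc C⁻¹ C := Set.Icc_subset_Icc h1 h2
  rw [hμK, withDensity_apply _ measurableSet_Icc, Measure.restrict_restrict measurableSet_Icc,
    Set.inter_eq_self_of_subset_left hsub]
  calc _ = ∫⁻ _ in Set.Icc s (s + h), ENNReal.ofReal c := by
        rw [setLIntegral_const, Real.volume_Icc, ← ENNReal.ofReal_mul hc.le]
        congr 2; ring
    _ ≤ _ := setLIntegral_mono hg fun B hB => hgc B (hsub hB)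

variable {ν ζ ξ : ℝ} {μB : (K : Fin T → ℕ) → Measure (Heights K)} {μσ : Measure ℝ}

lemma evidence_univ_ge (D : Fin n → (Fin p → ℝ) × ℝ) (E : Fin T → ZTree Z) (hf0 : Measurable f0)
    (hs0 : 0 < s0) [IsProbabilityMeasure μσ] [∀ K, IsProbabilityMeasure (μB K)]
    (I : Set ℝ) (N : Set (Heights fun t => (E t).numLeaves)) :
    ensembleProb Z ν ζ ξ E * (∫⁻ z, likRatio D (forest E z.2) f0 z.1 s0
        ∂((μσ.restrict I).prod ((μB fun t => (E t).numLeaves).restrict N))) * likelihood D f0 s0 ≤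
      evidence Z ν ζ ξ μB μσ D Set.univ := by
  have hm : Measurable fun z : ℝ × Heights (fun t => (E t).numLeaves) =>
      likRatio D (forest E z.2) f0 z.1 s0 := measurable_likRatio_forest_right D E hf0
  refine le_trans ?_ (ENNReal.le_tsum E)
  rw [lintegral_prod _ hm.aemeasurable, mul_assoc]
  gcongr
  simp only [Set.indicator_univ]
  rw [← lintegral_mul_const' _ _ (likelihood_ne_top D)]
  simp_rw [← lintegral_mul_const' _ _ (likelihood_ne_top (f := f0) (s := s0) D),
    ← likelihood_eq_likRatio_mul hs0 D]
  exact (lintegral_mono fun s => lintegral_mono' Measure.restrict_le_self le_rfl).trans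
    (lintegral_mono' Measure.restrict_le_self le_rfl)

/-- With large probability, the evidence is bounded below by the prior probability of a
neighbourhood of the true parameters. -/
lemma exists_event_evidence_ge {Q : Measure (Fin p → ℝ)} [IsProbabilityMeasure Q]
    (hf0 : Measurable f0) [IsProbabilityMeasure μσ] [∀ K, IsProbabilityMeasure (μB K)]
    (E : Fin T → ZTree Z) {C₁ C₂ c : ℝ} (hc : 0 < c) (hμB : IsTruncatedHeightPrior C₁ c μB)
    (hμσ : IsTruncatedVariancePrior C₂ c μσ) (hC₂ : 0 < C₂)
    (β : Heights fun t => (E t).numLeaves) {δ h U a : ℝ} (hδ : 0 < δ) (hh : 0 < h)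
    (hβ : ∀ t k, |β t k| + δ ≤ C₁) (h1 : C₂⁻¹ ≤ s0) (h2 : s0 + h ≤ C₂)
    (hU : ∀ B : Heights fun t => (E t).numLeaves, (∀ t k, |B t k - β t k| ≤ δ) →
      ∀ᵐ x ∂Q, |forest E B x - f0 x| ≤ U)
    (ha : ∀ B : Heights fun t => (E t).numLeaves, (∀ t k, |B t k - β t k| ≤ δ) →
      ∫ x, (forest E B x - f0 x) ^ 2 ∂Q ≤ a)
    {t : ℝ} (ht : 0 < t) :
    ∃ G : Set (Fin n → (Fin p → ℝ) × ℝ), MeasurableSet G ∧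
      (Measure.pi fun _ : Fin n => obsLaw Q f0 s0) G ≤
        ENNReal.ofReal (Real.exp (n * (Real.exp (C₂ * U ^ 2) * C₂ * a + C₂ ^ 2 * h ^ 2)) * t) ∧
      ∀ D ∉ G, ensembleProb Z ν ζ ξ E *
        ENNReal.ofReal (t * (c * h * (c * (2 * δ)) ^ totalLeaves E)) * likelihood D f0 s0 ≤
        evidence Z ν ζ ξ μB μσ D Set.univ := by
  have := Fact.mk hf0
  have hs0 : 0 < s0 := (inv_pos.2 hC₂).trans_le h1
  set N : Set (Heights fun t => (E t).numLeaves) :=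
    {B | ∀ t k, B t k ∈ Set.Icc (β t k - δ) (β t k + δ)} with hN
  have hNmeas : MeasurableSet N := by
    have : N = Set.univ.pi fun t => Set.univ.pi fun k => Set.Icc (β t k - δ) (β t k + δ) := by
      ext B; exact ⟨fun h t _ k _ => h t k, fun h t k => h t trivial k trivial⟩
    rw [this]
    exact MeasurableSet.univ_pi fun t => MeasurableSet.univ_pi fun k => measurableSet_Icc
  set I : Set ℝ := Set.Icc s0 (s0 + h) with hI
  set π := (μσ.restrict I).prod ((μB fun t => (E t).numLeaves).restrict N) with hπ
  have hmass : ENNReal.ofReal (c * h * (c * (2 * δ)) ^ totalLeaves E) ≤ π Set.univ := by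
    rw [hπ, ← Set.univ_prod_univ, Measure.prod_prod, Measure.restrict_apply_univ,
      Measure.restrict_apply_univ, ENNReal.ofReal_mul (by positivity)]
    exact mul_le_mul' (le_variancePrior hc hμσ h1 h2) (le_heightPrior hc hμB _ β hδ hβ)
  have hmem : ∀ᵐ θ ∂π, θ.1 ∈ I ∧ θ.2 ∈ N := by
    rw [hπ, Measure.prod_restrict]
    exact (ae_restrict_mem (measurableSet_Icc.prod hNmeas)).mono fun θ hθ => hθ
  have hN' : ∀ B ∈ N, ∀ t k, |B t k - β t k| ≤ δ := fun B hB t k => by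
    have := hB t k
    rw [abs_le]; constructor <;> linarith [this.1, this.2]
  obtain ⟨G, hG, hPG, hGc⟩ := exists_event_mixture_ge
    (Measure.pi fun _ : Fin n => obsLaw Q f0 s0) π
    (R := fun z => likRatio z.1 (forest E z.2.2) f0 z.2.1 s0)
    (X := ENNReal.ofReal (Real.exp (n * (Real.exp (C₂ * U ^ 2) * C₂ * a + C₂ ^ 2 * h ^ 2))))
    (t := ENNReal.ofReal t) (measurable_likRatio_forest E hf0)
    (hmem.mono fun θ hθ D => ⟨likRatio_ne_zero (hs0.trans_le hθ.1.1) D, likRatio_ne_top hs0 D⟩)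
    (hmem.mono fun θ hθ => by
      refine (lintegral_inv_likRatio_le (measurable_forest E _) hf0 hC₂ h1 hθ.1.1
        (hU θ.2 (hN' _ hθ.2))).trans (ENNReal.ofReal_le_ofReal (Real.exp_le_exp.2 ?_))
      have h3 := ha θ.2 (hN' _ hθ.2)
      have h4 : 0 ≤ θ.1 - s0 := sub_nonneg.2 hθ.1.1
      have h5 : θ.1 - s0 ≤ h := by linarith [hθ.1.2]
      gcongr)
    (by simpa using ht) ENNReal.ofReal_ne_top
    (lt_of_lt_of_le (by rw [ENNReal.ofReal_pos]; positivity) hmass).ne' rfl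
  refine ⟨G, hG, hPG.trans_eq (ENNReal.ofReal_mul (Real.exp_pos _).le).symm, fun D hD => ?_⟩
  refine le_trans ?_ (evidence_univ_ge D E hf0 hs0 I N)
  gcongr
  rw [ENNReal.ofReal_mul ht.le]
  exact (mul_le_mul_right hmass _).trans (hGc D hD)

/-! ### Upper bounds for the posterior -/

lemma min_one_tsum_le {ι : Type*} (x : ι → ℝ≥0∞) : min 1 (∑' i, x i) ≤ ∑' i, min 1 (x i) := by
  by_cases h : ∃ i, 1 ≤ x i
  · obtain ⟨i, hi⟩ := h
    refine (min_le_left _ _).trans (le_trans ?_ (ENNReal.le_tsum i))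
    rw [min_eq_left hi]
  · push Not at h
    refine (min_le_right _ _).trans (le_of_eq (tsum_congr fun i => ?_))
    rw [min_eq_right (h i).le]

lemma min_one_sum_le {ι : Type*} (s : Finset ι) (x : ι → ℝ≥0∞) :
    min 1 (∑ i ∈ s, x i) ≤ ∑ i ∈ s, min 1 (x i) := by
  have := min_one_tsum_le fun i : s => x i
  rwa [tsum_fintype, tsum_fintype, Finset.sum_coe_sort s x,
    Finset.sum_coe_sort s fun i => min 1 (x i)] at this

/-- The contribution of an ensemble to the evidence. -/
def ensembleEvidence (μB : (K : Fin T → ℕ) → Measure (Heights K)) (μσ : Measure ℝ)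
    (D : Fin n → (Fin p → ℝ) × ℝ) (A : Set (((Fin p → ℝ) → ℝ) × ℝ)) (E : Fin T → ZTree Z) : ℝ≥0∞ :=
  ∫⁻ s, ∫⁻ B, A.indicator (fun θ => likelihood D θ.1 θ.2) (forest E B, s)
      ∂(μB fun t => (E t).numLeaves) ∂μσ

lemma evidence_mono (D : Fin n → (Fin p → ℝ) × ℝ) (A : Set (((Fin p → ℝ) → ℝ) × ℝ)) :
    evidence Z ν ζ ξ μB μσ D A ≤ evidence Z ν ζ ξ μB μσ D Set.univ := by
  refine ENNReal.tsum_le_tsum fun E => ?_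
  gcongr
  exact Set.subset_univ A

lemma posterior_le_one (D : Fin n → (Fin p → ℝ) × ℝ) (A : Set (((Fin p → ℝ) → ℝ) × ℝ)) :
    posterior Z ν ζ ξ μB μσ D A ≤ 1 :=
  (ENNReal.div_le_div_right (evidence_mono D A) _).trans ENNReal.div_self_le_one

lemma posterior_le_tsum (D : Fin n → (Fin p → ℝ) × ℝ) (A : Set (((Fin p → ℝ) → ℝ) × ℝ))
    {y : ℝ≥0∞} (hy : y ≤ evidence Z ν ζ ξ μB μσ D Set.univ) :
    posterior Z ν ζ ξ μB μσ D A ≤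
      ∑' E : Fin T → ZTree Z, min 1 (ensembleProb Z ν ζ ξ E * ensembleEvidence μB μσ D A E / y) := by
  refine le_trans (le_min (posterior_le_one D A) ?_) (min_one_tsum_le _)
  refine (ENNReal.div_le_div_left hy _).trans (le_of_eq ?_)
  simp only [evidence, div_eq_mul_inv, ensembleEvidence, ENNReal.tsum_mul_right]

lemma lintegral_posterior_le (P : Measure (Fin n → (Fin p → ℝ) × ℝ))
    (A : Set (((Fin p → ℝ) → ℝ) × ℝ)) {G : Set (Fin n → (Fin p → ℝ) × ℝ)} (hG : MeasurableSet G)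
    (y : (Fin n → (Fin p → ℝ) × ℝ) → ℝ≥0∞)
    (hy : ∀ D ∉ G, y D ≤ evidence Z ν ζ ξ μB μσ D Set.univ)
    (F : (Fin T → ZTree Z) → (Fin n → (Fin p → ℝ) × ℝ) → ℝ≥0∞) (hF : ∀ E, Measurable (F E))
    (hle : ∀ E D, min 1 (ensembleProb Z ν ζ ξ E * ensembleEvidence μB μσ D A E / y D) ≤ F E D) :
    ∫⁻ D, posterior Z ν ζ ξ μB μσ D A ∂P ≤ P G + ∑' E, ∫⁻ D, F E D ∂P := by
  rw [← lintegral_tsum fun E => (hF E).aemeasurable, ← lintegral_indicator_one hG,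
    ← lintegral_add_left (measurable_one.indicator hG)]
  refine lintegral_mono fun D => ?_
  by_cases hD : D ∈ G
  · simpa [hD] using (posterior_le_one D A).trans le_self_add
  · simpa [hD] using (posterior_le_tsum D A (hy D hD)).trans (ENNReal.tsum_le_tsum fun E => hle E D)

lemma lintegral_min_one_mul_le {Ω : Type*} [MeasurableSpace Ω] {P : Measure Ω} {R : Ω → ℝ≥0∞}
    (hR : Measurable R) (h1 : ∫⁻ D, R D ∂P ≤ 1) {ρ : ℝ≥0∞}
    (h2 : ∫⁻ D, R D ^ (1 / 2 : ℝ) ∂P ≤ ρ) (u : ℝ≥0∞) {θ : ℝ} (hθ : 1 / 2 ≤ θ) (hθ1 : θ ≤ 1) :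
    ∫⁻ D, min 1 (u * R D) ∂P ≤ u ^ θ * ρ ^ (2 * (1 - θ)) := by
  have b1 : ∫⁻ D, min 1 (u * R D) ∂P ≤ u := by
    calc _ ≤ ∫⁻ D, u * R D ∂P := lintegral_mono fun D => min_le_right _ _
      _ = u * ∫⁻ D, R D ∂P := lintegral_const_mul _ hR
      _ ≤ u * 1 := by gcongr
      _ = u := mul_one u
  have b2 : ∫⁻ D, min 1 (u * R D) ∂P ≤ u ^ (1 / 2 : ℝ) * ρ := by
    calc _ ≤ ∫⁻ D, u ^ (1 / 2 : ℝ) * R D ^ (1 / 2 : ℝ) ∂P := by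
          refine lintegral_mono fun D => ?_
          rw [← ENNReal.mul_rpow_of_nonneg _ _ (by norm_num)]
          rcases le_total 1 (u * R D) with h | h
          · rw [min_eq_left h]; exact ENNReal.one_le_rpow h (by norm_num)
          · rw [min_eq_right h]
            calc u * R D = (u * R D) ^ (1 : ℝ) := (ENNReal.rpow_one _).symm
              _ ≤ _ := ENNReal.rpow_le_rpow_of_exponent_ge h (by norm_num)
      _ = u ^ (1 / 2 : ℝ) * ∫⁻ D, R D ^ (1 / 2 : ℝ) ∂P := lintegral_const_mul _ (hR.pow_const _)
      _ ≤ _ := by gcongr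
  set x := ∫⁻ D, min 1 (u * R D) ∂P
  calc x = x ^ (2 * θ - 1) * x ^ (2 * (1 - θ)) := by
        rw [← ENNReal.rpow_add_of_nonneg _ _ (by linarith) (by linarith)]
        rw [show 2 * θ - 1 + 2 * (1 - θ) = 1 by ring, ENNReal.rpow_one]
    _ ≤ u ^ (2 * θ - 1) * (u ^ (1 / 2 : ℝ) * ρ) ^ (2 * (1 - θ)) := by
        gcongr
        linarith
    _ = u ^ (2 * θ - 1) * u ^ (1 - θ) * ρ ^ (2 * (1 - θ)) := by
        rw [ENNReal.mul_rpow_of_nonneg _ _ (by linarith), ← ENNReal.rpow_mul, mul_assoc]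
        ring_nf
    _ = _ := by
        rw [← ENNReal.rpow_add_of_nonneg _ _ (by linarith) (by linarith)]
        ring_nf

lemma lintegral_lintegral_swap_prod {Ω Θ : Type*} [MeasurableSpace Ω] [MeasurableSpace Θ]
    {P : Measure Ω} [SFinite P] {π : Measure Θ} [SFinite π] {R : Ω × Θ → ℝ≥0∞} (hR : Measurable R) :
    ∫⁻ D, ∫⁻ θ, R (D, θ) ∂π ∂P = ∫⁻ θ, ∫⁻ D, R (D, θ) ∂P ∂π :=
  lintegral_lintegral_swap hR.aemeasurable

lemma lintegral_ensembleEvidence_le {Q : Measure (Fin p → ℝ)} [IsProbabilityMeasure Q]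
    (hf0 : Measurable f0) (hs0 : 0 < s0) [IsProbabilityMeasure μσ]
    [∀ K, IsProbabilityMeasure (μB K)] (hpos : ∀ᵐ s ∂μσ, 0 < s) (E : Fin T → ZTree Z)
    (A : Set (((Fin p → ℝ) → ℝ) × ℝ)) :
    ∃ F : (Fin n → (Fin p → ℝ) × ℝ) → ℝ≥0∞, Measurable F ∧
      (∀ D, ensembleEvidence μB μσ D A E ≤ F D * likelihood D f0 s0) ∧
      ∫⁻ D, F D ∂(Measure.pi fun _ : Fin n => obsLaw Q f0 s0) ≤ 1 := by
  have := Fact.mk hf0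
  have hm := measurable_likRatio_forest (n := n) (s0 := s0) E hf0
  set π := μσ.prod (μB fun t => (E t).numLeaves) with hπ
  refine ⟨fun D => ∫⁻ z, likRatio D (forest E z.2) f0 z.1 s0 ∂π, hm.lintegral_prod_right', ?_, ?_⟩
  · intro D
    rw [← lintegral_mul_const' _ _ (likelihood_ne_top D)]
    simp_rw [← likelihood_eq_likRatio_mul hs0 D]
    have hm2 : Measurable fun z : ℝ × Heights (fun t => (E t).numLeaves) =>
        likelihood D (forest E z.2) z.1 := by
      have e : (fun z : ℝ × Heights (fun t => (E t).numLeaves) =>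
          likelihood D (forest E z.2) z.1) =
          fun z => likRatio D (forest E z.2) f0 z.1 s0 * likelihood D f0 s0 := by
        ext z; exact likelihood_eq_likRatio_mul hs0 D
      rw [e]
      exact (measurable_likRatio_forest_right (s0 := s0) D E hf0).mul_const (likelihood D f0 s0)
    rw [hπ, lintegral_prod _ hm2.aemeasurable]
    refine lintegral_mono fun s => lintegral_mono fun B => ?_
    exact Set.indicator_le_self' (fun _ _ => zero_le) _
  · refine (lintegral_lintegral_swap_prod (R := fun z : (Fin n → (Fin p → ℝ) × ℝ) × ℝ ×
      Heights (fun t => (E t).numLeaves) => likRatio z.1 (forest E z.2.2) f0 z.2.1 s0) hm).trans_le ?_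
    have hp' : ∀ᵐ z ∂π, 0 < z.1 := (measurePreserving_fst (μ := μσ)).quasiMeasurePreserving.ae hpos
    calc _ ≤ ∫⁻ _, 1 ∂π := by
          apply lintegral_mono_ae
          filter_upwards [hp'] with z hz
          exact (lintegral_likRatio (measurable_forest E _) hf0 hz hs0).le
      _ = 1 := by simp

end Forest

end

noncomputable section

namespace Forest

/-! ### Discretisation of the step-heights and of the variance -/

variable {p b : ℕ} {Z : Fin b → Fin p → ℝ} {T n : ℕ} {f f0 : (Fin p → ℝ) → ℝ} {s0 : ℝ}
  {Q : Measure (Fin p → ℝ)}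

lemma eLpNorm_two_eq {h : (Fin p → ℝ) → ℝ} (hh : MemLp h 2 Q) :
    eLpNorm h 2 Q = ENNReal.ofReal √(∫ x, h x ^ 2 ∂Q) := by
  rw [hh.eLpNorm_eq_integral_rpow_norm two_ne_zero ENNReal.ofNat_ne_top, Real.sqrt_eq_rpow]
  simp

lemma memLp_sub_of_bounded [IsFiniteMeasure Q] (hf : Measurable f) (hf0 : Measurable f0) {U : ℝ}
    (hU : ∀ᵐ x ∂Q, |f x - f0 x| ≤ U) : MemLp (fun x => f x - f0 x) 2 Q :=
  MemLp.of_bound (hf.sub hf0).aestronglyMeasurable U hU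

lemma ae_mem_cube {C : ℝ} (hQ : HasBoundedDensity C Q) : ∀ᵐ x ∂Q, x ∈ cube p := by
  obtain ⟨q, -, -, rfl⟩ := hQ
  exact (withDensity_absolutelyContinuous _ _).ae_le (ae_restrict_mem measurableSet_Icc)

lemma ae_mem_heightCube {C c : ℝ} {μB : (K : Fin T → ℕ) → Measure (Heights K)}
    (hμ : IsTruncatedHeightPrior C c μB) (K : Fin T → ℕ) : ∀ᵐ B ∂(μB K), B ∈ heightCube K C := by
  obtain ⟨-, g, -, -, hg⟩ := hμ K
  rw [hg]
  refine (withDensity_absolutelyContinuous _ _).ae_le (ae_restrict_mem ?_)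
  have : heightCube K C = Set.univ.pi fun t => Set.univ.pi fun k => Set.Icc (-C) C := by
    ext B; exact ⟨fun h t _ k _ => h t k, fun h t k => h t trivial k trivial⟩
  rw [this]
  exact MeasurableSet.univ_pi fun t => MeasurableSet.univ_pi fun k => measurableSet_Icc

lemma ae_mem_Icc_variancePrior {C c : ℝ} {μσ : Measure ℝ} (hμ : IsTruncatedVariancePrior C c μσ) :
    ∀ᵐ s ∂μσ, s ∈ Set.Icc C⁻¹ C := by
  obtain ⟨-, g, -, -, hg⟩ := hμ
  rw [hg]
  exact (withDensity_absolutelyContinuous _ _).ae_le (ae_restrict_mem measurableSet_Icc)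

lemma exists_grid_near {x C δ : ℝ} (hδ : 0 < δ) (hx : |x| ≤ C) :
    ∃ i : Fin (2 * ⌈C / δ⌉₊ + 1), |x - δ * ((i : ℕ) - (⌈C / δ⌉₊ : ℝ))| ≤ δ := by
  set J := ⌈C / δ⌉₊
  have hJ : C / δ ≤ J := Nat.le_ceil _
  have h1 := abs_le.1 hx
  have h2 : -(J : ℝ) ≤ x / δ := by
    rw [le_div_iff₀ hδ]; rw [div_le_iff₀ hδ] at hJ; linarith
  have h3 : x / δ ≤ J := (div_le_div_of_nonneg_right h1.2 hδ.le).trans hJ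
  have h0 : 0 ≤ x / δ + J := by linarith
  have h4 := Nat.floor_le h0
  have h5 := Nat.lt_floor_add_one (x / δ + J)
  refine ⟨⟨⌊x / δ + J⌋₊, ?_⟩, ?_⟩
  · rw [Nat.lt_succ_iff]
    apply Nat.floor_le_of_le
    push_cast; linarith
  · have e : x - δ * ((⌊x / δ + J⌋₊ : ℝ) - J) = δ * (x / δ + J - ⌊x / δ + J⌋₊) := by
      field_simp; ring
    simp only
    rw [e, abs_mul, abs_of_pos hδ]
    have : |x / δ + J - ⌊x / δ + J⌋₊| ≤ 1 := abs_le.2 ⟨by linarith, by linarith⟩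
    nlinarith

lemma exists_grid_above {x C δ : ℝ} (hδ : 0 < δ) (h0 : 0 ≤ x) (hx : x ≤ C) :
    ∃ i : Fin (⌈C / δ⌉₊ + 1), x ≤ δ * (i : ℕ) ∧ δ * (i : ℕ) ≤ x + δ := by
  refine ⟨⟨⌈x / δ⌉₊, Nat.lt_succ_of_le (Nat.ceil_mono (div_le_div_of_nonneg_right hx hδ.le))⟩, ?_, ?_⟩
  · have := Nat.le_ceil (x / δ)
    rw [div_le_iff₀ hδ] at this
    simp only; linarith
  · have := Nat.ceil_lt_add_one (div_nonneg h0 hδ.le)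
    have h2 : δ * (⌈x / δ⌉₊ : ℝ) ≤ δ * (x / δ + 1) := by gcongr
    have h3 : δ * (x / δ + 1) = x + δ := by field_simp
    simp only; linarith

/-- Indices of the grid on the parameters of an ensemble. -/
abbrev GridIndex (K : Fin T → ℕ) (J J' : ℕ) : Type :=
  ((t : Fin T) → Fin (K t) → Fin (2 * J + 1)) × Fin (J' + 1)

/-- The step-heights of a grid point. -/
def gridHeights {K : Fin T → ℕ} {J J' : ℕ} (δ : ℝ) (γ : GridIndex K J J') : Heights K :=
  fun t k => δ * ((γ.1 t k : ℕ) - (J : ℝ))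

/-- The variance of a grid point. -/
def gridVar {K : Fin T → ℕ} {J J' : ℕ} (δ : ℝ) (γ : GridIndex K J J') : ℝ := δ * (γ.2 : ℕ)

lemma card_gridIndex (K : Fin T → ℕ) (J J' : ℕ) :
    Fintype.card (GridIndex K J J') = (2 * J + 1) ^ (∑ t, K t) * (J' + 1) := by
  simp [Fintype.card_prod, Fintype.card_pi, Finset.prod_pow_eq_pow_sum]

/-- The Hellinger constant for regression functions within distance `U` and variances at most `S`. -/
def hellingerConst (U S : ℝ) : ℝ :=
  min (Real.exp (-(U ^ 2 / (8 * S))) / (8 * S)) (1 / (16 * S ^ 2)) / 2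

lemma hellingerConst_pos (U : ℝ) {S : ℝ} (hS : 0 < S) : 0 < hellingerConst U S := by
  unfold hellingerConst; positivity

lemma hellingerConst_mul_sq_le {U S x y r : ℝ} (hS : 0 < S) (hr : 0 ≤ r) (h : r ≤ √x + |y|)
    (hx : 0 ≤ x) :
    hellingerConst U S * r ^ 2 ≤ Real.exp (-(U ^ 2 / (8 * S))) / (8 * S) * x + y ^ 2 / (16 * S ^ 2) := by
  set c1 := Real.exp (-(U ^ 2 / (8 * S))) / (8 * S)
  set c2 := 1 / (16 * S ^ 2) with hc2
  have e : hellingerConst U S = min c1 c2 / 2 := rfl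
  have hm : 0 ≤ min c1 c2 := by positivity
  have h1 : r ^ 2 ≤ 2 * (x + y ^ 2) := by
    have : r ^ 2 ≤ (√x + |y|) ^ 2 := pow_le_pow_left₀ hr h 2
    have e1 := Real.sq_sqrt hx
    have e2 := sq_abs y
    nlinarith [sq_nonneg (√x - |y|)]
  have h2 : min c1 c2 * x ≤ c1 * x := by gcongr; exact min_le_left _ _
  have h3 : min c1 c2 * y ^ 2 ≤ c2 * y ^ 2 := by gcongr; exact min_le_right _ _
  have e4 : y ^ 2 / (16 * S ^ 2) = c2 * y ^ 2 := by rw [hc2]; ring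
  rw [e, e4]
  nlinarith

open Classical in
/-- The grid points far away from the true parameters. -/
def farGrid (Q : Measure (Fin p → ℝ)) (E : Fin T → ZTree Z) (f0 : (Fin p → ℝ) → ℝ)
    (s0 δ C₁ S r : ℝ) (J J' : ℕ) : Finset (GridIndex (fun t => (E t).numLeaves) J J') :=
  Finset.univ.filter fun γ => (∀ t k, |gridHeights δ γ t k| ≤ C₁) ∧ 0 < gridVar δ γ ∧
    gridVar δ γ ≤ S ∧
    r ≤ √(∫ x, (forest E (gridHeights δ γ) x - f0 x) ^ 2 ∂Q) + |gridVar δ γ - s0|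

lemma likelihood_le_farGrid [IsProbabilityMeasure Q] (hT : 0 < T) (hf0 : Measurable f0) {C₀' C₁ C₂ δ M r : ℝ}
    (hf0b : ∀ᵐ x ∂Q, |f0 x| ≤ C₀') (hC₂ : 0 < C₂) (hδ : 0 < δ) (hδ1 : δ ≤ 1)
    (hfar : r + (T + C₂ * T + 1) * δ ≤ M) (E : Fin T → ZTree Z)
    (B : Heights fun t => (E t).numLeaves) (hB : B ∈ heightCube (fun t => (E t).numLeaves) C₁)
    {s : ℝ} (hs : s ∈ Set.Icc C₂⁻¹ C₂)
    (hM : ENNReal.ofReal M < eLpNorm (fun x => forest E B x - f0 x) 2 Q + ENNReal.ofReal |s - s0|)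
    (D : Fin n → (Fin p → ℝ) × ℝ) :
    likelihood D (forest E B) s ≤ ENNReal.ofReal (Real.exp (n * ((T + C₂ + T * C₂) * δ))) *
      ∑ γ ∈ farGrid Q E f0 s0 δ (C₁ + 1) (C₂ * (1 + T) + 1) r ⌈C₁ / δ⌉₊ ⌈C₂ * (1 + T) / δ⌉₊,
        likelihood D (forest E (gridHeights δ γ)) (gridVar δ γ) := by
  have hT' : (1 : ℝ) ≤ T := by exact_mod_cast hT
  have hs0 : 0 < s := (inv_pos.2 hC₂).trans_le hs.1
  have hinv : s⁻¹ ≤ C₂ := inv_le_of_inv_le₀ hC₂ hs.1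
  have hBC : ∀ t k, |B t k| ≤ C₁ := fun t k => abs_le.2 (hB t k)
  choose i hi using fun t k => exists_grid_near hδ (hBC t k)
  obtain ⟨i', hi1, hi2⟩ := exists_grid_above (x := s * (1 + T * δ)) (C := C₂ * (1 + T)) hδ
    (by positivity) (by
      have : T * δ ≤ T := by nlinarith
      have := hs.2
      gcongr)
  set γ : GridIndex (fun t => (E t).numLeaves) ⌈C₁ / δ⌉₊ ⌈C₂ * (1 + T) / δ⌉₊ := (i, i') with hγ
  have hγ1 : ∀ t k, |B t k - gridHeights δ γ t k| ≤ δ := hi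
  set s' := gridVar δ γ with hs'
  have hs'1 : s * (1 + T * δ) ≤ s' := hi1
  have hs'2 : s' ≤ s * (1 + T * δ) + δ := hi2
  have hs'0 : 0 < s' := lt_of_lt_of_le (by positivity) hs'1
  have hnear := abs_forest_sub_le E hγ1
  have hγC : ∀ t k, |gridHeights δ γ t k| ≤ C₁ + 1 := fun t k => by
    have h1 := abs_le.1 (hγ1 t k)
    have h2 := hB t k
    exact abs_le.2 ⟨by linarith [h2.1], by linarith [h2.2]⟩
  have hmem : γ ∈ farGrid Q E f0 s0 δ (C₁ + 1) (C₂ * (1 + T) + 1) r ⌈C₁ / δ⌉₊ ⌈C₂ * (1 + T) / δ⌉₊ := by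
    refine Finset.mem_filter.2 ⟨Finset.mem_univ _, hγC, hs'0, ?_, ?_⟩
    · have : s * (1 + T * δ) ≤ C₂ * (1 + T) := by
        have : T * δ ≤ T := by nlinarith
        have := hs.2
        gcongr
      linarith
    · have hg0 : ∀ᵐ x ∂Q, |forest E (gridHeights δ γ) x - f0 x| ≤ T * (C₁ + 1) + C₀' := by
        filter_upwards [hf0b] with x hx
        exact (abs_sub _ _).trans (add_le_add (abs_forest_le E hγC x) hx)
      have h1 : eLpNorm (fun x => forest E B x - f0 x) 2 Q ≤ ENNReal.ofReal (T * δ +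
          √(∫ x, (forest E (gridHeights δ γ) x - f0 x) ^ 2 ∂Q)) := by
        have e : (fun x => forest E B x - f0 x) =
            (fun x => forest E B x - forest E (gridHeights δ γ) x) +
              fun x => forest E (gridHeights δ γ) x - f0 x := by ext x; simp
        rw [e, ENNReal.ofReal_add (by positivity) (Real.sqrt_nonneg _),
          ← eLpNorm_two_eq (memLp_sub_of_bounded (measurable_forest E _) hf0 hg0)]
        refine (eLpNorm_add_le ((measurable_forest E _).sub (measurable_forest E _)).aestronglyMeasurable
          ((measurable_forest E _).sub hf0).aestronglyMeasurable one_le_two).trans ?_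
        refine add_le_add ?_ le_rfl
        refine (eLpNorm_le_of_ae_bound (C := T * δ) (Eventually.of_forall hnear)).trans ?_
        simp
      have h2 := hM.trans_le (add_le_add h1 le_rfl)
      rw [← ENNReal.ofReal_add (by positivity) (abs_nonneg _)] at h2
      have h3 := not_le.1 fun h => absurd h2 (not_lt.2 (ENNReal.ofReal_le_ofReal h))
      have h4 : |s - s0| ≤ |s' - s0| + (C₂ * T + 1) * δ := by
        have h5 : |s - s'| ≤ (C₂ * T + 1) * δ := by
          rw [abs_le]
          have h6 : s * (T * δ) ≤ C₂ * (T * δ) := by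
            have := hs.2
            gcongr
          have h7 : 0 ≤ s * (T * δ) := by positivity
          have h8 : 0 ≤ (C₂ * T + 1) * δ := by positivity
          constructor <;> nlinarith
        have h9 := abs_add_le (s - s') (s' - s0)
        rw [sub_add_sub_cancel] at h9
        linarith
      have e : (T + C₂ * T + 1) * δ = T * δ + (C₂ * T + 1) * δ := by ring
      linarith
  refine (likelihood_le_of_near (g := forest E (gridHeights δ γ)) (s' := s') hs0
    (show 0 < T * δ by positivity) hnear hs'1 D).trans ?_
  refine mul_le_mul' ?_ (Finset.single_le_sum (f := fun γ : GridIndex (fun t => (E t).numLeaves)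
    ⌈C₁ / δ⌉₊ ⌈C₂ * (1 + T) / δ⌉₊ => likelihood D (forest E (gridHeights δ γ)) (gridVar δ γ))
    (fun _ _ => zero_le) hmem)
  rw [Real.exp_nat_mul, ENNReal.ofReal_pow (Real.exp_pos _).le]
  gcongr
  have a1 : s' / s ≤ Real.exp ((T + C₂) * δ) := by
    refine le_trans ?_ (Real.add_one_le_exp _)
    rw [div_le_iff₀ hs0]
    have : δ ≤ C₂ * δ * s := by
      have : 1 ≤ C₂ * s := by
        rw [inv_eq_one_div, div_le_iff₀ hs0] at hinv; exact hinv
      nlinarith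
    nlinarith
  have a2 : √(s' / s) ≤ Real.exp ((T + C₂) * δ) := by
    apply Real.sqrt_le_iff.2 ⟨(Real.exp_pos _).le, a1.trans ?_⟩
    have : 1 ≤ Real.exp ((T + C₂) * δ) := Real.one_le_exp (by positivity)
    nlinarith
  have a3 : Real.exp (T * δ / (2 * s)) ≤ Real.exp (T * C₂ * δ) := by
    apply Real.exp_le_exp.2
    have e : T * δ / (2 * s) = T * δ * s⁻¹ / 2 := by field_simp
    have : T * δ * s⁻¹ ≤ T * δ * C₂ := by gcongr
    have h0 : 0 ≤ T * δ * s⁻¹ := by positivity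
    rw [e]; nlinarith
  calc _ ≤ Real.exp ((T + C₂) * δ) * Real.exp (T * C₂ * δ) := by gcongr
    _ = _ := by rw [← Real.exp_add]; congr 1; ring

variable {μB : (K : Fin T → ℕ) → Measure (Heights K)} {μσ : Measure ℝ}

/-- The expected contribution of one ensemble to the posterior probability of the complement of a
ball around the true parameters. -/
lemma exists_majorant_ensembleEvidence [IsProbabilityMeasure Q] (hT : 0 < T) (hf0 : Measurable f0) {C₀' C₁ C₂ c δ M r S U : ℝ}
    (hf0b : ∀ᵐ x ∂Q, |f0 x| ≤ C₀') (hC₂ : 0 < C₂) (hδ : 0 < δ) (hδ1 : δ ≤ 1) (hs0 : 0 < s0)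
    (hs0C : s0 ≤ C₂) (hS : S = C₂ * (1 + T) + 1) (hUU : U = T * (C₁ + 1) + C₀')
    (hμB : IsTruncatedHeightPrior C₁ c μB) (hμσ : IsTruncatedVariancePrior C₂ c μσ)
    (hr : 0 ≤ r) (hfar : r + (T + C₂ * T + 1) * δ ≤ M) (E : Fin T → ZTree Z)
    {y w : ℝ≥0∞} {θ : ℝ} (hθ : 1 / 2 ≤ θ) (hθ1 : θ ≤ 1) :
    ∃ F : (Fin n → (Fin p → ℝ) × ℝ) → ℝ≥0∞, Measurable F ∧
      (∀ D, min 1 (w * ensembleEvidence μB μσ D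
        {θ | ENNReal.ofReal M < eLpNorm (fun x => θ.1 x - f0 x) 2 Q + ENNReal.ofReal |θ.2 - s0|} E /
          (y * likelihood D f0 s0)) ≤ F D) ∧
      ∫⁻ D, F D ∂(Measure.pi fun _ : Fin n => obsLaw Q f0 s0) ≤
        ((2 * ⌈C₁ / δ⌉₊ + 1) ^ totalLeaves E * (⌈C₂ * (1 + T) / δ⌉₊ + 1) : ℕ) *
        ((w * ENNReal.ofReal (Real.exp (n * ((T + C₂ + T * C₂) * δ))) / y) ^ θ *
          ENNReal.ofReal (Real.exp (-(n * (hellingerConst U S * r ^ 2)))) ^ (2 * (1 - θ))) := by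
  have hpB : ∀ K, IsProbabilityMeasure (μB K) := fun K => (hμB K).1
  have hpσ : IsProbabilityMeasure μσ := hμσ.1
  have hSpos : 0 < S := by rw [hS]; positivity
  set A : Set (((Fin p → ℝ) → ℝ) × ℝ) :=
    {θ | ENNReal.ofReal M < eLpNorm (fun x => θ.1 x - f0 x) 2 Q + ENNReal.ofReal |θ.2 - s0|} with hA
  set κ := ENNReal.ofReal (Real.exp (n * ((T + C₂ + T * C₂) * δ)))
  set Γ := farGrid Q E f0 s0 δ (C₁ + 1) (C₂ * (1 + T) + 1) r ⌈C₁ / δ⌉₊ ⌈C₂ * (1 + T) / δ⌉₊ with hΓ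
  have hEE : ∀ D : Fin n → (Fin p → ℝ) × ℝ, ensembleEvidence μB μσ D A E ≤
      κ * ∑ γ ∈ Γ, likelihood D (forest E (gridHeights δ γ)) (gridVar δ γ) := by
    intro D
    calc ensembleEvidence μB μσ D A E ≤ ∫⁻ s, ∫⁻ B, κ * ∑ γ ∈ Γ,
          likelihood D (forest E (gridHeights δ γ)) (gridVar δ γ)
          ∂(μB fun t => (E t).numLeaves) ∂μσ := by
          apply lintegral_mono_ae
          filter_upwards [ae_mem_Icc_variancePrior hμσ] with s hs
          apply lintegral_mono_ae
          filter_upwards [ae_mem_heightCube hμB fun t => (E t).numLeaves] with B hB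
          by_cases hBA : (forest E B, s) ∈ A
          · rw [Set.indicator_of_mem hBA]
            exact likelihood_le_farGrid hT hf0 hf0b hC₂ hδ hδ1 hfar E B hB hs hBA D
          · rw [Set.indicator_of_notMem hBA]; exact zero_le
      _ = _ := by simp
  refine ⟨fun D => ∑ γ ∈ Γ, min 1 (w * κ / y *
    likRatio D (forest E (gridHeights δ γ)) f0 (gridVar δ γ) s0), ?_, ?_, ?_⟩
  · exact Finset.measurable_sum _ fun γ _ => measurable_const.min
      ((measurable_likRatio (measurable_forest E _) hf0).const_mul _)
  · intro D
    refine le_trans (min_le_min_left 1 ?_) (min_one_sum_le _ _)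
    have hL0 := likelihood_ne_zero (f := f0) hs0 D
    have hLt := likelihood_ne_top (f := f0) (s := s0) D
    refine (ENNReal.div_le_div_right (mul_le_mul_right (hEE D) w) _).trans (le_of_eq ?_)
    simp_rw [likelihood_eq_likRatio_mul (f := forest E (gridHeights δ _)) (f0 := f0) hs0 D]
    rw [← Finset.sum_mul, ← Finset.mul_sum, ← mul_assoc, ← mul_assoc,
      ENNReal.mul_div_mul_right _ _ hL0 hLt, ENNReal.mul_div_right_comm]
  · rw [lintegral_finsetSum _ fun γ _ => measurable_const.min
      ((measurable_likRatio (measurable_forest E _) hf0).const_mul _)]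
    have hone : ∀ γ ∈ Γ, ∫⁻ D, min 1 (w * κ / y *
        likRatio D (forest E (gridHeights δ γ)) f0 (gridVar δ γ) s0)
        ∂(Measure.pi fun _ : Fin n => obsLaw Q f0 s0) ≤ (w * κ / y) ^ θ *
          ENNReal.ofReal (Real.exp (-(n * (hellingerConst U S * r ^ 2)))) ^ (2 * (1 - θ)) := by
      intro γ hγ
      obtain ⟨hγ1, hγ2, hγ3, hγ4⟩ := (Finset.mem_filter.1 hγ).2
      have hU' : ∀ᵐ x ∂Q, |forest E (gridHeights δ γ) x - f0 x| ≤ U := by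
        filter_upwards [hf0b] with x hx
        rw [hUU]
        exact (abs_sub _ _).trans (add_le_add (abs_forest_le E hγ1 x) hx)
      refine lintegral_min_one_mul_le (measurable_likRatio (measurable_forest E _) hf0)
        (lintegral_likRatio (measurable_forest E _) hf0 hγ2 hs0).le ?_ _ hθ hθ1
      refine (lintegral_sqrt_likRatio_le (S := S) (measurable_forest E _) hf0 hγ2 hs0
        (by rw [hS]; exact hγ3) (by
          rw [hS]
          have : (0 : ℝ) ≤ T := by positivity
          nlinarith) hU').trans ?_
      apply ENNReal.ofReal_le_ofReal (Real.exp_le_exp.2 (neg_le_neg _))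
      gcongr
      exact hellingerConst_mul_sq_le hSpos hr hγ4 (integral_nonneg fun x => sq_nonneg _)
    refine (Finset.sum_le_sum hone).trans ?_
    rw [Finset.sum_const, nsmul_eq_mul]
    gcongr
    refine (Finset.card_le_univ _).trans ?_
    rw [card_gridIndex]; rfl

end Forest

end

noncomputable section

namespace Forest

/-! ### The contraction rate -/

lemma natCast_mul_approxRate_sq {n d R : ℕ} {lam abar : ℝ} (hn : 0 < n) (hlam : 0 < lam)
    (habar : 0 < abar) (hl : 0 ≤ Real.log n) :
    (n : ℝ) * approxRate n d R lam abar ^ 2 =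
      (lam ^ 2 * d ^ 2 * n) ^ ((d : ℝ) / (2 * abar + d)) *
        (R * Real.log n) ^ (2 * abar / (2 * abar + d)) := by
  have hn' : (0 : ℝ) < n := by exact_mod_cast hn
  have hden : 0 < 2 * abar + d := by positivity
  set e := (d : ℝ) / (2 * abar + d) with he
  set f := abar / (2 * abar + d) with hf
  have hef : e + 2 * f = 1 := by rw [he, hf]; field_simp; ring
  have h2f : 2 * abar / (2 * abar + d) = 2 * f := by rw [hf]; ring
  have hRl : 0 ≤ R * Real.log n := by positivity
  have e1 : ((lam * d) ^ e) ^ 2 = (lam ^ 2 * d ^ 2) ^ e := by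
    rw [← mul_pow, ← Real.rpow_natCast, ← Real.rpow_natCast, ← Real.rpow_mul (by positivity),
      ← Real.rpow_mul (by positivity), mul_comm e]
  have e2 : ((R * Real.log n / n) ^ f) ^ 2 = (R * Real.log n) ^ (2 * f) / (n : ℝ) ^ (2 * f) := by
    rw [← Real.div_rpow hRl hn'.le, ← Real.rpow_natCast, ← Real.rpow_mul (by positivity)]
    congr 1; push_cast; ring
  rw [approxRate, mul_pow, e1, e2, h2f, Real.mul_rpow (by positivity) hn'.le]
  have e3 : (n : ℝ) = (n : ℝ) ^ e * (n : ℝ) ^ (2 * f) := by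
    rw [← Real.rpow_add hn', hef, Real.rpow_one]
  have h4 : 0 < (n : ℝ) ^ (2 * f) := by positivity
  calc (n : ℝ) * ((lam ^ 2 * d ^ 2) ^ e * ((R * Real.log n) ^ (2 * f) / (n : ℝ) ^ (2 * f)))
      = ((n : ℝ) ^ e * (n : ℝ) ^ (2 * f)) *
        ((lam ^ 2 * d ^ 2) ^ e * ((R * Real.log n) ^ (2 * f) / (n : ℝ) ^ (2 * f))) := by rw [← e3]
    _ = _ := by field_simp

lemma rpow_le_natCast_mul_approxRate_sq {n d R : ℕ} {lam abar a : ℝ} (hn : 0 < n) (hd : 0 < d)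
    (hR : 0 < R) (ha : a < 1 / 2) (hlam : (n : ℝ) ^ (-a) ≤ lam) (habar : 0 < abar)
    (habar1 : abar ≤ 1) (hl : 1 ≤ Real.log n) :
    (n : ℝ) ^ ((1 - 2 * a) / 3) ≤ n * approxRate n d R lam abar ^ 2 := by
  have hn' : (0 : ℝ) < n := by exact_mod_cast hn
  have hn1 : (1 : ℝ) ≤ n := by exact_mod_cast hn
  have hd1 : (1 : ℝ) ≤ d := by exact_mod_cast hd
  have hR1 : (1 : ℝ) ≤ R := by exact_mod_cast hR
  have hden : 0 < 2 * abar + d := by positivity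
  rw [natCast_mul_approxRate_sq hn (lt_of_lt_of_le (by positivity) hlam) habar (by linarith)]
  have h1 : 1 ≤ (R * Real.log n) ^ (2 * abar / (2 * abar + d)) :=
    Real.one_le_rpow (by nlinarith) (by positivity)
  have h2 : (n : ℝ) ^ (1 - 2 * a) ≤ lam ^ 2 * d ^ 2 * n := by
    have e : (n : ℝ) ^ (1 - 2 * a) = ((n : ℝ) ^ (-a)) ^ 2 * 1 ^ 2 * n := by
      rw [← Real.rpow_natCast, ← Real.rpow_mul hn'.le, one_pow, mul_one, ← Real.rpow_add_one hn'.ne']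
      congr 1; push_cast; ring
    rw [e]
    gcongr
  have h3 : 1 / 3 ≤ (d : ℝ) / (2 * abar + d) := by
    rw [div_le_div_iff₀ (by norm_num) hden]; linarith
  have h4 : (1 : ℝ) ≤ (n : ℝ) ^ (1 - 2 * a) := Real.one_le_rpow hn1 (by linarith)
  calc (n : ℝ) ^ ((1 - 2 * a) / 3) = ((n : ℝ) ^ (1 - 2 * a)) ^ ((1 : ℝ) / 3) := by
        rw [← Real.rpow_mul hn'.le]; congr 1; ring
    _ ≤ ((n : ℝ) ^ (1 - 2 * a)) ^ ((d : ℝ) / (2 * abar + d)) :=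
        Real.rpow_le_rpow_of_exponent_le h4 h3
    _ ≤ (lam ^ 2 * d ^ 2 * n) ^ ((d : ℝ) / (2 * abar + d)) := by gcongr
    _ ≤ _ := le_mul_of_one_le_right (by positivity) h1

lemma size_mul_log_le {n d R : ℕ} {lam abar C x : ℝ} (hn : 0 < n) (hlam : 0 < lam)
    (hR : 0 < R) (habar : 0 < abar) (hl : 0 < Real.log n)
    (hx : x ≤ C * (lam ^ 2 * d ^ 2 * n / (R * Real.log n)) ^ ((d : ℝ) / (2 * abar + d))) :
    R * x * Real.log n ≤ C * (n * approxRate n d R lam abar ^ 2) := by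
  have hn' : (0 : ℝ) < n := by exact_mod_cast hn
  have hR1 : (0 : ℝ) < R := by exact_mod_cast hR
  have hRl : 0 < R * Real.log n := by positivity
  have hden : 0 < 2 * abar + d := by positivity
  rw [natCast_mul_approxRate_sq hn hlam habar hl.le]
  rw [Real.div_rpow (by positivity) hRl.le] at hx
  have e : R * Real.log n = (R * Real.log n) ^ ((d : ℝ) / (2 * abar + d)) *
      (R * Real.log n) ^ (2 * abar / (2 * abar + d)) := by
    rw [← Real.rpow_add hRl]
    have : (d : ℝ) / (2 * abar + d) + 2 * abar / (2 * abar + d) = 1 := by field_simp; ring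
    rw [this, Real.rpow_one]
  have h1 := mul_le_mul_of_nonneg_left hx hRl.le
  have h2 : 0 < (R * Real.log n) ^ ((d : ℝ) / (2 * abar + d)) := by positivity
  calc R * x * Real.log n = R * Real.log n * x := by ring
    _ ≤ _ := h1
    _ = ((R * Real.log n) ^ ((d : ℝ) / (2 * abar + d)) *
      (R * Real.log n) ^ (2 * abar / (2 * abar + d))) * (C * ((lam ^ 2 * d ^ 2 * n) ^
        ((d : ℝ) / (2 * abar + d)) / (R * Real.log n) ^ ((d : ℝ) / (2 * abar + d)))) := by rw [← e]
    _ = _ := by field_simp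

lemma approxRate_nonneg (n d R : ℕ) {lam : ℝ} (abar : ℝ) (hlam : 0 < lam) :
    0 ≤ approxRate n d R lam abar := by
  have := Real.log_natCast_nonneg n
  unfold approxRate
  positivity

lemma approxRate_le_rate (n p d R : ℕ) (lam abar : ℝ) :
    approxRate n d R lam abar ≤ rate n p d R lam abar :=
  le_add_of_nonneg_left (Real.sqrt_nonneg _)

lemma mul_log_le_rate_sq {n p d R : ℕ} {lam abar : ℝ} (hn : 0 < n) (hlam : 0 < lam) :
    d * Real.log p ≤ n * rate n p d R lam abar ^ 2 := by
  have hn' : (0 : ℝ) < n := by exact_mod_cast hn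
  have h0 : 0 ≤ d * Real.log p / n := by
    have := Real.log_natCast_nonneg p
    positivity
  have h1 : √(d * Real.log p / n) ≤ rate n p d R lam abar :=
    le_add_of_nonneg_right (approxRate_nonneg n d R abar hlam)
  have h2 := pow_le_pow_left₀ (Real.sqrt_nonneg _) h1 2
  rw [Real.sq_sqrt h0, div_le_iff₀ hn'] at h2
  linarith

/-! ### The approximating ensemble -/

variable {p b : ℕ} {Z : Fin b → Fin p → ℝ}

/-- A single tree and a step function on it, as an ensemble and a forest. -/
lemma exists_ensemble_of_tree (T : ℕ) (tr : ZTree Z) (β : Fin tr.numLeaves → ℝ) {C : ℝ}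
    (hβ : ∀ k, |β k| ≤ C) (hv : tr.Valid (Cell.unit p)) :
    ∃ (E : Fin (T + 1) → ZTree Z) (B : Heights fun t => (E t).numLeaves),
      (∀ t k, |B t k| ≤ C) ∧ (∀ x, forest E B x = tr.stepFun β x) ∧
      totalLeaves E = tr.numLeaves + T ∧ (∀ t, (E t).Valid (Cell.unit p)) ∧
      (∀ t, (E t).height ≤ tr.height) ∧ ∀ i, totalSplits E i = tr.splitCount i := by
  have hC : 0 ≤ C := (abs_nonneg _).trans (hβ ⟨0, tr.numLeaves_pos⟩)
  set E : Fin (T + 1) → ZTree Z := Fin.cons tr fun _ => ZTree.leaf with hE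
  refine ⟨E, Fin.cons (α := fun t => Fin (E t).numLeaves → ℝ) β fun _ _ => 0, ?_, ?_, ?_, ?_, ?_, ?_⟩
  · intro t
    refine Fin.cases ?_ (fun i => ?_) t
    · exact hβ
    · intro k
      show |(0 : ℝ)| ≤ C
      simpa using hC
  · intro x
    rw [forest, Fin.sum_univ_succ]
    have h1 : ∀ i : Fin T, (E i.succ).stepFun
        (Fin.cons (α := fun t => Fin (E t).numLeaves → ℝ) β (fun _ _ => 0) i.succ) x = 0 := fun i => rfl
    rw [Finset.sum_eq_zero fun i _ => h1 i, add_zero]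
    rfl
  · rw [totalLeaves, Fin.sum_univ_succ]
    simp [hE, ZTree.numLeaves]
  · intro t
    refine Fin.cases ?_ (fun i => ?_) t
    · exact hv
    · trivial
  · intro t
    refine Fin.cases ?_ (fun i => ?_) t
    · exact le_rfl
    · exact Nat.zero_le _
  · intro i
    rw [totalSplits, Fin.sum_univ_succ]
    simp [hE, ZTree.splitCount]

lemma abs_sub_clip_le {C x y : ℝ} (hx : |x| ≤ C) : |x - max (-C) (min C y)| ≤ |x - y| := by
  have h := abs_le.1 hx
  rcases le_total C y with h1 | h1
  · rw [min_eq_left h1, max_eq_right (by linarith)]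
    rw [abs_of_nonpos (by linarith), abs_of_nonpos (by linarith)]; linarith
  · rw [min_eq_right h1]
    rcases le_total (-C) y with h2 | h2
    · rw [max_eq_right h2]
    · rw [max_eq_left h2, abs_of_nonneg (by linarith), abs_of_nonneg (by linarith)]; linarith

lemma abs_clip_le {C : ℝ} (hC : 0 ≤ C) (y : ℝ) : |max (-C) (min C y)| ≤ C :=
  abs_le.2 ⟨le_max_left _ _, max_le (by linarith) (min_le_left _ _)⟩

lemma integral_sq_le_of_boundedDensity {Q : Measure (Fin p → ℝ)} [IsProbabilityMeasure Q]
    {CQ : ℝ} (hQ : HasBoundedDensity CQ Q) {g : (Fin p → ℝ) → ℝ} (hg : MemLp g 2 Q) {r : ℝ}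
    (hr : 0 ≤ r) (h : eLpNorm g 2 (volume.restrict (cube p)) ≤ ENNReal.ofReal r) :
    ∫ x, g x ^ 2 ∂Q ≤ |CQ| * r ^ 2 := by
  obtain ⟨q, hq, hqC, hQq⟩ := hQ
  have hle : Q ≤ ENNReal.ofReal |CQ| • volume.restrict (cube p) := by
    rw [hQq, ← withDensity_const]
    exact withDensity_mono (Eventually.of_forall fun x =>
      (hqC x).trans (ENNReal.ofReal_le_ofReal (le_abs_self CQ)))
  have h1 : eLpNorm g 2 Q ≤ ENNReal.ofReal (√|CQ| * r) := by
    refine (eLpNorm_mono_measure g hle).trans ?_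
    rw [eLpNorm_smul_measure_of_ne_top ENNReal.ofNat_ne_top, smul_eq_mul,
      ENNReal.ofReal_mul (Real.sqrt_nonneg _), Real.sqrt_eq_rpow,
      ← ENNReal.ofReal_rpow_of_nonneg (abs_nonneg _) (by norm_num)]
    refine mul_le_mul' (le_of_eq ?_) h
    norm_num
  rw [eLpNorm_two_eq hg, ENNReal.ofReal_le_ofReal_iff (by positivity)] at h1
  have h2 := pow_le_pow_left₀ (Real.sqrt_nonneg _) h1 2
  rwa [Real.sq_sqrt (integral_nonneg fun x => sq_nonneg _), mul_pow,
    Real.sq_sqrt (abs_nonneg _)] at h2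

/-- The split-net assumption yields an ensemble that approximates the true function. -/
lemma SplitNetApprox.exists_ensemble {d R n T : ℕ} {C lam abar C₀' CQ : ℝ} {S : Fin d ↪o Fin p}
    {α : Fin R → Fin d → ℝ} {f : (Fin p → ℝ) → ℝ} (h : SplitNetApprox C n Z S α lam abar f)
    {Q : Measure (Fin p → ℝ)} [IsProbabilityMeasure Q] (hQ : HasBoundedDensity CQ Q)
    (hf : Measurable f) (hC₀' : 0 ≤ C₀') (hfb : ∀ x ∈ cube p, |f x| ≤ C₀')
    (hn : 0 < n) (hlam : 0 < lam) (habar : 0 < abar) (hl : 0 < Real.log n) :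
    ∃ (E : Fin (T + 1) → ZTree Z) (B : Heights fun t => (E t).numLeaves) (H L : ℕ),
      (∀ t k, |B t k| ≤ C₀') ∧ (∀ t, (E t).Valid (Cell.unit p)) ∧
      (∀ t, (E t).height ≤ H) ∧ (H : ℝ) ≤ C * Real.log n + L ∧ 0 < L ∧ 0 < R ∧ 0 < C ∧
      totalLeaves E = R * 2 ^ L + T ∧ (usedCoords E).card ≤ d ∧
      (R * 2 ^ L) * Real.log n ≤ C * (n * approxRate n d R lam abar ^ 2) ∧
      ∫ x, (forest E B x - f x) ^ 2 ∂Q ≤ |CQ| * (C * approxRate n d R lam abar) ^ 2 := by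
  obtain ⟨Tstar, lab, L, sub, β, hv, hch, hh, hL, -, h2L, hreg, happ⟩ := h
  have hprop := fun k => (hreg k).1.properties
  have hR : 0 < R := Fin.pos_iff_nonempty.2 ⟨lab ⟨0, Tstar.numLeaves_pos⟩⟩
  have hnl : Tstar.numLeaves = R := by simpa using Fintype.card_congr lab
  have hn' : (0 : ℝ) < n := by exact_mod_cast hn
  have hR' : (0 : ℝ) < R := by exact_mod_cast hR
  have hC : 0 < C := by
    by_contra hC
    have h1 : C * (lam ^ 2 * d ^ 2 * n / (R * Real.log n)) ^ ((d : ℝ) / (2 * abar + d)) ≤ 0 :=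
      mul_nonpos_of_nonpos_of_nonneg (not_lt.1 hC) (by positivity)
    have : (0 : ℝ) < 2 ^ L := by positivity
    linarith
  have hleaves : (Tstar.graft sub).numLeaves = R * 2 ^ L := by
    rw [ZTree.numLeaves_graft, Finset.sum_congr rfl fun k _ => (hprop k).2.2.2]
    simp [hnl]
  have htrv : (Tstar.graft sub).Valid (Cell.unit p) := ZTree.valid_graft _ _ _ hv fun k => (hprop k).1
  have htrc : (Tstar.graft sub).ChoppedIn (Set.range S) := ZTree.choppedIn_graft _ _ hch fun k => (hprop k).2.1
  have htrh : (Tstar.graft sub).height ≤ Tstar.height + L := ZTree.height_graft_le _ _ fun k => (hprop k).2.2.1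
  set β' : Fin (Tstar.graft sub).numLeaves → ℝ := fun k => max (-C₀') (min C₀' (β k)) with hβ'
  obtain ⟨E, B, hB, hEB, hEl, hEv, hEh, hEs⟩ :=
    exists_ensemble_of_tree T (Tstar.graft sub) β' (fun k => abs_clip_le hC₀' _) htrv
  refine ⟨E, B, Tstar.height + L, L, hB, hEv, fun t => (hEh t).trans htrh, ?_, hL, hR, hC, ?_, ?_, ?_, ?_⟩
  · push_cast; linarith
  · rw [hEl, hleaves]
  · rw [ZTree.choppedIn_iff] at htrc
    have : usedCoords E ⊆ Finset.univ.map S.toEmbedding := by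
      intro i hi
      have := (Finset.mem_filter.1 hi).2
      rw [hEs] at this
      obtain ⟨j, hj⟩ := htrc i this
      simp only [Finset.mem_map, Finset.mem_univ, true_and]
      exact ⟨j, hj⟩
    simpa using Finset.card_le_card this
  · exact size_mul_log_le hn hlam hR habar hl h2L
  · have har := approxRate_nonneg n d R abar hlam
    have hbdd : ∀ᵐ x ∂Q, |forest E B x - f x| ≤ (T + 1 : ℕ) * C₀' + C₀' := by
      filter_upwards [ae_mem_cube hQ] with x hx
      exact (abs_sub _ _).trans (add_le_add (abs_forest_le E hB x) (hfb x hx))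
    refine integral_sq_le_of_boundedDensity hQ (memLp_sub_of_bounded (measurable_forest E B) hf hbdd)
      (by positivity) (le_trans ?_ happ)
    refine eLpNorm_mono_ae ?_
    filter_upwards [ae_restrict_mem measurableSet_Icc] with x hx
    rw [Real.norm_eq_abs, Real.norm_eq_abs, abs_sub_comm, hEB]
    exact abs_sub_clip_le (y := β ((Tstar.graft sub).leafIdx x)) (hfb x hx)

end Forest

end

noncomputable section

namespace Forest

/-! ### Bounds on the exponential scale -/

lemma exp_neg_abs_log_le {x : ℝ} (hx : 0 < x) : Real.exp (-|Real.log x|) ≤ x := by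
  calc Real.exp (-|Real.log x|) ≤ Real.exp (Real.log x) := Real.exp_le_exp.2 (neg_abs_le _)
    _ = x := Real.exp_log hx

lemma le_exp_abs_log {x : ℝ} (hx : 0 < x) : x ≤ Real.exp |Real.log x| := by
  calc x = Real.exp (Real.log x) := (Real.exp_log hx).symm
    _ ≤ _ := Real.exp_le_exp.2 (le_abs_self _)

lemma pow_le_exp {x c l κ β : ℝ} {K : ℕ} (hx : 0 ≤ x) (hc : 0 ≤ c) (h : x ≤ Real.exp (c * l))
    (hK : K * l ≤ κ * β) : x ^ K ≤ Real.exp (c * κ * β) := by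
  calc x ^ K ≤ Real.exp (c * l) ^ K := pow_le_pow_left₀ hx h K
    _ = Real.exp (c * (K * l)) := by rw [← Real.exp_nat_mul]; ring_nf
    _ ≤ Real.exp (c * κ * β) := by
        rw [mul_assoc]; exact Real.exp_le_exp.2 (mul_le_mul_of_nonneg_left hK hc)

lemma exp_neg_le_pow {x c l κ β : ℝ} {K : ℕ} (hc : 0 ≤ c) (h : Real.exp (-(c * l)) ≤ x)
    (hK : K * l ≤ κ * β) : Real.exp (-(c * κ * β)) ≤ x ^ K := by
  calc Real.exp (-(c * κ * β)) ≤ Real.exp (-(c * (K * l))) := by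
        rw [mul_assoc]; exact Real.exp_le_exp.2 (neg_le_neg (mul_le_mul_of_nonneg_left hK hc))
    _ = Real.exp (-(c * l)) ^ K := by rw [← Real.exp_nat_mul]; ring_nf
    _ ≤ x ^ K := pow_le_pow_left₀ (Real.exp_pos _).le h K

lemma natCast_le_exp_of_mul_log_le {n K : ℕ} {κ β : ℝ} (hκ : 0 < κ) (hl : 1 ≤ Real.log n)
    (hβ : β ≤ n) (hK : K * Real.log n ≤ κ * β) :
    (K : ℝ) ≤ Real.exp ((|Real.log κ| + 1) * Real.log n) := by
  have hn : (0 : ℝ) < n := by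
    by_contra h
    rw [le_antisymm (not_lt.1 h) (Nat.cast_nonneg n), Real.log_zero] at hl
    linarith
  calc (K : ℝ) ≤ K * Real.log n := le_mul_of_one_le_right (Nat.cast_nonneg _) hl
    _ ≤ κ * n := hK.trans (mul_le_mul_of_nonneg_left hβ hκ.le)
    _ ≤ Real.exp |Real.log κ| * Real.exp (Real.log n) := by
        rw [Real.exp_log hn]
        gcongr
        exact le_exp_abs_log hκ
    _ ≤ _ := by
        rw [← Real.exp_add]
        apply Real.exp_le_exp.2
        nlinarith [abs_nonneg (Real.log κ)]

lemma mul_rpow_neg_le {p : ℕ} [NeZero p] {ζ ξ θ : ℝ} (hζ : 0 < ζ) (h : 1 ≤ ξ * θ) :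
    p * (ζ / (p : ℝ) ^ ξ) ^ θ ≤ ζ ^ θ := by
  have hp : (1 : ℝ) ≤ p := by exact_mod_cast Nat.pos_of_ne_zero (NeZero.ne p)
  rw [Real.div_rpow hζ.le (by positivity), ← Real.rpow_mul (by positivity)]
  have h1 : (p : ℝ) ≤ (p : ℝ) ^ (ξ * θ) := by
    simpa using Real.rpow_le_rpow_of_exponent_le hp h
  have h2 : 0 < ζ ^ θ := by positivity
  rw [mul_div_assoc', div_le_iff₀ (by positivity)]
  nlinarith

lemma natCast_le_of_two_pow_mul_le {n L : ℕ} {R C β : ℝ} (hC : 0 < C) (hR : 1 ≤ R)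
    (hl : 1 ≤ Real.log n) (hβ : β ≤ n) (h : R * 2 ^ L * Real.log n ≤ C * β) :
    (L : ℝ) ≤ 2 * (|Real.log C| + 1) * Real.log n := by
  have hn : (0 : ℝ) < n := by
    by_contra h
    rw [le_antisymm (not_lt.1 h) (Nat.cast_nonneg n), Real.log_zero] at hl
    linarith
  have h1 : (2 : ℝ) ^ L ≤ C * n := by
    calc (2 : ℝ) ^ L ≤ R * 2 ^ L := le_mul_of_one_le_left (by positivity) hR
      _ ≤ R * 2 ^ L * Real.log n := le_mul_of_one_le_right (by positivity) hl
      _ ≤ _ := h.trans (mul_le_mul_of_nonneg_left hβ hC.le)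
  have h3 := Real.log_le_log (by positivity) h1
  rw [Real.log_pow, Real.log_mul hC.ne' hn.ne'] at h3
  have h4 := Real.log_two_gt_d9
  have h5 := le_abs_self (Real.log C)
  have h6 : (L : ℝ) * (1 / 2) ≤ L * Real.log 2 := by
    apply mul_le_mul_of_nonneg_left _ (Nat.cast_nonneg _); linarith
  nlinarith [abs_nonneg (Real.log C)]

/-- The prior probability of a moderately large sparse ensemble is at least exponentially small. -/
lemma exists_exp_neg_le_ensembleProb {ν ζ ξ C : ℝ} (hν0 : 0 < ν) (hν1 : ν ≤ 1 / 2) (hζ : 0 < ζ)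
    (hξ : 1 < ξ) (hC : 0 < C) (T : ℕ) :
    ∃ Y : ℝ, 0 ≤ Y ∧ ∀ {n p d R b A H L : ℕ} [NeZero p] {Z : Fin b → Fin p → ℝ}
      (E : Fin (T + 1) → ZTree Z) {β : ℝ}, 1 ≤ Real.log n → Real.log n ≤ β → β ≤ n →
      d * Real.log p ≤ β → (∀ j, (coordSet Z j).card ≤ A) → 0 < A →
      2 * (A : ℝ) ≤ Real.exp ((C + 2) * Real.log n) → (∀ t, (E t).Valid (Cell.unit p)) →
      (∀ t, (E t).height ≤ H) → (H : ℝ) ≤ C * Real.log n + L → 0 < L → 0 < R →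
      totalLeaves E = R * 2 ^ L + T → (usedCoords E).card ≤ d →
      (R * 2 ^ L) * Real.log n ≤ C * β →
      (totalLeaves E * Real.log n ≤ (C + T) * β) ∧
      ENNReal.ofReal (Real.exp (-(Y * β))) ≤ ensembleProb Z ν ζ ξ E := by
  set g := |Real.log ζ| with hg
  set κ := C + T with hκ
  have hg0 : 0 ≤ g := abs_nonneg _
  have hκ0 : 0 < κ := by positivity
  set cL := 2 * (|Real.log C| + 1) with hcL
  have hcL0 : 0 ≤ cL := by positivity
  set c1 := (C + cL) * |Real.log ν| + (C + 2) with hc1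
  have hc10 : 0 ≤ c1 := by positivity
  refine ⟨c1 * κ + (κ * g + ξ) + (|Real.log κ| + 1) * κ + (ζ + κ) + g, by positivity, ?_⟩
  clear_value g κ cL c1
  intro n p d R b A H L _ Z E β hl hlβ hβn hdp hA hA0 hAl hv hH hHL hL0 hR0 htot hused hsize
  set l := Real.log n with hldef
  have hp1 : (1 : ℝ) ≤ p := by exact_mod_cast Nat.pos_of_ne_zero (NeZero.ne p)
  have hlogp : 0 ≤ Real.log p := Real.log_nonneg hp1
  have hβ1 : 1 ≤ β := hl.trans hlβ
  have hn : (0 : ℝ) < n := by linarith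
  have hR1 : (1 : ℝ) ≤ R := by exact_mod_cast hR0
  set K := totalLeaves E with hK
  have hKl : K * l ≤ κ * β := by
    rw [htot]; push_cast
    rw [hκ, add_mul, add_mul]
    have : (T : ℝ) * l ≤ T * β := by gcongr
    linarith
  refine ⟨hKl, ?_⟩
  have hKβ : (K : ℝ) ≤ κ * β := (le_mul_of_one_le_right (Nat.cast_nonneg _) hl).trans hKl
  have hN := sum_totalSplits_add E
  set N := ∑ i, totalSplits E i with hNdef
  have h2L : 2 ≤ R * 2 ^ L := by
    calc 2 = 1 * 2 ^ 1 := by norm_num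
      _ ≤ R * 2 ^ L := Nat.mul_le_mul hR0 (Nat.pow_le_pow_right (by norm_num) hL0)
  have hN0 : 0 < N := by omega
  have hNK : N ≤ K := by omega
  have hNK' : (N : ℝ) ≤ K := by exact_mod_cast hNK
  have hsN : (usedCoords E).card ≤ K := (card_usedCoords_le E)
  set s := (usedCoords E).card with hs
  have hsK' : (s : ℝ) ≤ K := by exact_mod_cast hsN
  have hsd : (s : ℝ) ≤ d := by exact_mod_cast hused
  -- the number of rounds
  have hLl : (L : ℝ) ≤ cL * l := by
    rw [hcL]; exact natCast_le_of_two_pow_mul_le hC hR1 hl hβn hsize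
  have hHl : (H : ℝ) ≤ (C + cL) * l := by rw [add_mul]; linarith
  set a := ζ / (p : ℝ) ^ ξ with ha
  have ha0 : 0 < a := by positivity
  have hpa : p * a ≤ ζ := by
    have := mul_rpow_neg_le (p := p) (ζ := ζ) (ξ := ξ) (θ := 1) hζ (by linarith)
    simpa using this
  have hpa0 : 0 < p * a := by positivity
  refine le_trans (ENNReal.ofReal_le_ofReal ?_)
    (le_ensembleProb hν0 hν1 ha0 rfl hA hA0 E hv hH hNdef.symm hN0)
  have hA0' : (0 : ℝ) < A := by exact_mod_cast hA0
  have f1 : Real.exp (-(c1 * κ * β)) ≤ (ν ^ H / (2 * A)) ^ K := by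
    refine exp_neg_le_pow hc10 ?_ hKl
    have e1 : Real.exp (-((C + cL) * |Real.log ν| * l)) ≤ ν ^ H := by
      calc _ ≤ Real.exp (-(|Real.log ν| * H)) := by
            apply Real.exp_le_exp.2
            have := mul_le_mul_of_nonneg_left hHl (abs_nonneg (Real.log ν))
            linarith
        _ = Real.exp (-|Real.log ν|) ^ H := by rw [← Real.exp_nat_mul]; ring_nf
        _ ≤ ν ^ H := pow_le_pow_left₀ (Real.exp_pos _).le (exp_neg_abs_log_le hν0) _
    calc Real.exp (-(c1 * l))
        = Real.exp (-((C + cL) * |Real.log ν| * l)) / Real.exp ((C + 2) * l) := by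
          rw [← Real.exp_sub, hc1]; ring_nf
      _ ≤ _ := by gcongr
  have f2 : Real.exp (-((κ * g + ξ) * β)) ≤ a ^ s := by
    have e1 : a = Real.exp (Real.log ζ - ξ * Real.log p) := by
      rw [Real.exp_sub, Real.exp_log hζ, mul_comm ξ, ← Real.rpow_def_of_pos (by linarith)]
    rw [e1, ← Real.exp_nat_mul]
    apply Real.exp_le_exp.2
    have h1 : (s : ℝ) * g ≤ κ * β * g := mul_le_mul_of_nonneg_right (hsK'.trans hKβ) hg0
    have h2 : (s : ℝ) * (-g) ≤ s * Real.log ζ :=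
      mul_le_mul_of_nonneg_left (by rw [hg]; exact neg_abs_le _) (Nat.cast_nonneg _)
    have h3 : (s : ℝ) * Real.log p ≤ β :=
      (mul_le_mul_of_nonneg_right hsd hlogp).trans hdp
    have h4 : ξ * (s * Real.log p) ≤ ξ * β := mul_le_mul_of_nonneg_left h3 (by linarith)
    calc -((κ * g + ξ) * β) = -(κ * β * g) - ξ * β := by ring
      _ ≤ s * Real.log ζ - ξ * (s * Real.log p) := by linarith
      _ = _ := by ring
  have f3 : (N : ℝ) ^ N ≤ Real.exp ((|Real.log κ| + 1) * κ * β) := by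
    have hNl : N * l ≤ κ * β := (mul_le_mul_of_nonneg_right hNK' (by linarith)).trans hKl
    exact pow_le_exp (Nat.cast_nonneg _) (by positivity)
      (natCast_le_exp_of_mul_log_le hκ0 hl hβn hNl) hNl
  have f4 : Real.exp (-((ζ + κ) * β)) ≤ (2 : ℝ) ^ (-(p * a + N)) := by
    rw [Real.rpow_def_of_pos two_pos]
    apply Real.exp_le_exp.2
    have h0 : ζ ≤ ζ * β := le_mul_of_one_le_right hζ.le hβ1
    have h1 : p * a + N ≤ (ζ + κ) * β := by rw [add_mul]; linarith
    have h2 : Real.log 2 ≤ 1 := by linarith [Real.log_two_lt_d9]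
    have h3 : 0 ≤ p * a + N := by positivity
    have h4 := mul_le_mul_of_nonneg_right h2 h3
    linarith
  have f5 : Real.exp (-(g * β)) ≤ 1 / (p * a) := by
    calc _ ≤ Real.exp (-g) :=
          Real.exp_le_exp.2 (neg_le_neg (le_mul_of_one_le_right hg0 hβ1))
      _ = (Real.exp g)⁻¹ := Real.exp_neg _
      _ ≤ (p * a)⁻¹ := by
        rw [inv_le_inv₀ (Real.exp_pos _) hpa0]
        rw [hg]; exact hpa.trans (le_exp_abs_log hζ)
      _ = _ := (one_div _).symm
  have hNN : (0 : ℝ) < (N : ℝ) ^ N := by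
    have : (0 : ℝ) < N := by exact_mod_cast hN0
    positivity
  calc Real.exp (-((c1 * κ + (κ * g + ξ) + (|Real.log κ| + 1) * κ + (ζ + κ) + g) * β))
      = Real.exp (-(c1 * κ * β)) * (Real.exp (-((κ * g + ξ) * β)) /
        Real.exp ((|Real.log κ| + 1) * κ * β) * (Real.exp (-((ζ + κ) * β)) *
          Real.exp (-(g * β)))) := by
        rw [← Real.exp_sub, ← Real.exp_add, ← Real.exp_add, ← Real.exp_add]; ring_nf
    _ ≤ _ := by gcongr

/-- Ensembles with many terminal nodes have negligible prior probability. -/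
lemma tsum_ensembleProb_tail_le_exp {ν ζ ξ : ℝ} {p b T : ℕ} {Z : Fin b → Fin p → ℝ}
    (hν0 : 0 < ν) (hν1 : ν ≤ 1 / 2) (ha : 0 < ζ / (p : ℝ) ^ ξ) {c l β K' Y : ℝ} {K : ℕ}
    (hc : 0 < c) (hcl : 10 ≤ c * l) (hl0 : 0 < l) (hK'1 : 1 ≤ K') (hK' : (Y + 1) * 16 ≤ K' * c)
    (hK : K' * β ≤ K * l) (hTl : 4 * T * l ≤ Real.exp (c / 2 * l)) (hβ : Real.exp (c * l) ≤ β) :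
    (∑' E : Fin T → ZTree Z, if K < totalLeaves E then ensembleProb Z ν ζ ξ E else 0) ≤
      ENNReal.ofReal (Real.exp (-((Y + 1) * β))) := by
  set m := ⌊c / 2 * l⌋₊ with hm
  have hm1 : (m : ℝ) ≤ c / 2 * l := Nat.floor_le (by positivity)
  have hm2 : c / 2 * l < m + 1 := Nat.lt_floor_add_one _
  have hm4 : 4 ≤ m := Nat.le_floor (by push_cast; linarith)
  have hm4' : (4 : ℝ) ≤ m := by exact_mod_cast hm4
  have hβ0 : 0 < β := (Real.exp_pos _).trans_le hβ
  have h2m : (2 : ℝ) ^ m ≤ Real.exp (c / 2 * l) := by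
    calc (2 : ℝ) ^ m ≤ Real.exp 1 ^ m := by
          gcongr; linarith [Real.exp_one_gt_d9]
      _ = Real.exp m := by rw [← Real.exp_nat_mul, mul_one]
      _ ≤ _ := Real.exp_le_exp.2 hm1
  have hTK : (T : ℝ) * 2 ^ m * 4 ≤ K := by
    have h1 : T * 2 ^ m * 4 * l ≤ K * l := by
      calc T * 2 ^ m * 4 * l = (4 * T * l) * 2 ^ m := by ring
        _ ≤ Real.exp (c / 2 * l) * Real.exp (c / 2 * l) := by gcongr
        _ = Real.exp (c * l) := by rw [← Real.exp_add]; ring_nf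
        _ ≤ β := hβ
        _ ≤ K' * β := le_mul_of_one_le_left hβ0.le hK'1
        _ ≤ K * l := hK
    exact le_of_mul_le_mul_right h1 hl0
  have hTK' : T * 2 ^ m * 4 ≤ K := by exact_mod_cast hTK
  set x := ∑' E : Fin T → ZTree Z, if K < totalLeaves E then ensembleProb Z ν ζ ξ E else 0
  have hx : x * ((2 : ℝ≥0∞) ^ (m - 1)) ^ K ≤ ((2 : ℝ≥0∞) ^ (m * 2 ^ m)) ^ T := by
    convert tsum_ensembleProb_tail_le hν0 hν1 ha (by omega : 0 < m) K
  rw [← pow_mul, ← pow_mul] at hx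
  obtain ⟨q, hq⟩ : ∃ q, (m - 1) * K = m * 2 ^ m * T + q := by
    apply Nat.exists_eq_add_of_le
    clear_value m
    obtain ⟨m', rfl⟩ : ∃ m', m = m' + 1 := ⟨m - 1, by omega⟩
    simp only [Nat.add_sub_cancel]
    nlinarith [Nat.mul_le_mul_left (m' + 1) hTK', hm4]
  have hq2 : (m : ℝ) * K ≤ 2 * q := by
    have h1 : ((m : ℝ) - 1) * K = m * 2 ^ m * T + q := by
      have : (((m - 1 : ℕ) : ℝ)) = m - 1 := by push_cast [Nat.cast_sub (by omega : 1 ≤ m)]; ring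
      rw [← this]; exact_mod_cast hq
    have h2 := mul_le_mul_of_nonneg_left hTK (by positivity : (0 : ℝ) ≤ m)
    have h3 := mul_le_mul_of_nonneg_right hm4' (Nat.cast_nonneg (α := ℝ) K)
    nlinarith
  have hxq : x * (2 : ℝ≥0∞) ^ q ≤ 1 := by
    have h0 : (2 : ℝ≥0∞) ^ (m * 2 ^ m * T) ≠ 0 := by positivity
    have ht : (2 : ℝ≥0∞) ^ (m * 2 ^ m * T) ≠ ⊤ := ENNReal.pow_ne_top ENNReal.ofNat_ne_top
    rw [hq, pow_add, ← mul_assoc, mul_right_comm] at hx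
    rw [← ENNReal.mul_le_mul_iff_left h0 ht, one_mul]
    exact hx
  have hqβ : (Y + 1) * β ≤ q * Real.log 2 := by
    have h1 := Real.log_two_gt_d9
    have h2 : c / 4 * l ≤ m := by linarith
    have h3 : c / 4 * (K' * β) ≤ m * K := by
      calc c / 4 * (K' * β) ≤ c / 4 * (K * l) := by gcongr
        _ = (c / 4 * l) * K := by ring
        _ ≤ m * K := by gcongr
    have h4 := mul_le_mul_of_nonneg_right hK' hβ0.le
    nlinarith
  have h2q : ENNReal.ofReal (Real.exp ((Y + 1) * β)) ≤ 2 ^ q := by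
    calc _ ≤ ENNReal.ofReal (2 ^ q) := by
          apply ENNReal.ofReal_le_ofReal
          calc _ ≤ Real.exp (q * Real.log 2) := Real.exp_le_exp.2 hqβ
            _ = 2 ^ q := by rw [Real.exp_nat_mul, Real.exp_log two_pos]
      _ = 2 ^ q := by rw [ENNReal.ofReal_pow two_pos.le]; norm_num
  rw [Real.exp_neg, ENNReal.ofReal_inv_of_pos (Real.exp_pos _), ENNReal.le_inv_iff_mul_le]
  exact (mul_le_mul_right h2q _).trans hxq

/-- The sum of fractional powers of prior probabilities grows at most exponentially. -/
lemma exists_tsum_ensembleProb_rpow_le {ν ζ ξ C κ θ : ℝ} (hν0 : 0 < ν) (hν1 : ν ≤ 1 / 2)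
    (hζ : 0 < ζ) (hξ : 1 < ξ) (hC : 0 < C) (hκ : 0 < κ) (hθ : 0 < θ) (hθ1 : θ ≤ 1)
    (hξθ : 1 ≤ ξ * θ) :
    ∃ V : ℝ, ∀ {n p T b A K : ℕ} [NeZero p] {Z : Fin b → Fin p → ℝ} {β : ℝ}, 1 ≤ Real.log n →
      Real.log n ≤ β → β ≤ n → Real.log p ≤ β → (∀ j, (coordSet Z j).card ≤ A) → 0 < A →
      2 * (A : ℝ) ≤ Real.exp ((C + 2) * Real.log n) → 0 < K → K * Real.log n ≤ κ * β →
      ∑' E : Fin T → ZTree Z, (if totalLeaves E ≤ K then ensembleProb Z ν ζ ξ E ^ θ else 0) ≤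
        ENNReal.ofReal (Real.exp (V * β)) := by
  set c1 := (|Real.log κ| + 1) + (C + 3) with hc1
  have hc10 : 0 ≤ c1 := by positivity
  refine ⟨ζ * κ + (1 / ζ + (ξ - 1)) + c1 * κ + ζ ^ θ, ?_⟩
  intro n p T b A K _ Z β hl hlβ hβn hpβ hA hA0 hAl hK0 hKl
  have hp1 : (1 : ℝ) ≤ p := by exact_mod_cast Nat.pos_of_ne_zero (NeZero.ne p)
  have hp0 : (0 : ℝ) < p := by linarith
  have hβ1 : 1 ≤ β := hl.trans hlβ
  set a := ζ / (p : ℝ) ^ ξ with ha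
  have ha0 : 0 < a := by positivity
  have hpa : p * a ≤ ζ := by
    have := mul_rpow_neg_le (p := p) (ζ := ζ) (ξ := ξ) (θ := 1) hζ (by linarith)
    simpa using this
  have haζ : a ≤ ζ := (le_mul_of_one_le_left ha0.le hp1).trans hpa
  refine (tsum_ensembleProb_rpow_le hν0 hν1 ha0 rfl hA hA0 hK0 hθ hθ1).trans
    (ENNReal.ofReal_le_ofReal ?_)
  have f1 : (1 + a) ^ K ≤ Real.exp (ζ * κ * β) := by
    refine pow_le_exp (by positivity) hζ.le ?_ hKl
    calc 1 + a ≤ ζ + 1 := by linarith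
      _ ≤ Real.exp ζ := Real.add_one_le_exp ζ
      _ ≤ _ := Real.exp_le_exp.2 (le_mul_of_one_le_right hζ.le hl)
  have f2 : 1 + 1 / (p * a) ≤ Real.exp ((1 / ζ + (ξ - 1)) * β) := by
    have e1 : 1 / (p * a) = 1 / ζ * (p : ℝ) ^ (ξ - 1) := by
      rw [ha, Real.rpow_sub_one hp0.ne']; field_simp
    have e2 : 1 ≤ (p : ℝ) ^ (ξ - 1) := Real.one_le_rpow hp1 (by linarith)
    have e3 : (p : ℝ) ^ (ξ - 1) ≤ Real.exp ((ξ - 1) * β) := by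
      rw [Real.rpow_def_of_pos hp0]
      apply Real.exp_le_exp.2
      nlinarith
    rw [e1]
    calc 1 + 1 / ζ * (p : ℝ) ^ (ξ - 1) ≤ (1 / ζ + 1) * (p : ℝ) ^ (ξ - 1) := by linarith
      _ ≤ Real.exp (1 / ζ * β) * Real.exp ((ξ - 1) * β) := by
          gcongr
          calc 1 / ζ + 1 ≤ Real.exp (1 / ζ) := Real.add_one_le_exp _
            _ ≤ _ := Real.exp_le_exp.2 (le_mul_of_one_le_right (by positivity) hβ1)
      _ = _ := by rw [← Real.exp_add]; ring_nf
  have f3 : (4 * (K * A) : ℝ) ^ K ≤ Real.exp (c1 * κ * β) := by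
    refine pow_le_exp (by positivity) hc10 ?_ hKl
    calc (4 * (K * A) : ℝ) = K * (2 * (2 * A)) := by ring
      _ ≤ Real.exp ((|Real.log κ| + 1) * Real.log n) *
          (Real.exp 1 * Real.exp ((C + 2) * Real.log n)) := by
          gcongr
          · exact natCast_le_exp_of_mul_log_le hκ hl hβn hKl
          · linarith [Real.exp_one_gt_d9]
      _ = Real.exp ((|Real.log κ| + 1) * Real.log n + (1 + (C + 2) * Real.log n)) := by
          rw [← Real.exp_add, ← Real.exp_add]
      _ ≤ _ := by
          apply Real.exp_le_exp.2
          rw [hc1]; nlinarith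
  have f4 : (1 + a ^ θ) ^ p ≤ Real.exp (ζ ^ θ * β) := by
    calc (1 + a ^ θ) ^ p ≤ Real.exp (a ^ θ) ^ p := by
          gcongr; rw [add_comm]; exact Real.add_one_le_exp _
      _ = Real.exp (p * a ^ θ) := by rw [← Real.exp_nat_mul]
      _ ≤ _ := by
        apply Real.exp_le_exp.2
        have h1 := mul_rpow_neg_le (p := p) hζ hξθ
        have h2 : 0 ≤ ζ ^ θ := by positivity
        nlinarith
  calc _ ≤ Real.exp (ζ * κ * β) * Real.exp ((1 / ζ + (ξ - 1)) * β) * Real.exp (c1 * κ * β) *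
        Real.exp (ζ ^ θ * β) := by gcongr
    _ = _ := by rw [← Real.exp_add, ← Real.exp_add, ← Real.exp_add]; ring_nf

end Forest

end

noncomputable section

namespace Forest

/-! ### The lower bound for the evidence -/

lemma exp_neg_le_mul {c r : ℝ} {n : ℕ} (hc : 0 < c) (hl : 1 ≤ Real.log n) (hr : 1 ≤ n * r) :
    Real.exp (-((|Real.log c| + 1) * Real.log n)) ≤ c * r := by
  have hn : (0 : ℝ) < n := by
    by_contra h
    rw [le_antisymm (not_lt.1 h) (Nat.cast_nonneg n), Real.log_zero] at hl
    linarith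
  have h1 : Real.exp (-Real.log n) ≤ r := by
    rw [Real.exp_neg, Real.exp_log hn, inv_le_iff_one_le_mul₀' hn]
    exact hr
  calc _ ≤ Real.exp (-|Real.log c| + -Real.log n) := by
        apply Real.exp_le_exp.2
        nlinarith [abs_nonneg (Real.log c)]
    _ = Real.exp (-|Real.log c|) * Real.exp (-Real.log n) := Real.exp_add _ _
    _ ≤ _ := mul_le_mul (exp_neg_abs_log_le hc) h1 (Real.exp_pos _).le hc.le

lemma integral_forest_sub_sq_le {p b T : ℕ} {Z : Fin b → Fin p → ℝ} {Q : Measure (Fin p → ℝ)}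
    [IsProbabilityMeasure Q] {f : (Fin p → ℝ) → ℝ} (hf : Measurable f) {U : ℝ}
    (hfb : ∀ᵐ x ∂Q, |f x| ≤ U) (E : Fin T → ZTree Z) {B β : Heights fun t => (E t).numLeaves}
    {δ C : ℝ} (hβ : ∀ t k, |β t k| ≤ C) (hB : ∀ t k, |B t k - β t k| ≤ δ) :
    ∫ x, (forest E B x - f x) ^ 2 ∂Q ≤
      2 * (T * δ) ^ 2 + 2 * ∫ x, (forest E β x - f x) ^ 2 ∂Q := by
  have hi : Integrable (fun x => (forest E β x - f x) ^ 2) Q := by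
    refine (memLp_sub_of_bounded (U := T * C + U) (measurable_forest E β) hf ?_).integrable_sq
    filter_upwards [hfb] with x hx
    exact (abs_sub _ _).trans (add_le_add (abs_forest_le E hβ x) hx)
  have e : 2 * (T * δ) ^ 2 + 2 * ∫ x, (forest E β x - f x) ^ 2 ∂Q =
      ∫ x, (2 * (T * δ) ^ 2 + 2 * (forest E β x - f x) ^ 2) ∂Q := by
    rw [integral_add (integrable_const _) (hi.const_mul 2)]
    simp [integral_const_mul]
  rw [e]
  refine integral_mono_of_nonneg (Eventually.of_forall fun x => sq_nonneg _)
    ((integrable_const _).add (hi.const_mul 2)) (Eventually.of_forall fun x => ?_)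
  have h1 := abs_forest_sub_le E hB x
  have h2 : (forest E B x - forest E β x) ^ 2 ≤ (T * δ) ^ 2 := by
    rw [← sq_abs]; exact pow_le_pow_left₀ (abs_nonneg _) h1 2
  have h3 : forest E B x - f x = (forest E B x - forest E β x) + (forest E β x - f x) := by ring
  simp only
  rw [h3]
  nlinarith [sq_nonneg ((forest E B x - forest E β x) - (forest E β x - f x))]

/-- Up to an event of small probability, the evidence is at least an exponentially small multiple
of the likelihood of the true parameter. -/
lemma exists_event_exp_neg_le_evidence {ν ζ ξ C CQ C₀' C₁ C₂ c : ℝ} (hν0 : 0 < ν)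
    (hν1 : ν ≤ 1 / 2) (hζ : 0 < ζ) (hξ : 1 < ξ) (hC : 0 < C) (hC₀' : 0 ≤ C₀') (hC₂ : 0 < C₂)
    (hc : 0 < c) (T : ℕ) :
    ∃ Y : ℝ, 0 ≤ Y ∧ ∀ {n p d R b A : ℕ} [NeZero p] {Z : Fin b → Fin p → ℝ} {S : Fin d ↪o Fin p}
      {α : Fin R → Fin d → ℝ} {lam abar r s0 : ℝ} {f : (Fin p → ℝ) → ℝ}
      {Q : Measure (Fin p → ℝ)} [IsProbabilityMeasure Q]
      {μB : (K : Fin (T + 1) → ℕ) → Measure (Heights K)} {μσ : Measure ℝ},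
      SplitNetApprox C n Z S α lam abar f → HasBoundedDensity CQ Q → Measurable f →
      (∀ x ∈ cube p, |f x| ≤ C₀') → 0 < lam → 0 < abar → 1 ≤ Real.log n →
      approxRate n d R lam abar ≤ r → 0 < r → r ≤ 1 → C₀' + r ≤ C₁ → C₂⁻¹ ≤ s0 → s0 + r ≤ C₂ →
      Real.log n ≤ n * r ^ 2 → d * Real.log p ≤ n * r ^ 2 →
      (∀ j, (coordSet Z j).card ≤ A) → 0 < A →
      2 * (A : ℝ) ≤ Real.exp ((C + 2) * Real.log n) →
      IsTruncatedHeightPrior C₁ c μB → IsTruncatedVariancePrior C₂ c μσ →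
      ∃ G : Set (Fin n → (Fin p → ℝ) × ℝ), MeasurableSet G ∧
        (Measure.pi fun _ : Fin n => obsLaw Q f s0) G ≤ ENNReal.ofReal (Real.exp (-(n * r ^ 2))) ∧
        ∀ D ∉ G, ENNReal.ofReal (Real.exp (-(Y * (n * r ^ 2)))) * likelihood D f s0 ≤
          evidence Z ν ζ ξ μB μσ D Set.univ := by
  obtain ⟨Y, hY0, hY⟩ := exists_exp_neg_le_ensembleProb hν0 hν1 hζ hξ hC T
  set U := (T + 1 : ℕ) * C₁ + C₀' with hU
  set Ca := 2 * ((T + 1 : ℕ) : ℝ) ^ 2 + 2 * (|CQ| * C ^ 2) with hCa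
  set κ := Real.exp (C₂ * U ^ 2) * C₂ * Ca + C₂ ^ 2 with hκ
  have hκ0 : 0 ≤ κ := by positivity
  set g := |Real.log c| + 1 with hg
  have hg0 : 0 ≤ g := by positivity
  refine ⟨Y + (κ + 1) + g + g * (C + T), by positivity, ?_⟩
  clear_value U Ca κ g
  intro n p d R b A _ Z S α lam abar r s0 f Q _ μB μσ hZ hQ hf hfb hlam habar hl har hr hr1 hrC hs0
    hs0C hlβ hdp hA hA0 hAl hμB hμσ
  have hn : (0 : ℝ) < n := by
    by_contra h
    rw [le_antisymm (not_lt.1 h) (Nat.cast_nonneg n), Real.log_zero] at hl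
    linarith
  have hr2 : r ^ 2 ≤ r := by nlinarith
  set β := n * r ^ 2 with hβ
  have hβ1 : 1 ≤ β := hl.trans hlβ
  have hβn : β ≤ n := mul_le_of_le_one_right hn.le (hr2.trans hr1)
  have hnr : 1 ≤ n * r := hβ1.trans (mul_le_mul_of_nonneg_left hr2 hn.le)
  clear_value β
  obtain ⟨E, B, H, L, hB, hv, hH, hHL, hL0, hR0, -, htot, hused, hsize, happ⟩ :=
    hZ.exists_ensemble (T := T) hQ hf hC₀' hfb (by exact_mod_cast hn) hlam habar (by linarith)
  have har0 := approxRate_nonneg n d R abar hlam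
  have hab : approxRate n d R lam abar ^ 2 ≤ r ^ 2 := pow_le_pow_left₀ har0 har 2
  have hsize' : (R * 2 ^ L) * Real.log n ≤ C * β :=
    hsize.trans (mul_le_mul_of_nonneg_left
      (hβ ▸ mul_le_mul_of_nonneg_left hab hn.le) hC.le)
  obtain ⟨hKl, hw⟩ := hY E hl hlβ hβn hdp hA hA0 hAl hv hH hHL hL0 hR0 htot hused hsize'
  have hpB : ∀ K, IsProbabilityMeasure (μB K) := fun K => (hμB K).1
  have hpσ : IsProbabilityMeasure μσ := hμσ.1
  have hfb' : ∀ᵐ x ∂Q, |f x| ≤ C₀' := (ae_mem_cube hQ).mono fun x hx => hfb x hx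
  have hUb : ∀ B' : Heights fun t => (E t).numLeaves, (∀ t k, |B' t k - B t k| ≤ r) →
      ∀ᵐ x ∂Q, |forest E B' x - f x| ≤ U := by
    intro B' hB'
    filter_upwards [hfb'] with x hx
    rw [hU]
    refine (abs_sub _ _).trans (add_le_add (abs_forest_le E (C := C₁) (fun t k => ?_) x) hx)
    have h1 := abs_sub_abs_le_abs_sub (B' t k) (B t k)
    linarith [hB' t k, hB t k]
  have hint : ∀ B' : Heights fun t => (E t).numLeaves, (∀ t k, |B' t k - B t k| ≤ r) →
      ∫ x, (forest E B' x - f x) ^ 2 ∂Q ≤ Ca * r ^ 2 := by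
    intro B' hB'
    refine (integral_forest_sub_sq_le hf hfb' E hB hB').trans ?_
    have h1 : |CQ| * (C * approxRate n d R lam abar) ^ 2 ≤ |CQ| * C ^ 2 * r ^ 2 := by
      rw [mul_pow, ← mul_assoc]; gcongr
    rw [hCa, mul_pow]
    linarith
  obtain ⟨G, hG, hPG, hev⟩ := exists_event_evidence_ge (n := n) (ν := ν) (ζ := ζ) (ξ := ξ) (Q := Q)
    hf E hc hμB hμσ hC₂ B
    hr hr (fun t k => by linarith [hB t k]) hs0 hs0C hUb hint
    (Real.exp_pos (-((κ + 1) * β)))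
  refine ⟨G, hG, hPG.trans (le_of_eq ?_), fun D hD => le_trans ?_ (hev D hD)⟩
  · rw [← Real.exp_add, hβ, hκ]; congr 2; ring
  · refine mul_le_mul_left ?_ _
    have e : Real.exp (-((Y + (κ + 1) + g + g * (C + T)) * β)) =
        Real.exp (-(Y * β)) * (Real.exp (-((κ + 1) * β)) * (Real.exp (-(g * β)) *
          Real.exp (-(g * (C + T) * β)))) := by
      rw [← Real.exp_add, ← Real.exp_add, ← Real.exp_add]; ring_nf
    rw [e, ENNReal.ofReal_mul (Real.exp_pos _).le]
    refine mul_le_mul' hw (ENNReal.ofReal_le_ofReal ?_)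
    have h1 : Real.exp (-(g * Real.log n)) ≤ c * r := by
      rw [hg]; exact exp_neg_le_mul hc hl hnr
    have h2 : Real.exp (-(g * β)) ≤ c * r :=
      (Real.exp_le_exp.2 (neg_le_neg (mul_le_mul_of_nonneg_left hlβ hg0))).trans h1
    have h3 : Real.exp (-(g * (C + T) * β)) ≤ (c * (2 * r)) ^ totalLeaves E :=
      exp_neg_le_pow hg0 (h1.trans (by linarith [mul_pos hc hr])) hKl
    gcongr

end Forest

end

noncomputable section

namespace Forest

/-! ### Posterior contraction for a fixed sample size -/

lemma ofReal_exp_mul (a b : ℝ) : ENNReal.ofReal (Real.exp a) * ENNReal.ofReal (Real.exp b) =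
    ENNReal.ofReal (Real.exp (a + b)) := by
  rw [← ENNReal.ofReal_mul (Real.exp_pos _).le, Real.exp_add]

lemma ofReal_exp_div (x : ℝ≥0∞) (b : ℝ) : x / ENNReal.ofReal (Real.exp b) =
    x * ENNReal.ofReal (Real.exp (-b)) := by
  rw [Real.exp_neg, ENNReal.ofReal_inv_of_pos (Real.exp_pos _), div_eq_mul_inv]

lemma ofReal_exp_rpow (a t : ℝ) :
    ENNReal.ofReal (Real.exp a) ^ t = ENNReal.ofReal (Real.exp (a * t)) := by
  rw [ENNReal.ofReal_rpow_of_pos (Real.exp_pos _), Real.exp_mul]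

lemma natCeil_div_le {C δ : ℝ} {n : ℕ} (hC : 0 ≤ C) (hδ : 0 < δ) (h : 1 ≤ n * δ) :
    (⌈C / δ⌉₊ : ℝ) ≤ C * n + 1 := by
  refine (Nat.ceil_lt_add_one (by positivity)).le.trans (add_le_add_left ?_ 1)
  rw [div_le_iff₀ hδ, mul_assoc]
  exact le_mul_of_one_le_right hC h

lemma affine_le_exp_log {C : ℝ} {n : ℕ} (hC : 1 ≤ C) (hl : 1 ≤ Real.log n) :
    C * n ≤ Real.exp ((Real.log C + 1) * Real.log n) := by
  have hn : (0 : ℝ) < n := by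
    by_contra h
    rw [le_antisymm (not_lt.1 h) (Nat.cast_nonneg n), Real.log_zero] at hl
    linarith
  have h0 : 0 < C := by linarith
  calc C * n = Real.exp (Real.log C + Real.log n) := by
        rw [Real.exp_add, Real.exp_log h0, Real.exp_log hn]
    _ ≤ _ := by
        apply Real.exp_le_exp.2
        nlinarith [Real.log_nonneg hC]

/-- The number of grid points is at most exponentially large. -/
lemma exists_gridSize_le {C C' : ℝ} (hC : 0 ≤ C) (hC' : 0 ≤ C') (κ : ℝ) :
    ∃ W : ℝ, ∀ {n K N : ℕ} {δ β : ℝ}, 1 ≤ Real.log n → Real.log n ≤ β → 0 < δ → 1 ≤ n * δ →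
      N ≤ K → K * Real.log n ≤ κ * β →
      (((2 * ⌈C / δ⌉₊ + 1) ^ N * (⌈C' / δ⌉₊ + 1) : ℕ) : ℝ≥0∞) ≤
        ENNReal.ofReal (Real.exp (W * β)) := by
  refine ⟨(Real.log (2 * C + 3) + 1) * κ + (Real.log (C' + 2) + 1), ?_⟩
  intro n K N δ β hl hlβ hδ hnδ hNK hK
  have hn1 : (1 : ℝ) ≤ n := by
    by_contra h
    have : Real.log n ≤ 0 := Real.log_nonpos (Nat.cast_nonneg n) (not_le.1 h).le
    linarith
  have h1 : (((2 * ⌈C / δ⌉₊ + 1 : ℕ)) : ℝ) ≤ (2 * C + 3) * n := by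
    have := natCeil_div_le hC hδ hnδ
    push_cast; nlinarith
  have h2 : (((⌈C' / δ⌉₊ + 1 : ℕ)) : ℝ) ≤ (C' + 2) * n := by
    have := natCeil_div_le hC' hδ hnδ
    push_cast; nlinarith
  have hc : 0 ≤ Real.log (2 * C + 3) := Real.log_nonneg (by linarith)
  have hc' : 0 ≤ Real.log (C' + 2) := Real.log_nonneg (by linarith)
  have h3 : (((2 * ⌈C / δ⌉₊ + 1 : ℕ)) : ℝ) ^ N ≤
      Real.exp ((Real.log (2 * C + 3) + 1) * κ * β) := by
    refine pow_le_exp (Nat.cast_nonneg _) (by linarith)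
      (h1.trans (affine_le_exp_log (by linarith) hl)) (le_trans ?_ hK)
    have : (N : ℝ) ≤ K := by exact_mod_cast hNK
    gcongr
  have h4 : (((⌈C' / δ⌉₊ + 1 : ℕ)) : ℝ) ≤ Real.exp ((Real.log (C' + 2) + 1) * β) :=
    (h2.trans (affine_le_exp_log (by linarith) hl)).trans (Real.exp_le_exp.2 (by gcongr))
  rw [← ENNReal.ofReal_natCast]
  apply ENNReal.ofReal_le_ofReal
  rw [add_mul, Real.exp_add, Nat.cast_mul, Nat.cast_pow]
  gcongr

lemma exists_card_coordSet_le {p b : ℕ} {Z : Fin b → Fin p → ℝ} {C l : ℝ} (hC : 0 < C)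
    (hl : 1 ≤ l) (h : ∀ j, Real.log (coordSet Z j).card ≤ C * l) :
    ∃ A : ℕ, (∀ j, (coordSet Z j).card ≤ A) ∧ 0 < A ∧ 2 * (A : ℝ) ≤ Real.exp ((C + 2) * l) := by
  refine ⟨⌈Real.exp (C * l)⌉₊, fun j => ?_, Nat.ceil_pos.2 (Real.exp_pos _), ?_⟩
  · rcases Nat.eq_zero_or_pos (coordSet Z j).card with h0 | h0
    · rw [h0]; exact Nat.zero_le _
    · have h1 : ((coordSet Z j).card : ℝ) ≤ Real.exp (C * l) := by
        rw [← Real.exp_log (by exact_mod_cast h0 : (0 : ℝ) < (coordSet Z j).card)]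
        exact Real.exp_le_exp.2 (h j)
      exact_mod_cast h1.trans (Nat.le_ceil _)
  · have h1 : (⌈Real.exp (C * l)⌉₊ : ℝ) < Real.exp (C * l) + 1 :=
      Nat.ceil_lt_add_one (Real.exp_pos _).le
    have h2 : 1 ≤ Real.exp (C * l) := Real.one_le_exp (by positivity)
    have h3 : 2 ≤ Real.exp l := by linarith [Real.add_one_le_exp l]
    have h4 : Real.exp ((C + 2) * l) = Real.exp l * Real.exp l * Real.exp (C * l) := by
      rw [← Real.exp_add, ← Real.exp_add]; ring_nf
    have h5 : 4 ≤ Real.exp l * Real.exp l := by nlinarith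
    rw [h4]
    nlinarith

lemma min_one_div_le {w x y L F : ℝ≥0∞} (hL0 : L ≠ 0) (hL : L ≠ ⊤) (h : x ≤ F * L) :
    min 1 (w * x / (y * L)) ≤ w * F / y := by
  refine (min_le_right _ _).trans ?_
  calc w * x / (y * L) ≤ w * (F * L) / (y * L) := by gcongr
    _ = w * F / y := by rw [← mul_assoc, ENNReal.mul_div_mul_right _ _ hL0 hL]

/-- The expected posterior probability of the complement of a ball with radius of the order of
the contraction rate is exponentially small. -/
lemma exists_lintegral_posterior_le {ν ζ ξ C CQ C₀' C₁ C₂ c c0 : ℝ} (hν0 : 0 < ν)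
    (hν1 : ν ≤ 1 / 2) (hζ : 0 < ζ) (hξ : 1 < ξ) (hC : 0 < C) (hC₀' : 0 ≤ C₀') (hC₁ : 0 ≤ C₁)
    (hC₂ : 0 < C₂) (hc : 0 < c) (hc0 : 0 < c0) (T : ℕ) :
    ∃ M : ℝ, 0 < M ∧ ∀ {n p d R b : ℕ} [NeZero p] {Z : Fin b → Fin p → ℝ} {S : Fin d ↪o Fin p}
      {α : Fin R → Fin d → ℝ} {lam abar r s0 : ℝ} {f : (Fin p → ℝ) → ℝ}
      {Q : Measure (Fin p → ℝ)} [IsProbabilityMeasure Q]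
      {μB : (K : Fin (T + 1) → ℕ) → Measure (Heights K)} {μσ : Measure ℝ},
      SplitNetApprox C n Z S α lam abar f → HasBoundedDensity CQ Q → Measurable f →
      (∀ x ∈ cube p, |f x| ≤ C₀') → 0 < lam → 0 < abar → 0 < d → 1 ≤ Real.log n →
      approxRate n d R lam abar ≤ r → 0 < r → r ≤ 1 → C₀' + r ≤ C₁ → C₂⁻¹ ≤ s0 → s0 + r ≤ C₂ →
      d * Real.log p ≤ n * r ^ 2 → (∀ j, Real.log (coordSet Z j).card ≤ C * Real.log n) →
      10 ≤ c0 * Real.log n → 4 * (T + 1 : ℕ) * Real.log n ≤ Real.exp (c0 / 2 * Real.log n) →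
      Real.log n ≤ n * r ^ 2 → Real.exp (c0 * Real.log n) ≤ n * r ^ 2 →
      IsTruncatedHeightPrior C₁ c μB → IsTruncatedVariancePrior C₂ c μσ →
      ∫⁻ D, posterior Z ν ζ ξ μB μσ D {θ | ENNReal.ofReal (M * r) <
          eLpNorm (fun x => θ.1 x - f x) 2 Q + ENNReal.ofReal |θ.2 - s0|}
        ∂(Measure.pi fun _ : Fin n => obsLaw Q f s0) ≤
        3 * ENNReal.ofReal (Real.exp (-(n * r ^ 2))) := by
  obtain ⟨Y, hY0, hY⟩ := exists_event_exp_neg_le_evidence (CQ := CQ) (C₁ := C₁) hν0 hν1 hζ hξ hC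
    hC₀' hC₂ hc T
  obtain ⟨K', hK'⟩ : ∃ K' : ℝ, K' = max 1 ((Y + 1) * 16 / c0) := ⟨_, rfl⟩
  have hK'1 : 1 ≤ K' := hK' ▸ le_max_left _ _
  have hK'c : (Y + 1) * 16 ≤ K' * c0 := by
    rw [← div_le_iff₀ hc0, hK']; exact le_max_right _ _
  obtain ⟨θ, hθ⟩ : ∃ θ : ℝ, θ = max (1 / 2) (1 / ξ) := ⟨_, rfl⟩
  have hθ2 : 1 / 2 ≤ θ := hθ ▸ le_max_left _ _
  have hθ0 : 0 < θ := by linarith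
  have hθ1 : θ < 1 := by
    rw [hθ]; exact max_lt (by norm_num) ((div_lt_one (by linarith)).2 hξ)
  have hξθ : 1 ≤ ξ * θ := by
    have : 1 / ξ ≤ θ := hθ ▸ le_max_right _ _
    rwa [div_le_iff₀' (by linarith)] at this
  obtain ⟨V, hV⟩ := exists_tsum_ensembleProb_rpow_le (κ := K' + 1) hν0 hν1 hζ hξ hC
    (by linarith) hθ0 hθ1.le hξθ
  obtain ⟨W, hW⟩ := exists_gridSize_le (C' := C₂ * (1 + (T + 1 : ℕ))) hC₁ (by positivity) (K' + 1)
  obtain ⟨h, hh⟩ : ∃ h : ℝ, h = hellingerConst ((T + 1 : ℕ) * (C₁ + 1) + C₀')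
    (C₂ * (1 + (T + 1 : ℕ)) + 1) := ⟨_, rfl⟩
  have hh0 : 0 < h := hh ▸ hellingerConst_pos _ (by positivity)
  obtain ⟨c6, hc6⟩ : ∃ c6 : ℝ, c6 = (T + 1 : ℕ) + C₂ + (T + 1 : ℕ) * C₂ := ⟨_, rfl⟩
  obtain ⟨M1, hM10, hM1⟩ : ∃ M1 : ℝ, 0 ≤ M1 ∧
      V + W + θ * (c6 + Y) + 1 ≤ 2 * (1 - θ) * (h * M1 ^ 2) := by
    have h1 : 0 < 2 * (1 - θ) * h := by have : 0 < 1 - θ := by linarith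
                                        positivity
    refine ⟨√(|V + W + θ * (c6 + Y) + 1| / (2 * (1 - θ) * h)), Real.sqrt_nonneg _, ?_⟩
    rw [Real.sq_sqrt (by positivity), ← mul_assoc, mul_div_cancel₀ _ h1.ne']
    exact le_abs_self _
  refine ⟨M1 + ((T + 1 : ℕ) + C₂ * (T + 1 : ℕ) + 1), by positivity, ?_⟩
  intro n p d R b _ Z S α lam abar r s0 f Q _ μB μσ hZ hQ hf hfb hlam habar hd hl har hr hr1 hrC
    hs0 hs0C hdp hcard hcl hTl hlβ hβc hμB hμσ
  obtain ⟨A, hA, hA0, hAl⟩ := exists_card_coordSet_le hC hl hcard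
  obtain ⟨G, hG, hPG, hev⟩ := hY hZ hQ hf hfb hlam habar hl har hr hr1 hrC hs0 hs0C hlβ hdp hA hA0
    hAl hμB hμσ
  have hn : (0 : ℝ) < n := by
    by_contra h
    rw [le_antisymm (not_lt.1 h) (Nat.cast_nonneg n), Real.log_zero] at hl
    linarith
  have hr2 : r ^ 2 ≤ r := by nlinarith
  have hs00 : 0 < s0 := (inv_pos.2 hC₂).trans_le hs0
  obtain ⟨β, hβ⟩ : ∃ β : ℝ, β = n * r ^ 2 := ⟨_, rfl⟩
  rw [← hβ] at hPG hev hdp hlβ hβc ⊢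
  have hβ1 : 1 ≤ β := hl.trans hlβ
  have hβn : β ≤ n := hβ ▸ mul_le_of_le_one_right hn.le (hr2.trans hr1)
  have hlog0 : 0 < Real.log n := by linarith
  have hpβ : Real.log p ≤ β :=
    (le_mul_of_one_le_left (Real.log_natCast_nonneg p) (by exact_mod_cast hd)).trans hdp
  obtain ⟨K, hK⟩ : ∃ K : ℕ, K = ⌈K' * β / Real.log n⌉₊ := ⟨_, rfl⟩
  have hK0 : 0 < K := hK ▸ Nat.ceil_pos.2 (by positivity)
  have hKge : K' * β ≤ K * Real.log n := by
    rw [← div_le_iff₀ hlog0, hK]; exact Nat.le_ceil _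
  have hKle : K * Real.log n ≤ (K' + 1) * β := by
    have h1 : (K : ℝ) ≤ K' * β / Real.log n + 1 := by
      rw [hK]; exact (Nat.ceil_lt_add_one (by positivity)).le
    have h2 := mul_le_mul_of_nonneg_right h1 hlog0.le
    rw [add_mul, div_mul_cancel₀ _ hlog0.ne'] at h2
    linarith
  have hpB : ∀ K, IsProbabilityMeasure (μB K) := fun K => (hμB K).1
  have hpσ : IsProbabilityMeasure μσ := hμσ.1
  have hfb' : ∀ᵐ x ∂Q, |f x| ≤ C₀' := (ae_mem_cube hQ).mono fun x hx => hfb x hx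
  have hpos : ∀ᵐ s ∂μσ, 0 < s :=
    (ae_mem_Icc_variancePrior hμσ).mono fun s hs => (inv_pos.2 hC₂).trans_le hs.1
  set 𝒜 := {θ : ((Fin p → ℝ) → ℝ) × ℝ | ENNReal.ofReal
    ((M1 + ((T + 1 : ℕ) + C₂ * (T + 1 : ℕ) + 1)) * r) <
      eLpNorm (fun x => θ.1 x - f x) 2 Q + ENNReal.ofReal |θ.2 - s0|} with h𝒜
  have hF : ∀ E : Fin (T + 1) → ZTree Z, ∃ F : (Fin n → (Fin p → ℝ) × ℝ) → ℝ≥0∞, Measurable F ∧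
      (∀ D, min 1 (ensembleProb Z ν ζ ξ E * ensembleEvidence μB μσ D 𝒜 E /
        (ENNReal.ofReal (Real.exp (-(Y * β))) * likelihood D f s0)) ≤ F D) ∧
      ∫⁻ D, F D ∂(Measure.pi fun _ : Fin n => obsLaw Q f s0) ≤
        (if totalLeaves E ≤ K then ensembleProb Z ν ζ ξ E ^ θ else 0) *
          ENNReal.ofReal (Real.exp (-((V + 1) * β))) +
        (if K < totalLeaves E then ensembleProb Z ν ζ ξ E else 0) *
          ENNReal.ofReal (Real.exp (Y * β)) := by
    intro E
    by_cases hE : totalLeaves E ≤ K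
    · obtain ⟨F, hFm, hFle, hFint⟩ := exists_majorant_ensembleEvidence (n := n) (Q := Q) (δ := r ^ 2)
        (M := (M1 + ((T + 1 : ℕ) + C₂ * (T + 1 : ℕ) + 1)) * r) (r := M1 * r)
        (Nat.succ_pos T) hf hfb' hC₂ (by positivity) (hr2.trans hr1) hs00 (by linarith) rfl rfl
        hμB hμσ (by positivity)
        (by rw [add_mul M1]
            exact add_le_add_right (mul_le_mul_of_nonneg_left hr2
              (by positivity : (0 : ℝ) ≤ (T + 1 : ℕ) + C₂ * (T + 1 : ℕ) + 1)) _) E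
        (y := ENNReal.ofReal (Real.exp (-(Y * β)))) (w := ensembleProb Z ν ζ ξ E) hθ2 hθ1.le
      refine ⟨F, hFm, hFle, hFint.trans ?_⟩
      rw [if_pos hE, if_neg (not_lt.2 hE), zero_mul, add_zero, ← hh]
      have e1 : (n : ℝ) * (((T + 1 : ℕ) + C₂ + (T + 1 : ℕ) * C₂) * r ^ 2) = c6 * β := by
        rw [hc6, hβ]; ring
      have e2 : -((n : ℝ) * (h * (M1 * r) ^ 2)) = -(h * M1 ^ 2 * β) := by rw [hβ]; ring
      rw [e1, e2, ofReal_exp_div, mul_assoc, ofReal_exp_mul, ENNReal.mul_rpow_of_nonneg _ _ hθ0.le,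
        ofReal_exp_rpow, ofReal_exp_rpow]
      refine (mul_le_mul_left (hW hl hlβ (by positivity) (by rwa [← hβ]) hE hKle) _).trans ?_
      rw [mul_assoc (_ ^ θ), ofReal_exp_mul, mul_left_comm, ofReal_exp_mul]
      refine mul_le_mul_right (ENNReal.ofReal_le_ofReal (Real.exp_le_exp.2 ?_)) _
      have := mul_le_mul_of_nonneg_right hM1 (by linarith : 0 ≤ β)
      linarith
    · obtain ⟨F, hFm, hFle, hFint⟩ := lintegral_ensembleEvidence_le (n := n) (Q := Q) (μB := μB) hf
        hs00 hpos E 𝒜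
      refine ⟨fun D => ensembleProb Z ν ζ ξ E * F D / ENNReal.ofReal (Real.exp (-(Y * β))),
        (hFm.const_mul _).div_const _,
        fun D => min_one_div_le (likelihood_ne_zero hs00 D) (likelihood_ne_top D) (hFle D), ?_⟩
      rw [if_neg hE, if_pos (not_le.1 hE), zero_mul, zero_add]
      simp_rw [ofReal_exp_div, neg_neg]
      rw [lintegral_mul_const _ (hFm.const_mul _), lintegral_const_mul _ hFm]
      gcongr
      exact (mul_le_mul_right hFint _).trans (mul_one _).le
  choose F hFm hFle hFint using hF
  refine (lintegral_posterior_le _ 𝒜 hG _ hev F hFm hFle).trans ?_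
  have hpζ : 0 < ζ / (p : ℝ) ^ ξ := by
    have : (0 : ℝ) < p := by exact_mod_cast Nat.pos_of_ne_zero (NeZero.ne p)
    positivity
  have s1 := hV (T := T + 1) (Z := Z) hl hlβ hβn hpβ hA hA0 hAl hK0 hKle
  have s2 := tsum_ensembleProb_tail_le_exp (T := T + 1) (Z := Z) hν0 hν1 hpζ hc0 hcl hlog0 hK'1
    hK'c hKge hTl hβc
  calc _ ≤ ENNReal.ofReal (Real.exp (-β)) + (ENNReal.ofReal (Real.exp (-β)) +
        ENNReal.ofReal (Real.exp (-β))) := by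
        refine add_le_add hPG ((ENNReal.tsum_le_tsum hFint).trans ?_)
        rw [ENNReal.tsum_add, ENNReal.tsum_mul_right, ENNReal.tsum_mul_right]
        refine add_le_add ((mul_le_mul_left s1 _).trans_eq ?_) ((mul_le_mul_left s2 _).trans_eq ?_)
        · rw [ofReal_exp_mul]; ring_nf
        · rw [ofReal_exp_mul]; ring_nf
    _ = 3 * ENNReal.ofReal (Real.exp (-β)) := by ring

end Forest

end

open Forest in
theorem mainTheorem4
    -- dimensions, active coordinates, function class and true function, all depending on `n`
    (p d R : ℕ → ℕ) (hd : ∀ n, 0 < d n)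
    (S : ∀ n, Fin (d n) ↪o Fin (p n))
    (lam abar : ℕ → ℝ) (hlam : ∀ n, 0 < lam n) (habar : ∀ n, 0 < abar n ∧ abar n ≤ 1)
    (a : ℝ) (ha : a < 1 / 2) (hlam_low : ∀ᶠ n : ℕ in atTop, (n : ℝ) ^ (-a) ≤ lam n)
    (α : ∀ n, Fin (R n) → Fin (d n) → ℝ) (hα : ∀ n, α n ∈ SmoothnessTuples (R n) (d n) (abar n))
    (Ξ : ∀ n, Fin (R n) → Set (Fin (d n) → ℝ)) (hΞ : ∀ n, IsBoxPartition (Ξ n))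
    (f₀ : ∀ n, (Fin (p n) → ℝ) → ℝ) (hf₀_meas : ∀ n, Measurable (f₀ n))
    (hf₀ : ∀ n, SparseHolder (lam n) (α n) (Ξ n) (S n) (f₀ n))
    (hrate : Tendsto (fun n => rate n (p n) (d n) (R n) (lam n) (abar n)) atTop (𝓝 0))
    (C₀' : ℝ) (hC₀' : 0 < C₀') (hf₀_bdd : ∀ n, ∀ x ∈ cube (p n), |f₀ n x| ≤ C₀')
    (C₀ : ℝ) (hC₀ : 1 < C₀) (σ₀sq : ℕ → ℝ) (hσ₀ : ∀ n, σ₀sq n ∈ Set.Icc C₀⁻¹ C₀)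
    -- random design with bounded density
    (Q : ∀ n, Measure (Fin (p n) → ℝ)) (hQ : ∀ n, IsProbabilityMeasure (Q n))
    (CQ : ℝ) (hQ_dens : ∀ n, HasBoundedDensity CQ (Q n))
    -- split-net
    (b : ℕ → ℕ) (Z : ∀ n, Fin (b n) → Fin (p n) → ℝ) (hZ : ∀ n i, Z n i ∈ cube (p n))
    (CZ : ℝ)
    (hZ_card : ∀ᶠ n : ℕ in atTop, ∀ j,
      Real.log ((coordSet (Z n) j).card) ≤ CZ * Real.log n)
    (hZ_approx : ∀ᶠ n : ℕ in atTop,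
      SplitNetApprox CZ n (Z n) (S n) (α n) (lam n) (abar n) (f₀ n))
    -- prior
    (T : ℕ) (hT : 0 < T) (ν ζ ξ : ℝ) (hν : 0 < ν ∧ ν < 1 / 2) (hζ : 0 < ζ) (hξ : 1 < ξ)
    (C₁ C₂ c : ℝ) (hC₁ : C₀' < C₁) (hC₂ : C₀ < C₂) (hc : 0 < c)
    (μB : ℕ → (K : Fin T → ℕ) → Measure (Heights K))
    (hμB : ∀ n, IsTruncatedHeightPrior C₁ c (μB n))
    (μσ : ℕ → Measure ℝ) (hμσ : ∀ n, IsTruncatedVariancePrior C₂ c (μσ n)) :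
    ∃ M : ℝ, 0 < M ∧
      Tendsto
        (fun n : ℕ =>
          ∫⁻ D, posterior (Z n) ν ζ ξ (μB n) (μσ n) D
              {θ | ENNReal.ofReal (M * rate n (p n) (d n) (R n) (lam n) (abar n)) <
                eLpNorm (fun x => θ.1 x - f₀ n x) 2 (Q n) + ENNReal.ofReal |θ.2 - σ₀sq n|}
            ∂(Measure.pi fun _ : Fin n => obsLaw (Q n) (f₀ n) (σ₀sq n)))
        atTop (𝓝 0) := by
  obtain ⟨T, rfl⟩ := Nat.exists_eq_succ_of_ne_zero hT.ne'
  have hCZ : 0 < CZ := by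
    obtain ⟨n, h, hl⟩ := (hZ_approx.and
      ((Real.tendsto_log_atTop.comp tendsto_natCast_atTop_atTop).eventually_ge_atTop 1)).exists
    have hl' : (1 : ℝ) ≤ Real.log n := hl
    have hn : 0 < n := by
      rcases Nat.eq_zero_or_pos n with rfl | h0
      · norm_num at hl'
      · exact h0
    obtain ⟨-, -, -, -, -, -, -, -, -, -, hC, -⟩ := h.exists_ensemble (T := 0) (hQ_dens n)
      (hf₀_meas n) hC₀'.le (hf₀_bdd n) hn (hlam n) (habar n).1 (by linarith)
    exact hC
  have hc0 : 0 < (1 - 2 * a) / 3 := by linarith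
  obtain ⟨M, hM, hpost⟩ := exists_lintegral_posterior_le (CQ := CQ) hν.1 hν.2.le hζ hξ hCZ hC₀'.le
    (hC₀'.le.trans hC₁.le) (by linarith : 0 < C₂) hc hc0 T
  refine ⟨M, hM, ?_⟩
  have hlog : Tendsto (fun n : ℕ => Real.log n) atTop atTop :=
    Real.tendsto_log_atTop.comp tendsto_natCast_atTop_atTop
  have hβlow : ∀ᶠ n : ℕ in atTop, Real.exp ((1 - 2 * a) / 3 * Real.log n) ≤
      n * rate n (p n) (d n) (R n) (lam n) (abar n) ^ 2 := by
    filter_upwards [hlog.eventually_ge_atTop 1, hlam_low, hZ_approx, eventually_gt_atTop 0]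
      with n hl hlow h hn
    obtain ⟨-, -, -, -, -, -, -, -, -, hR, -⟩ := h.exists_ensemble (T := 0) (hQ_dens n)
      (hf₀_meas n) hC₀'.le (hf₀_bdd n) hn (hlam n) (habar n).1 (by linarith)
    have h1 := rpow_le_natCast_mul_approxRate_sq hn (hd n) hR ha hlow (habar n).1 (habar n).2 hl
    rw [Real.rpow_def_of_pos (by exact_mod_cast hn), mul_comm (Real.log _)] at h1
    refine h1.trans ?_
    have := approxRate_nonneg n (d n) (R n) (abar n) (hlam n)
    have := approxRate_le_rate n (p n) (d n) (R n) (lam n) (abar n)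
    gcongr
  have hexp : ∀ᶠ x : ℝ in atTop, 4 * (T + 1 : ℕ) * x ≤ Real.exp ((1 - 2 * a) / 3 / 2 * x) := by
    have h := (isLittleO_pow_exp_pos_mul_atTop (k := 1) (half_pos hc0)).bound
      (show (0 : ℝ) < 1 / (4 * (T + 1 : ℕ)) by positivity)
    filter_upwards [h] with x hx
    rw [pow_one, Real.norm_eq_abs, Real.norm_eq_abs, abs_of_pos (Real.exp_pos _), div_mul_eq_mul_div,
      one_mul, le_div_iff₀ (by positivity)] at hx
    nlinarith [le_abs_self x, mul_le_mul_of_nonneg_right (le_abs_self x)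
      (by positivity : (0 : ℝ) ≤ 4 * (T + 1 : ℕ))]
  have hexp1 : ∀ᶠ x : ℝ in atTop, x ≤ Real.exp ((1 - 2 * a) / 3 * x) := by
    have h := (isLittleO_pow_exp_pos_mul_atTop (k := 1) hc0).bound one_pos
    filter_upwards [h] with x hx
    rw [pow_one, Real.norm_eq_abs, Real.norm_eq_abs, abs_of_pos (Real.exp_pos _), one_mul] at hx
    exact (le_abs_self x).trans hx
  have hlim : Tendsto (fun n : ℕ => 3 * ENNReal.ofReal (Real.exp
      (-(n * rate n (p n) (d n) (R n) (lam n) (abar n) ^ 2)))) atTop (𝓝 0) := by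
    have h1 : Tendsto (fun n : ℕ => n * rate n (p n) (d n) (R n) (lam n) (abar n) ^ 2)
        atTop atTop :=
      tendsto_atTop_mono' _ hβlow
        (Real.tendsto_exp_atTop.comp (hlog.const_mul_atTop hc0))
    have h2 := ENNReal.tendsto_ofReal (Real.tendsto_exp_neg_atTop_nhds_zero.comp h1)
    rw [ENNReal.ofReal_zero] at h2
    simpa using ENNReal.Tendsto.const_mul h2 (Or.inr (ENNReal.ofNat_ne_top (n := 3)))
  refine tendsto_of_tendsto_of_tendsto_of_le_of_le' tendsto_const_nhds hlim
    (Eventually.of_forall fun _ => zero_le) ?_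
  filter_upwards [hlog.eventually_ge_atTop 1, hlog.eventually_ge_atTop (10 / ((1 - 2 * a) / 3)),
    hlog.eventually hexp, hlog.eventually hexp1, hβlow, hZ_card, hZ_approx, eventually_gt_atTop 0,
    hrate.eventually_le_const (show (0 : ℝ) < 1 by norm_num),
    hrate.eventually_le_const (sub_pos.2 hC₁), hrate.eventually_le_const (sub_pos.2 hC₂)]
    with n hl hl10 hx hx1 hβ hcard happ hn hr1 hrC hrC₂
  have hp : NeZero (p n) := ⟨fun h => by
    have := S n ⟨0, hd n⟩
    rw [h] at this
    exact this.elim0⟩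
  have hQn := hQ n
  have hr0 : 0 < rate n (p n) (d n) (R n) (lam n) (abar n) := by
    have h0 : 0 ≤ rate n (p n) (d n) (R n) (lam n) (abar n) :=
      (approxRate_nonneg n (d n) (R n) (abar n) (hlam n)).trans (approxRate_le_rate ..)
    refine lt_of_le_of_ne h0 fun h => ?_
    rw [← h] at hβ
    have := Real.exp_pos ((1 - 2 * a) / 3 * Real.log n)
    norm_num at hβ
    linarith
  exact hpost happ (hQ_dens n) (hf₀_meas n) (hf₀_bdd n) (hlam n) (habar n).1 (hd n) hl
    (approxRate_le_rate ..) hr0 hr1 (by linarith)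
    ((inv_anti₀ (by linarith) hC₂.le).trans (hσ₀ n).1) (by linarith [(hσ₀ n).2])
    (mul_log_le_rate_sq hn (hlam n)) hcard (by rwa [div_le_iff₀' hc0] at hl10) hx
    (hx1.trans hβ) hβ (hμB n) (hμσ n)
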